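/- Work over $\mathbb{Q}$; CDGA means commutative differential graded algebra, graded by non-negative integers, with differential of degree $+1$. Let $n$ be odd and let $(A,d,\epsilon)$ be a $1$-connected (that is, $A^0=\mathbb{Q}$ and $A^1=0$) finite-dimensional Poincaré duality CDGA of formal dimension $n$: $\epsilon\colon A^n\to\mathbb{Q}$ is linear with $\epsilon(dA^{n-1})=0$, and for every $k$ and every $0\neq a\in A^k$ there is $b\in A^{n-k}$ with $\epsilon(ab)\neq 0$. Let $\{a_i\}$ be a homogeneous basis of $A$, $\{a_i^*\}$ its Poincaré dual basis ($\epsilon(a_ia_j^*)=\delta_{ij}$), and let $\Delta=\sum_i(-1)^{|a_i|}a_i\otimes a_i^*\in(A\otimes A)^n$ be the diagonal class. Let $\Delta^!\colon s^{-n}A\to A\otimes A$, $s^{-n}a\mapsto\Delta(1\otimes a)$, with mapping cone $C(\Delta^!)=(A\otimes A)\oplus ss^{-n}A$, where $ss^{-n}a$ has degree $|a|+n-1$. For $\xi\in(A\otimes A)^{2n-2}$ let $C(\xi)$ be the CDGA $C(\Delta^!)/C(\Delta^!)^{\geq 2n-1}$ whose multiplication is the one compatible with the $A\otimes A$-dgmodule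 structure and such that $(ss^{-n}1)\cdot(ss^{-n}1)=\xi$ (and $ss^{-n}x\cdot ss^{-n}y=0$ if $|x|+|y|>0$); it receives a canonical CDGA morphism $A\otimes A\to C(\xi)$. Write $C(\xi)\simeq_{A\otimes A}C(\xi')$ (weakly equivalent under $A\otimes A$) if there are a relative Sullivan algebra $A\otimes A\rightarrowtail(A\otimes A\otimes\Lambda Z,D)$ and CDGA quasi-isomorphisms from $(A\otimes A\otimes\Lambda Z,D)$ to $C(\xi)$ and to $C(\xi')$ whose restrictions to $A\otimes A$ are the canonical morphisms. Every $\xi\in(A\otimes A)^{2n-2}$ is a cocycle. If $\xi,\xi'\in(A\otimes A)^{2n-2}$ satisfy $[\xi]=[\xi']$ in $H^{2n-2}(A\otimes A)/([\Delta])$, where $([\Delta])$ is the ideal of $H^*(A\otimes A)$ generated by $[\Delta]$, then $C(\xi)\simeq_{A\otimes A}C(\xi')$. Consequently, $\simeq_{A\otimes A}$ being an equivalence relation on the family of CDGAs $C(\xi)$, there is a surjection $$\psi\colon H^{2n-2}(A\otimes A)/([\Delta])\longrightarrow\{C(\xi):\xi\in(A\otimes A)^{2n-2}\}/\simeq_{A\otimes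 A}$$ which sends the class of $\xi$ to the equivalence class of $C(\xi)$ for every $\xi\in(A\otimes A)^{2n-2}$. -/

import Mathlib

open scoped DirectSum TensorProduct

universe u

/-- A commutative differential graded algebra over `ℚ`: a graded algebra concentrated in
non-negative degrees, graded commutative, with a differential of degree `+1`. -/
structure CDGA where
  carrier : Type u
  [ring : Ring carrier]
  [algebra : Algebra ℚ carrier]
  gr : ℕ → Submodule ℚ carrier
  [gradedMonoid : SetLike.GradedMonoid gr]
  isInternal : DirectSum.IsInternal gr
  d : carrier →ₗ[ℚ] carrier
  d_mem : ∀ {k : ℕ} {a : carrier}, a ∈ gr k → d a ∈ gr (k + 1)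
  d_d : ∀ a : carrier, d (d a) = 0
  graded_comm : ∀ {p q : ℕ} {a b : carrier}, a ∈ gr p → b ∈ gr q →
    a * b = (-1 : ℚ) ^ (p * q) • (b * a)
  leibniz : ∀ {p : ℕ} {a : carrier}, a ∈ gr p → ∀ b : carrier,
    d (a * b) = d a * b + (-1 : ℚ) ^ p • (a * d b)

namespace CDGA

instance : CoeSort CDGA.{u} (Type u) := ⟨CDGA.carrier⟩

attribute [instance] CDGA.ring CDGA.algebra CDGA.gradedMonoid

noncomputable instance gradedAlgebra (A : CDGA.{u}) : GradedAlgebra A.gr :=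
  { A.gradedMonoid, A.isInternal.chooseDecomposition with }

/-- A family of subspaces that spans and admits separating projections is a direct sum
decomposition. -/
theorem isInternal_of_proj {M : Type u} [AddCommGroup M] [Module ℚ M] (G : ℕ → Submodule ℚ M)
    (π : ℕ → M →ₗ[ℚ] M) (h1 : ∀ k, ∀ x ∈ G k, π k x = x)
    (h2 : ∀ k j, j ≠ k → ∀ x ∈ G j, π k x = 0) (h3 : ⨆ k, G k = ⊤) :
    DirectSum.IsInternal G := by
  rw [DirectSum.isInternal_submodule_iff_iSupIndep_and_iSup_eq_top]
  refine ⟨?_, h3⟩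
  rw [iSupIndep_def]
  intro k
  rw [Submodule.disjoint_def]
  intro x hx hx'
  have : (⨆ j, ⨆ (_ : j ≠ k), G j) ≤ LinearMap.ker (π k) :=
    iSup_le fun j => iSup_le fun hj y hy => h2 k j hj y hy
  rw [← h1 k x hx]
  exact this hx'

section basic
variable (A : CDGA.{u})

/-- The projection onto the component of degree `k`. -/
noncomputable def proj (k : ℕ) : A →ₗ[ℚ] A :=
  (A.gr k).subtype ∘ₗ DirectSum.component ℚ ℕ (fun i => A.gr i) k ∘ₗ
    (DirectSum.decomposeLinearEquiv A.gr).toLinearMap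

theorem proj_mem (k : ℕ) (a : A) : A.proj k a ∈ A.gr k := by
  simp [proj]

theorem proj_same {k : ℕ} {a : A} (h : a ∈ A.gr k) : A.proj k a = a :=
  DirectSum.decompose_of_mem_same A.gr h

theorem proj_ne {k j : ℕ} (hj : j ≠ k) {a : A} (h : a ∈ A.gr j) : A.proj k a = 0 :=
  DirectSum.decompose_of_mem_ne A.gr h hj

theorem eq_zero_of_proj {a : A} (h : ∀ k, A.proj k a = 0) : a = 0 := by
  have : DirectSum.decompose A.gr a = 0 := by
    ext k
    exact h k
  exact (DirectSum.decomposeLinearEquiv A.gr).map_eq_zero_iff.1 this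

theorem iSup_gr : ⨆ k, A.gr k = ⊤ := A.isInternal.submodule_iSup_eq_top

/-- Linear maps that agree on homogeneous elements are equal. -/
theorem lin_ext {M : Type*} [AddCommGroup M] [Module ℚ M] {f g : A →ₗ[ℚ] M}
    (h : ∀ k, ∀ a ∈ A.gr k, f a = g a) : f = g := by
  refine DirectSum.decompose_lhom_ext A.gr fun k => ?_
  ext ⟨a, ha⟩
  exact h k a ha

/-- The degree involution `a ↦ (-1)^|a| a`. -/
noncomputable def sgn : A →ₗ[ℚ] A :=
  DirectSum.toModule ℚ ℕ A (fun k => (-1 : ℚ) ^ k • (A.gr k).subtype) ∘ₗ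
    (DirectSum.decomposeLinearEquiv A.gr).toLinearMap

theorem sgn_of_mem {k : ℕ} {a : A} (h : a ∈ A.gr k) : A.sgn a = (-1 : ℚ) ^ k • a := by
  simp only [sgn, LinearMap.comp_apply, LinearEquiv.coe_coe,
    DirectSum.decomposeLinearEquiv_apply]
  rw [DirectSum.decompose_of_mem A.gr h]
  erw [DirectSum.toModule_lof]
  simp

theorem leibniz_sgn (a b : A) : A.d (a * b) = A.d a * b + A.sgn a * A.d b := by
  have : (LinearMap.mul ℚ A).compr₂ A.d =
      (LinearMap.mul ℚ A).comp A.d + ((LinearMap.mul ℚ A).comp A.sgn).compl₂ A.d := by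
    refine A.lin_ext fun k a ha => ?_
    ext b
    simp [A.leibniz ha, A.sgn_of_mem ha]
  simpa using LinearMap.congr_fun₂ this a b

theorem d_sgn (a : A) : A.d (A.sgn a) = - A.sgn (A.d a) := by
  have : A.d ∘ₗ A.sgn = -(A.sgn ∘ₗ A.d) := by
    refine A.lin_ext fun k a ha => ?_
    simp [A.sgn_of_mem ha, A.sgn_of_mem (A.d_mem ha), pow_succ]
  simpa using LinearMap.congr_fun this a

theorem sgn_sgn (a : A) : A.sgn (A.sgn a) = a := by
  have : A.sgn ∘ₗ A.sgn = LinearMap.id := by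
    refine A.lin_ext fun k a ha => ?_
    simp [A.sgn_of_mem ha, smul_smul, ← mul_pow]
  simpa using LinearMap.congr_fun this a

theorem mul_mem {p q r : ℕ} {a b : A} (ha : a ∈ A.gr p) (hb : b ∈ A.gr q) (h : p + q = r) :
    a * b ∈ A.gr r := h ▸ SetLike.mul_mem_graded ha hb

theorem one_mem : (1 : A) ∈ A.gr 0 := SetLike.one_mem_graded A.gr

theorem d_one : A.d 1 = 0 := by
  have := A.leibniz A.one_mem 1
  simpa using this

end basic

/-- A morphism of CDGAs. -/
structure Hom (A B : CDGA.{u}) where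
  toAlgHom : A →ₐ[ℚ] B
  map_mem : ∀ {k : ℕ} {a : A}, a ∈ A.gr k → toAlgHom a ∈ B.gr k
  map_d : ∀ a : A, toAlgHom (A.d a) = B.d (toAlgHom a)

section tensor
variable (A B : CDGA.{u})

/-- The underlying algebra of the tensor product of two CDGAs, with the multiplication
`(a ⊗ b) (a' ⊗ b') = (-1)^(|b||a'|) aa' ⊗ bb'`. -/
abbrev T : Type u := GradedTensorProduct ℚ A.gr B.gr

variable {A B} in
/-- The pure tensor `a ⊗ b`. -/
noncomputable abbrev tm (a : A) (b : B) : T A B := GradedTensorProduct.tmul ℚ a b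

variable {A B} in
theorem tm_mul_tm {q p' : ℕ} (a : A) {b : B} (hb : b ∈ B.gr q) {a' : A} (ha' : a' ∈ A.gr p')
    (b' : B) : tm a b * tm a' b' = (-1 : ℚ) ^ (q * p') • tm (a * a') (b * b') := by
  have := GradedTensorProduct.tmul_coe_mul_coe_tmul (R := ℚ) A.gr B.gr a (⟨b, hb⟩ : B.gr q)
    (⟨a', ha'⟩ : A.gr p') b'
  refine this.trans ?_
  rcases Nat.even_or_odd (q * p') with h | h
  · rw [h.neg_one_pow]
    erw [h.neg_one_pow]
    simp
  · rw [h.neg_one_pow]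
    erw [h.neg_one_pow]
    simp

/-- The degree `k` part of the tensor product: the span of the `a ⊗ b` with `|a| + |b| = k`. -/
noncomputable def tensorGr (k : ℕ) : Submodule ℚ (T A B) :=
  Submodule.span ℚ {z | ∃ i j, i + j = k ∧ ∃ a ∈ A.gr i, ∃ b ∈ B.gr j, z = tm a b}

/-- `d (a ⊗ b) = da ⊗ b + (-1)^|a| a ⊗ db`. -/
noncomputable def tensorD : T A B →ₗ[ℚ] T A B :=
  (GradedTensorProduct.of ℚ A.gr B.gr).toLinearMap ∘ₗ
    (TensorProduct.map A.d LinearMap.id + TensorProduct.map A.sgn B.d) ∘ₗ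
    (GradedTensorProduct.of ℚ A.gr B.gr).symm.toLinearMap

variable {A B}

theorem tensorD_tm (a : A) (b : B) : tensorD A B (tm a b) = tm (A.d a) b + tm (A.sgn a) (B.d b) :=
  rfl

theorem tm_mem {i j k : ℕ} {a : A} {b : B} (ha : a ∈ A.gr i) (hb : b ∈ B.gr j) (h : i + j = k) :
    tm a b ∈ tensorGr A B k := Submodule.subset_span ⟨i, j, h, a, ha, b, hb, rfl⟩

theorem tm_smul_left (c : ℚ) (a : A) (b : B) : tm (c • a) b = c • tm a b := rfl

theorem tm_smul_right (c : ℚ) (a : A) (b : B) : tm a (c • b) = c • tm a b :=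
  TensorProduct.tmul_smul c a b

theorem tm_add_left (a a' : A) (b : B) : tm (a + a') b = tm a b + tm a' b :=
  TensorProduct.add_tmul a a' b

theorem tm_add_right (a : A) (b b' : B) : tm a (b + b') = tm a b + tm a b' :=
  TensorProduct.tmul_add a b b'

theorem tm_zero_left (b : B) : tm (0 : A) b = 0 := TensorProduct.zero_tmul _ b
theorem tm_zero_right (a : A) : tm a (0 : B) = 0 := TensorProduct.tmul_zero _ a

/-- Linear maps that agree on homogeneous pure tensors are equal. -/
theorem tensor_lin_ext {M : Type*} [AddCommGroup M] [Module ℚ M] {f g : T A B →ₗ[ℚ] M}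
    (h : ∀ i j, ∀ a ∈ A.gr i, ∀ b ∈ B.gr j, f (tm a b) = g (tm a b)) : f = g := by
  apply GradedTensorProduct.hom_ext
  apply TensorProduct.ext
  refine A.lin_ext fun i a ha => ?_
  refine B.lin_ext fun j b hb => ?_
  exact h i j a ha b hb

theorem tensorGr_ext {M : Type*} [AddCommGroup M] [Module ℚ M] {f g : T A B →ₗ[ℚ] M} {k : ℕ}
    (h : ∀ i j, i + j = k → ∀ a ∈ A.gr i, ∀ b ∈ B.gr j, f (tm a b) = g (tm a b))
    {z : T A B} (hz : z ∈ tensorGr A B k) : f z = g z := by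
  have : tensorGr A B k ≤ LinearMap.eqLocus f g := by
    refine Submodule.span_le.2 ?_
    rintro _ ⟨i, j, hij, a, ha, b, hb, rfl⟩
    exact h i j hij a ha b hb
  exact this hz

theorem tensor_iSup : ⨆ k, tensorGr A B k = ⊤ := by
  rw [eq_top_iff]
  have key : (⨆ k, tensorGr A B k).mkQ = 0 := by
    refine tensor_lin_ext fun i j a ha b hb => ?_
    simp only [LinearMap.zero_apply, Submodule.mkQ_apply, Submodule.Quotient.mk_eq_zero]
    exact Submodule.mem_iSup_of_mem (i + j) (tm_mem ha hb rfl)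
  intro z _
  rw [← Submodule.Quotient.mk_eq_zero]
  exact LinearMap.congr_fun key z

variable (A B) in
noncomputable def tensorProj (k : ℕ) : T A B →ₗ[ℚ] T A B :=
  (GradedTensorProduct.of ℚ A.gr B.gr).toLinearMap ∘ₗ
    (∑ x ∈ Finset.HasAntidiagonal.antidiagonal k, TensorProduct.map (A.proj x.1) (B.proj x.2)) ∘ₗ
    (GradedTensorProduct.of ℚ A.gr B.gr).symm.toLinearMap

theorem tensorProj_tm (k : ℕ) (a : A) (b : B) : tensorProj A B k (tm a b) =
    ∑ x ∈ Finset.HasAntidiagonal.antidiagonal k, tm (A.proj x.1 a) (B.proj x.2 b) := by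
  simp [tensorProj, tm, GradedTensorProduct.tmul]

theorem tensorProj_same {i j : ℕ} {a : A} (ha : a ∈ A.gr i) {b : B} (hb : b ∈ B.gr j) :
    tensorProj A B (i + j) (tm a b) = tm a b := by
  rw [tensorProj_tm, Finset.sum_eq_single (i, j)]
  · simp only [A.proj_same ha, B.proj_same hb]
  · rintro ⟨p, q⟩ hpq hne
    by_cases hp : i = p
    · subst hp
      have : j = q := by
        have := Finset.HasAntidiagonal.mem_antidiagonal.1 hpq
        simp only at this; omega
      simp_all
    · simp only [A.proj_ne hp ha]; exact tm_zero_left _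
  · simp

theorem tensorProj_ne {i j k : ℕ} (h : i + j ≠ k) {a : A} (ha : a ∈ A.gr i) {b : B}
    (hb : b ∈ B.gr j) : tensorProj A B k (tm a b) = 0 := by
  rw [tensorProj_tm]
  refine Finset.sum_eq_zero ?_
  rintro ⟨p, q⟩ hpq
  by_cases hp : i = p
  · have hq : j ≠ q := by
      rintro rfl; subst hp; exact h (by simpa using hpq)
    simp only [B.proj_ne hq hb]; exact tm_zero_right _
  · simp only [A.proj_ne hp ha]; exact tm_zero_left _

theorem tensor_isInternal : DirectSum.IsInternal (tensorGr A B) := by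
  refine isInternal_of_proj _ (tensorProj A B) ?_ ?_ tensor_iSup
  · intro k x hx
    refine tensorGr_ext (f := tensorProj A B k) (g := LinearMap.id) ?_ hx
    rintro i j rfl a ha b hb
    exact tensorProj_same ha hb
  · intro k j hj x hx
    refine tensorGr_ext (f := tensorProj A B k) (g := 0) ?_ hx
    rintro p q rfl a ha b hb
    exact tensorProj_ne hj ha hb

theorem tensorD_mem {k : ℕ} {z : T A B} (hz : z ∈ tensorGr A B k) :
    tensorD A B z ∈ tensorGr A B (k + 1) := by
  have : tensorGr A B k ≤ (tensorGr A B (k + 1)).comap (tensorD A B) := by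
    refine Submodule.span_le.2 ?_
    rintro _ ⟨i, j, rfl, a, ha, b, hb, rfl⟩
    change tensorD A B (tm a b) ∈ tensorGr A B (i + j + 1)
    rw [tensorD_tm, A.sgn_of_mem ha, tm_smul_left]
    exact add_mem (tm_mem (A.d_mem ha) hb (by omega))
      (Submodule.smul_mem _ _ (tm_mem ha (B.d_mem hb) (by omega)))
  exact this hz

theorem tensorD_tensorD (z : T A B) : tensorD A B (tensorD A B z) = 0 := by
  have : tensorD A B ∘ₗ tensorD A B = 0 := by
    refine tensor_lin_ext fun i j a ha b hb => ?_
    simp only [LinearMap.comp_apply, tensorD_tm, map_add, A.d_d, B.d_d, tm_zero_left,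
      tm_zero_right, A.d_sgn, LinearMap.zero_apply, zero_add, add_zero]
    rw [← tm_add_left, add_neg_cancel, tm_zero_left]
  exact LinearMap.congr_fun this z

instance tensorGradedMonoid : SetLike.GradedMonoid (tensorGr A B) where
  one_mem := tm_mem A.one_mem B.one_mem rfl
  mul_mem := by
    intro k l z w hz hw
    have h1 : ∀ i j, i + j = k → ∀ a ∈ A.gr i, ∀ b ∈ B.gr j,
        tensorGr A B l ≤ (tensorGr A B (k + l)).comap (LinearMap.mul ℚ (T A B) (tm a b)) := by
      intro i j hij a ha b hb
      refine Submodule.span_le.2 ?_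
      rintro _ ⟨i', j', hij', a', ha', b', hb', rfl⟩
      change tm a b * tm a' b' ∈ tensorGr A B (k + l)
      rw [tm_mul_tm a hb ha' b']
      exact Submodule.smul_mem _ _
        (tm_mem (A.mul_mem ha ha' rfl) (B.mul_mem hb hb' rfl) (by omega))
    have h2 : tensorGr A B k ≤
        (tensorGr A B (k + l)).comap ((LinearMap.mul ℚ (T A B)).flip w) := by
      refine Submodule.span_le.2 ?_
      rintro _ ⟨i, j, hij, a, ha, b, hb, rfl⟩
      exact h1 i j hij a ha b hb hw
    exact h2 hz

theorem tensor_comm {p q : ℕ} {z w : T A B} (hz : z ∈ tensorGr A B p) (hw : w ∈ tensorGr A B q) :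
    z * w = (-1 : ℚ) ^ (p * q) • (w * z) := by
  refine tensorGr_ext (f := (LinearMap.mul ℚ (T A B)).flip w)
    (g := (-1 : ℚ) ^ (p * q) • LinearMap.mul ℚ (T A B) w) ?_ hz
  rintro i j rfl a ha b hb
  refine tensorGr_ext (f := LinearMap.mul ℚ (T A B) (tm a b))
    (g := (-1 : ℚ) ^ ((i + j) * q) • (LinearMap.mul ℚ (T A B)).flip (tm a b)) ?_ hw
  rintro i' j' rfl a' ha' b' hb'
  simp only [LinearMap.mul_apply', LinearMap.smul_apply, LinearMap.flip_apply]
  rw [tm_mul_tm a hb ha' b', tm_mul_tm a' hb' ha b, A.graded_comm ha ha', B.graded_comm hb hb',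
    tm_smul_left, tm_smul_right, smul_smul, smul_smul, smul_smul]
  congr 1
  have h1 : ∀ m : ℕ, ((-1 : ℚ) ^ m) * (-1) ^ m = 1 := fun m => by rw [← mul_pow]; simp
  have e : (i + j) * (i' + j') = i * i' + j * j' + j * i' + j' * i := by ring
  rw [e]
  simp only [pow_add]
  linear_combination (-((-1 : ℚ) ^ (i * i') * (-1) ^ (j * j') * (-1) ^ (j * i'))) * h1 (j' * i)

theorem tensor_leibniz {p : ℕ} {z : T A B} (hz : z ∈ tensorGr A B p) (w : T A B) :
    tensorD A B (z * w) = tensorD A B z * w + (-1 : ℚ) ^ p • (z * tensorD A B w) := by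
  refine tensorGr_ext (f := tensorD A B ∘ₗ (LinearMap.mul ℚ (T A B)).flip w)
    (g := (LinearMap.mul ℚ (T A B)).flip w ∘ₗ tensorD A B +
      (-1 : ℚ) ^ p • (LinearMap.mul ℚ (T A B)).flip (tensorD A B w)) ?_ hz
  rintro i j rfl a ha b hb
  have : tensorD A B ∘ₗ LinearMap.mul ℚ (T A B) (tm a b) =
      LinearMap.mul ℚ (T A B) (tensorD A B (tm a b)) +
      (-1 : ℚ) ^ (i + j) • (LinearMap.mul ℚ (T A B) (tm a b) ∘ₗ tensorD A B) := by
    refine tensor_lin_ext fun i' j' a' ha' b' hb' => ?_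
    simp only [LinearMap.comp_apply, LinearMap.add_apply, LinearMap.smul_apply,
      LinearMap.mul_apply', tensorD_tm, A.sgn_of_mem ha, A.sgn_of_mem ha', tm_smul_left,
      mul_add, add_mul, smul_mul_assoc, mul_smul_comm]
    rw [tm_mul_tm a hb ha' b', tm_mul_tm _ hb ha' b', tm_mul_tm a (B.d_mem hb) ha' b',
      tm_mul_tm a hb (A.d_mem ha') b', tm_mul_tm a hb ha' (B.d b'), map_smul, tensorD_tm,
      A.sgn_of_mem (A.mul_mem ha ha' rfl), A.leibniz ha, B.leibniz hb, tm_add_left, tm_add_right,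
      tm_smul_left _ (a * A.d a') (b * b'), tm_smul_left _ (a * a') (B.d b * b'), tm_smul_right, tm_smul_left _ (a * a') (b * B.d b')]
    simp only [smul_add, smul_smul]
    have h1 : ∀ m : ℕ, ((-1 : ℚ) ^ m) * (-1) ^ m = 1 := fun m => by rw [← mul_pow]; simp
    have e1 : (-1 : ℚ) ^ (j * i') * (-1) ^ (i + i') = (-1) ^ i * (-1) ^ ((j + 1) * i') := by
      rw [add_mul, pow_add, pow_add, one_mul]; ring
    have e2 : (-1 : ℚ) ^ (j * i') * (-1) ^ i = (-1) ^ (i + j) * (-1) ^ (j * (i' + 1)) := by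
      rw [mul_add, pow_add, pow_add, mul_one]
      linear_combination (-(-1 : ℚ) ^ (j * i') * (-1) ^ i) * h1 j
    have e3 : (-1 : ℚ) ^ (j * i') * ((-1) ^ j * (-1) ^ (i + i')) =
        (-1) ^ (i + j) * ((-1) ^ i' * (-1) ^ (j * i')) := by
      rw [pow_add, pow_add]; ring
    rw [e1, e2, e3]
    abel
  exact LinearMap.congr_fun this w

variable (A B) in
/-- The tensor product of two CDGAs. -/
noncomputable def tensor : CDGA.{u} where
  carrier := T A B
  gr := tensorGr A B
  isInternal := tensor_isInternal
  d := tensorD A B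
  d_mem := tensorD_mem
  d_d := tensorD_tensorD
  graded_comm := tensor_comm
  leibniz := tensor_leibniz

/-- The pure tensor `a ⊗ b` as an element of the CDGA `A ⊗ B`. -/
noncomputable def ot (a : A) (b : B) : A.tensor B := tm a b

theorem ot_mul_ot {q p' : ℕ} (a : A) {b : B} (hb : b ∈ B.gr q) {a' : A} (ha' : a' ∈ A.gr p')
    (b' : B) : ot a b * ot a' b' = (-1 : ℚ) ^ (q * p') • ot (a * a') (b * b') :=
  tm_mul_tm a hb ha' b'

theorem d_ot {i : ℕ} {a : A} (ha : a ∈ A.gr i) (b : B) :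
    (A.tensor B).d (ot a b) = ot (A.d a) b + (-1 : ℚ) ^ i • ot a (B.d b) := by
  refine (tensorD_tm a b).trans ?_
  rw [A.sgn_of_mem ha]; rfl

theorem ot_mem {i j k : ℕ} {a : A} {b : B} (ha : a ∈ A.gr i) (hb : b ∈ B.gr j) (h : i + j = k) :
    ot a b ∈ (A.tensor B).gr k := tm_mem ha hb h

theorem ot_one : ot (1 : A) (1 : B) = 1 := rfl

variable (A B) in
/-- `(a, b) ↦ a ⊗ b` as a bilinear map. -/
noncomputable def otₗ : A →ₗ[ℚ] B →ₗ[ℚ] A.tensor B :=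
  LinearMap.mk₂ ℚ ot tm_add_left tm_smul_left tm_add_right tm_smul_right

theorem otₗ_apply (a : A) (b : B) : otₗ A B a b = ot a b := rfl

theorem ot_lin_ext {M : Type*} [AddCommGroup M] [Module ℚ M] {f g : A.tensor B →ₗ[ℚ] M}
    (h : ∀ i j, ∀ a ∈ A.gr i, ∀ b ∈ B.gr j, f (ot a b) = g (ot a b)) : f = g :=
  tensor_lin_ext h

theorem ot_gr_le {k : ℕ} {S : Submodule ℚ (A.tensor B)}
    (h : ∀ i j, i + j = k → ∀ a ∈ A.gr i, ∀ b ∈ B.gr j, ot a b ∈ S) : (A.tensor B).gr k ≤ S := by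
  refine Submodule.span_le.2 ?_
  rintro _ ⟨i, j, hij, a, ha, b, hb, rfl⟩
  exact h i j hij a ha b hb

end tensor
section cohomology
variable (A : CDGA.{u})

/-- The algebra of cocycles. -/
noncomputable def cocycles : Subalgebra ℚ A where
  carrier := {a | A.d a = 0}
  mul_mem' := by
    intro a b ha hb
    simp only [Set.mem_ofPred_eq] at *
    rw [A.leibniz_sgn, ha, hb, zero_mul, mul_zero, add_zero]
  add_mem' := by
    intro a b ha hb
    simp only [Set.mem_ofPred_eq] at *
    rw [map_add, ha, hb, add_zero]
  algebraMap_mem' := by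
    intro r
    simp only [Set.mem_ofPred_eq, Algebra.algebraMap_eq_smul_one, map_smul, A.d_one, smul_zero]

theorem mem_cocycles {a : A} : a ∈ A.cocycles ↔ A.d a = 0 := Iff.rfl

/-- The ideal of coboundaries in the algebra of cocycles. -/
noncomputable def coboundaries : Ideal A.cocycles where
  carrier := {z | ∃ a : A, A.d a = z}
  add_mem' := by
    rintro _ _ ⟨a, ha⟩ ⟨b, hb⟩
    exact ⟨a + b, by rw [map_add, ha, hb]; rfl⟩
  zero_mem' := ⟨0, by simp⟩
  smul_mem' := by
    rintro ⟨c, hc⟩ _ ⟨b, hb⟩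
    refine ⟨A.sgn c * b, ?_⟩
    rw [A.leibniz_sgn, A.d_sgn, A.mem_cocycles.1 hc, A.sgn_sgn, hb]
    simp

instance : (A.coboundaries).IsTwoSided where
  mul_mem_of_left := by
    rintro _ ⟨c, hc⟩ ⟨b, hb⟩
    refine ⟨b * c, ?_⟩
    rw [A.leibniz_sgn, A.mem_cocycles.1 hc, hb]
    simp

/-- The cohomology algebra `H(A) = ker d / im d`. -/
abbrev H : Type u := A.cocycles ⧸ A.coboundaries

/-- The cohomology class of a cocycle. -/
noncomputable def cls (z : A.cocycles) : A.H := Ideal.Quotient.mk A.coboundaries z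

/-- The degree `k` cohomology `H^k(A)`: the classes of the cocycles of degree `k`. -/
noncomputable def Hgr (k : ℕ) : Submodule ℚ A.H :=
  ((A.gr k).comap A.cocycles.val.toLinearMap).map
    (Ideal.Quotient.mkₐ ℚ A.coboundaries).toLinearMap

theorem cls_mem {k : ℕ} {z : A.cocycles} (hz : (z : A) ∈ A.gr k) : A.cls z ∈ A.Hgr k :=
  ⟨z, hz, rfl⟩

/-- The degree `k` part of the quotient of `H(A)` by the ideal generated by a class `c`.
For a homogeneous class `c` left and two-sided ideals agree, by graded commutativity. -/
abbrev HgrMod (k : ℕ) (c : A.H) : Type u :=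
  A.Hgr k ⧸ ((Ideal.span {c}).restrictScalars ℚ).comap (A.Hgr k).subtype

end cohomology

namespace Hom

variable {A B C : CDGA.{u}}

/-- The map induced on cocycles. -/
noncomputable def onCocycles (f : Hom A B) : A.cocycles →+* B.cocycles :=
  RingHom.codRestrict (f.toAlgHom.toRingHom.comp A.cocycles.val.toRingHom) B.cocycles (by
    rintro ⟨z, hz⟩
    change B.d (f.toAlgHom z) = 0
    rw [← f.map_d, A.mem_cocycles.1 hz, map_zero])

/-- The map induced on cohomology. -/
noncomputable def onH (f : Hom A B) : A.H →+* B.H :=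
  Ideal.quotientMap B.coboundaries f.onCocycles (by
    rintro ⟨z, hz⟩ ⟨a, ha⟩
    exact ⟨f.toAlgHom a, by rw [← f.map_d, ha]; rfl⟩)

/-- A morphism of CDGAs is a quasi-isomorphism if it induces an isomorphism on cohomology. -/
def IsQuasiIso (f : Hom A B) : Prop := Function.Bijective f.onH

end Hom

section Free

/-- The relations `v ⊗ w = (-1)^(|v||w|) w ⊗ v` in the tensor algebra of a graded vector space. -/
inductive FreeRel (V : ℕ → Type u) [∀ p, AddCommGroup (V p)] [∀ p, Module ℚ (V p)] :
    TensorAlgebra ℚ (⨁ p, V p) → TensorAlgebra ℚ (⨁ p, V p) → Prop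
  | swap (p q : ℕ) (v : V p) (w : V q) :
      FreeRel V
        (TensorAlgebra.ι ℚ (DirectSum.lof ℚ ℕ V p v) * TensorAlgebra.ι ℚ (DirectSum.lof ℚ ℕ V q w))
        ((-1 : ℚ) ^ (p * q) •
          (TensorAlgebra.ι ℚ (DirectSum.lof ℚ ℕ V q w) *
            TensorAlgebra.ι ℚ (DirectSum.lof ℚ ℕ V p v)))

/-- The free graded commutative algebra `ΛV` on a graded vector space `V`. -/
abbrev FreeCGA (V : ℕ → Type u) [∀ p, AddCommGroup (V p)] [∀ p, Module ℚ (V p)] : Type u :=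
  RingQuot (FreeRel V)

variable {M : CDGA.{u}}

/-- For a graded subspace `V` of `M`, the algebra morphism `ΛV → M` extending the inclusion. -/
noncomputable def freeLift (V : ℕ → Submodule ℚ M) (hV : ∀ p, V p ≤ M.gr p) :
    FreeCGA (fun p => V p) →ₐ[ℚ] M :=
  RingQuot.liftAlgHom ℚ ⟨TensorAlgebra.lift ℚ
    (DirectSum.toModule ℚ ℕ M (fun p => (V p).subtype)), by
      rintro _ _ ⟨p, q, v, w⟩
      simp only [map_mul, map_smul, TensorAlgebra.lift_ι_apply, DirectSum.toModule_lof]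
      exact M.graded_comm (hV p v.2) (hV q w.2)⟩

end Free

namespace Hom

variable {R M : CDGA.{u}}

/-- The multiplication map `R ⊗ ΛV → M`, `r ⊗ w ↦ i(r) w`. -/
noncomputable def mulFree (i : Hom R M) (V : ℕ → Submodule ℚ M) (hV : ∀ p, V p ≤ M.gr p) :
    R ⊗[ℚ] FreeCGA (fun p => V p) →ₗ[ℚ] M :=
  TensorProduct.lift
    ((LinearMap.mul ℚ M).compl₁₂ i.toAlgHom.toLinearMap (freeLift V hV).toLinearMap)

/-- `i : R → M` exhibits `M` as a relative Sullivan algebra `(R ⊗ ΛV, D)` over `R`: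
`H^0(R) = ℚ`, and there is a graded subspace `V` of `M`, concentrated in positive degrees, such
that `M = R ⊗ ΛV` as a graded algebra, and `V` is the union of an increasing sequence
`F 0 ⊆ F 1 ⊆ ...` of graded subspaces with `D (F 0) ⊆ R` and `D (F (k + 1)) ⊆ R ⊗ Λ(F k)`. -/
def IsRelativeSullivan (i : Hom R M) : Prop :=
  (Nontrivial R ∧ ∀ x ∈ R.gr 0, R.d x = 0 → ∃ c : ℚ, x = algebraMap ℚ R c) ∧
  ∃ (V : ℕ → Submodule ℚ M) (hV : ∀ p, V p ≤ M.gr p),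
    V 0 = ⊥ ∧
    Function.Bijective (i.mulFree V hV) ∧
    ∃ F : ℕ → ℕ → Submodule ℚ M,
      (∀ k p, F k p ≤ F (k + 1) p) ∧
      (∀ p, ⨆ k, F k p = V p) ∧
      (∀ p, ∀ v ∈ F 0 p, M.d v ∈ i.toAlgHom.range) ∧
      (∀ k p, ∀ v ∈ F (k + 1) p,
        M.d v ∈ i.toAlgHom.range ⊔ Algebra.adjoin ℚ (⋃ q, (F k q : Set M)))

end Hom

/-- Two CDGAs under `R` are weakly equivalent under `R` if there are a relative Sullivan algebra
`R → M` and quasi-isomorphisms from `M` to both of them, compatible with the maps from `R`. -/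
def WeakEquivUnder {R Q Q' : CDGA.{u}} (f : Hom R Q) (g : Hom R Q') : Prop :=
  ∃ (M : CDGA.{u}) (i : Hom R M) (α : Hom M Q) (β : Hom M Q'),
    i.IsRelativeSullivan ∧ α.IsQuasiIso ∧ β.IsQuasiIso ∧
    (∀ r, α.toAlgHom (i.toAlgHom r) = f.toAlgHom r) ∧
    (∀ r, β.toAlgHom (i.toAlgHom r) = g.toAlgHom r)

/-- `A` is 1-connected: `A^0 = ℚ` and `A^1 = 0`. -/
structure OneConnected (A : CDGA.{u}) : Prop where
  nontrivial : Nontrivial A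
  gr_zero : ∀ a ∈ A.gr 0, ∃ c : ℚ, a = algebraMap ℚ A c
  gr_one : A.gr 1 = ⊥

/-- The data and axioms that turn a (finite-dimensional) CDGA `A` into a Poincaré duality CDGA of
formal dimension `n`. The orientation `A^n → ℚ` is extended by zero to the other degrees. -/
structure PoincareDuality (A : CDGA.{u}) (n : ℕ) where
  finite : Module.Finite ℚ A
  ε : A →ₗ[ℚ] ℚ
  ε_of_ne : ∀ k, k ≠ n → ∀ a ∈ A.gr k, ε a = 0
  ε_d : ∀ a, ε (A.d a) = 0
  nondeg : ∀ k, ∀ a ∈ A.gr k, a ≠ 0 → ∃ j, k + j = n ∧ ∃ b ∈ A.gr j, ε (a * b) ≠ 0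

/-- A homogeneous basis of `A` with `N` elements. -/
structure HomogeneousBasis (A : CDGA.{u}) (N : ℕ) where
  a : Module.Basis (Fin N) ℚ A
  deg : Fin N → ℕ
  a_mem : ∀ i, a i ∈ A.gr (deg i)

namespace PoincareDuality
variable {A : CDGA.{u}} {n N : ℕ} (P : A.PoincareDuality n)

/-- The bilinear form `(a, b) ↦ ε(b a)`. -/
noncomputable def form : LinearMap.BilinForm ℚ A := ((LinearMap.mul ℚ A).compr₂ P.ε).flip

theorem form_apply (a b : A) : P.form a b = P.ε (b * a) := rfl

theorem ε_mul_comm {p q : ℕ} {a b : A} (ha : a ∈ A.gr p) (hb : b ∈ A.gr q) :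
    P.ε (a * b) = (-1 : ℚ) ^ (p * q) * P.ε (b * a) := by
  rw [A.graded_comm ha hb, map_smul, smul_eq_mul]

/-- `ε(a b)` only sees the component of `b` of complementary degree. -/
theorem ε_mul_proj {p q : ℕ} (h : p + q = n) {a : A} (ha : a ∈ A.gr p) (b : A) :
    P.ε (a * A.proj q b) = P.ε (a * b) := by
  have : P.ε ∘ₗ LinearMap.mul ℚ A a ∘ₗ A.proj q = P.ε ∘ₗ LinearMap.mul ℚ A a := by
    refine A.lin_ext fun k b hb => ?_
    simp only [LinearMap.comp_apply, LinearMap.mul_apply']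
    by_cases hk : k = q
    · subst hk; rw [A.proj_same hb]
    · rw [A.proj_ne hk hb, mul_zero, map_zero]
      exact (P.ε_of_ne (p + k) (by omega) _ (A.mul_mem ha hb rfl)).symm
  exact LinearMap.congr_fun this b

theorem ε_proj_mul {p q : ℕ} (h : p + q = n) (a : A) {b : A} (hb : b ∈ A.gr q) :
    P.ε (A.proj p a * b) = P.ε (a * b) := by
  have : P.ε ∘ₗ (LinearMap.mul ℚ A).flip b ∘ₗ A.proj p = P.ε ∘ₗ (LinearMap.mul ℚ A).flip b := by
    refine A.lin_ext fun k a ha => ?_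
    simp only [LinearMap.comp_apply, LinearMap.mul_apply', LinearMap.flip_apply]
    by_cases hk : k = p
    · subst hk; rw [A.proj_same ha]
    · rw [A.proj_ne hk ha, zero_mul, map_zero]
      exact (P.ε_of_ne (k + q) (by omega) _ (A.mul_mem ha hb rfl)).symm
  exact LinearMap.congr_fun this a

theorem eq_zero_of_left {a : A} (h : ∀ b, P.ε (a * b) = 0) : a = 0 := by
  refine A.eq_zero_of_proj fun k => ?_
  by_contra hne
  obtain ⟨j, hj, b, hb, hb'⟩ := P.nondeg k _ (A.proj_mem k a) hne
  exact hb' (by rw [P.ε_proj_mul hj a hb, h b])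

theorem eq_zero_of_right {a : A} (h : ∀ b, P.ε (b * a) = 0) : a = 0 := by
  refine A.eq_zero_of_proj fun k => ?_
  by_contra hne
  obtain ⟨j, hj, b, hb, hb'⟩ := P.nondeg k _ (A.proj_mem k a) hne
  apply hb'
  rw [P.ε_mul_comm (A.proj_mem k a) hb, P.ε_mul_proj (by omega) hb a, h b, mul_zero]

theorem form_nondegenerate : P.form.Nondegenerate := by
  constructor
  · intro a h
    exact P.eq_zero_of_right fun b => h b
  · intro a h
    exact P.eq_zero_of_left fun b => h b

/-- The Poincaré dual basis, characterised by `ε(a_i a_j^*) = δ_ij`. -/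
noncomputable def dualBasis (b : A.HomogeneousBasis N) : Module.Basis (Fin N) ℚ A :=
  P.form.dualBasis P.form_nondegenerate b.a

theorem ε_dualBasis (b : A.HomogeneousBasis N) (i j : Fin N) :
    P.ε (b.a i * P.dualBasis b j) = if i = j then 1 else 0 :=
  P.form.apply_dualBasis_left P.form_nondegenerate b.a j i

/-- The diagonal class `Δ = ∑ (-1)^|a_i| a_i ⊗ a_i^*`. -/
noncomputable def diag (b : A.HomogeneousBasis N) : A.tensor A :=
  ∑ i, (-1 : ℚ) ^ b.deg i • ot (b.a i) (P.dualBasis b i)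

end PoincareDuality
section mulHom
variable (A : CDGA.{u})

/-- The multiplication map `A ⊗ A → A`, `a ⊗ b ↦ ab`. It is multiplicative because `A` is graded
commutative. -/
noncomputable def m : A.tensor A →ₐ[ℚ] A :=
  GradedTensorProduct.lift A.gr A.gr (AlgHom.id ℚ A) (AlgHom.id ℚ A) (by
    intro i j a b
    have := A.graded_comm a.2 b.2
    simp only [AlgHom.coe_id, id_eq]
    rw [this, mul_comm i j]
    rcases Nat.even_or_odd (j * i) with h | h
    · rw [h.neg_one_pow]
      erw [h.neg_one_pow]
      simp
    · rw [h.neg_one_pow]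
      erw [h.neg_one_pow]
      simp)

theorem m_ot (a b : A) : A.m (ot a b) = a * b := rfl

/-- The left action of `A ⊗ A` on `A` through the multiplication:
`(a ⊗ y) · x = (-1)^(|y||x|) a x y`. -/
theorem m_ot_mul {q r : ℕ} (a : A) {y x : A} (hy : y ∈ A.gr q) (hx : x ∈ A.gr r) :
    A.m (ot a y) * x = (-1 : ℚ) ^ (q * r) • (a * x * y) := by
  rw [m_ot, mul_assoc, A.graded_comm hy hx, mul_smul_comm, mul_assoc]

/-- The right action of `A ⊗ A` on `A` through the multiplication:
`x · (a ⊗ y) = (-1)^(|a||x|) a x y`. -/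
theorem mul_m_ot {p r : ℕ} {a x : A} (y : A) (ha : a ∈ A.gr p) (hx : x ∈ A.gr r) :
    x * A.m (ot a y) = (-1 : ℚ) ^ (p * r) • (a * x * y) := by
  rw [m_ot, ← mul_assoc, A.graded_comm hx ha, smul_mul_assoc, mul_comm r p]

theorem m_mem {k : ℕ} {z : A.tensor A} (hz : z ∈ (A.tensor A).gr k) : A.m z ∈ A.gr k := by
  have : (A.tensor A).gr k ≤ (A.gr k).comap A.m.toLinearMap :=
    ot_gr_le fun i j hij a ha b hb => A.mul_mem ha hb hij
  exact this hz

theorem m_d (z : A.tensor A) : A.m ((A.tensor A).d z) = A.d (A.m z) := by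
  have : A.m.toLinearMap ∘ₗ (A.tensor A).d = A.d ∘ₗ A.m.toLinearMap := by
    refine ot_lin_ext fun i j a ha b hb => ?_
    simp only [LinearMap.comp_apply, AlgHom.toLinearMap_apply]
    rw [d_ot ha, map_add, map_smul, m_ot, m_ot, m_ot, A.leibniz ha b]
  exact LinearMap.congr_fun this z

end mulHom

namespace PoincareDuality
variable {A : CDGA.{u}} {n N : ℕ} (P : A.PoincareDuality n) (b : A.HomogeneousBasis N)

theorem gr_eq_zero (P : A.PoincareDuality n) {k : ℕ} (hk : n < k) {a : A} (ha : a ∈ A.gr k) : a = 0 := by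
  by_contra hne
  obtain ⟨j, hj, -⟩ := P.nondeg k a ha hne
  omega

theorem deg_le (P : A.PoincareDuality n) (i : Fin N) : b.deg i ≤ n := by
  by_contra h
  exact b.a.ne_zero i (P.gr_eq_zero (by omega) (b.a_mem i))

theorem dualBasis_mem (j : Fin N) : P.dualBasis b j ∈ A.gr (n - b.deg j) := by
  have hj := P.deg_le b j
  have : P.dualBasis b j - A.proj (n - b.deg j) (P.dualBasis b j) = 0 := by
    refine P.eq_zero_of_right fun x => ?_
    have h0 : P.ε ∘ₗ (LinearMap.mul ℚ A).flip
        (P.dualBasis b j - A.proj (n - b.deg j) (P.dualBasis b j)) = 0 := by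
      refine b.a.ext fun i => ?_
      change P.ε (b.a i * (P.dualBasis b j - A.proj (n - b.deg j) (P.dualBasis b j))) = 0
      rw [mul_sub, map_sub]
      by_cases hi : b.deg i = b.deg j
      · rw [P.ε_mul_proj (by omega) (b.a_mem i), sub_self]
      · have hij : i ≠ j := fun h => hi (by rw [h])
        have hi' := P.deg_le b i
        rw [P.ε_dualBasis, if_neg hij, P.ε_of_ne (b.deg i + (n - b.deg j)) (by omega) _
          (A.mul_mem (b.a_mem i) (A.proj_mem _ _) rfl), sub_zero]
    exact LinearMap.congr_fun h0 x
  rw [sub_eq_zero.1 this]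
  exact A.proj_mem _ _

theorem expand_left (x : A) : ∑ j, P.ε (x * P.dualBasis b j) • b.a j = x := by
  conv_rhs => rw [← b.a.sum_repr x]
  refine Finset.sum_congr rfl fun j _ => ?_
  congr 1
  conv_lhs => rw [← b.a.sum_repr x]
  rw [Finset.sum_mul, map_sum, Finset.sum_eq_single j]
  · rw [smul_mul_assoc, map_smul, P.ε_dualBasis, if_pos rfl, smul_eq_mul, mul_one]
  · intro i _ hij
    rw [smul_mul_assoc, map_smul, P.ε_dualBasis, if_neg hij, smul_zero]
  · simp

theorem expand_right (x : A) : ∑ j, P.ε (b.a j * x) • P.dualBasis b j = x := by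
  conv_rhs => rw [← (P.dualBasis b).sum_repr x]
  refine Finset.sum_congr rfl fun j _ => ?_
  congr 1
  exact (P.form.dualBasis_repr_apply P.form_nondegenerate b.a x j).symm

theorem diag_mem : P.diag b ∈ (A.tensor A).gr n := by
  refine Submodule.sum_mem _ fun i _ => Submodule.smul_mem _ _ ?_
  have := P.deg_le b i
  exact ot_mem (b.a_mem i) (P.dualBasis_mem b i) (by omega)

/-- The diagonal class is a cocycle. -/
theorem d_diag : (A.tensor A).d (P.diag b) = 0 := by
  have h1 : ∀ m : ℕ, ((-1 : ℚ) ^ m) * (-1) ^ m = 1 := fun m => by rw [← mul_pow]; simp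
  have e : ∀ i, (A.tensor A).d ((-1 : ℚ) ^ b.deg i • ot (b.a i) (P.dualBasis b i)) =
      (∑ j, ((-1 : ℚ) ^ b.deg i * P.ε (A.d (b.a i) * P.dualBasis b j)) •
        ot (b.a j) (P.dualBasis b i)) +
      ∑ j, P.ε (b.a j * A.d (P.dualBasis b i)) • ot (b.a i) (P.dualBasis b j) := by
    intro i
    rw [map_smul, d_ot (b.a_mem i), smul_add, smul_smul, h1, one_smul]
    congr 1
    · conv_lhs => rw [← P.expand_left b (A.d (b.a i))]
      rw [← otₗ_apply, map_sum, LinearMap.sum_apply, Finset.smul_sum]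
      refine Finset.sum_congr rfl fun j _ => ?_
      rw [map_smul, LinearMap.smul_apply, smul_smul, otₗ_apply]
    · conv_lhs => rw [← P.expand_right b (A.d (P.dualBasis b i))]
      rw [← otₗ_apply, map_sum]
      refine Finset.sum_congr rfl fun j _ => ?_
      rw [map_smul, otₗ_apply]
  rw [diag, map_sum, Finset.sum_congr rfl fun i _ => e i, Finset.sum_add_distrib,
    Finset.sum_comm, ← Finset.sum_add_distrib]
  refine Finset.sum_eq_zero fun j _ => ?_
  rw [← Finset.sum_add_distrib]
  refine Finset.sum_eq_zero fun i _ => ?_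
  rw [← add_smul]
  have hz := P.ε_d (b.a i * P.dualBasis b j)
  rw [A.leibniz (b.a_mem i), map_add, map_smul, smul_eq_mul] at hz
  have : (-1 : ℚ) ^ b.deg i * P.ε (A.d (b.a i) * P.dualBasis b j) +
      P.ε (b.a i * A.d (P.dualBasis b j)) = 0 := by
    linear_combination (-1 : ℚ) ^ b.deg i * hz -
      P.ε (b.a i * A.d (P.dualBasis b j)) * h1 (b.deg i)
  rw [this, zero_smul]

/-- `Δ (x ⊗ 1) = Δ (1 ⊗ x)`. -/
theorem diag_mul_left {c : ℕ} {x : A} (hx : x ∈ A.gr c) :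
    P.diag b * ot x 1 = P.diag b * ot 1 x := by
  have h1 : ∀ m : ℕ, ((-1 : ℚ) ^ m) * (-1) ^ m = 1 := fun m => by rw [← mul_pow]; simp
  have eL : P.diag b * ot x 1 = ∑ i, ∑ j, ((-1 : ℚ) ^ (b.deg i + (n - b.deg i) * c) *
      P.ε (b.a i * x * P.dualBasis b j)) • ot (b.a j) (P.dualBasis b i) := by
    rw [diag, Finset.sum_mul]
    refine Finset.sum_congr rfl fun i _ => ?_
    rw [smul_mul_assoc, ot_mul_ot _ (P.dualBasis_mem b i) hx, mul_one, smul_smul, ← pow_add]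
    conv_lhs => rw [← P.expand_left b (b.a i * x)]
    rw [← otₗ_apply, map_sum, LinearMap.sum_apply, Finset.smul_sum]
    refine Finset.sum_congr rfl fun j _ => ?_
    rw [map_smul, LinearMap.smul_apply, smul_smul, otₗ_apply]
  have eR : P.diag b * ot 1 x = ∑ i, ∑ j, ((-1 : ℚ) ^ b.deg i *
      P.ε (b.a j * (P.dualBasis b i * x))) • ot (b.a i) (P.dualBasis b j) := by
    rw [diag, Finset.sum_mul]
    refine Finset.sum_congr rfl fun i _ => ?_
    rw [smul_mul_assoc, ot_mul_ot _ (P.dualBasis_mem b i) A.one_mem, mul_zero, pow_zero,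
      one_smul, mul_one]
    conv_lhs => rw [← P.expand_right b (P.dualBasis b i * x)]
    rw [← otₗ_apply, map_sum, Finset.smul_sum]
    refine Finset.sum_congr rfl fun j _ => ?_
    rw [map_smul, smul_smul, otₗ_apply]
  rw [eL, eR, Finset.sum_comm]
  refine Finset.sum_congr rfl fun i _ => Finset.sum_congr rfl fun j _ => ?_
  congr 1
  have hi := P.deg_le b i
  have hj := P.deg_le b j
  rw [A.graded_comm (P.dualBasis_mem b i) hx, mul_smul_comm, map_smul, smul_eq_mul, ← mul_assoc,
    ← mul_assoc]
  by_cases hd : b.deg j + c = b.deg i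
  · have hk : n - b.deg j = (n - b.deg i) + c := by omega
    rw [hk, ← hd, ← pow_add]
    congr 1
    have hcc : Even (c * c + c) := by
      have := Nat.even_mul_succ_self c
      rwa [Nat.mul_succ] at this
    rw [← hd] at hk
    have e2 : b.deg j + (n - (b.deg j + c) + c) * c =
      (b.deg j + (n - (b.deg j + c)) * c) + c * c := by ring
    have e3 : b.deg j + c + (n - (b.deg j + c)) * c =
      (b.deg j + (n - (b.deg j + c)) * c) + c := by ring
    have hs : (-1 : ℚ) ^ (c * c) = (-1) ^ c := by
      have := hcc.neg_one_pow (α := ℚ)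
      rw [pow_add] at this
      linear_combination (-1 : ℚ) ^ c * this - (-1 : ℚ) ^ (c * c) * h1 c
    rw [e2, e3, pow_add _ _ (c * c), pow_add _ _ c, hs]
  · rw [P.ε_of_ne (b.deg j + c + (n - b.deg i)) (by omega) _
      (A.mul_mem (A.mul_mem (b.a_mem j) hx rfl) (P.dualBasis_mem b i) rfl), mul_zero, mul_zero]

/-- `Δ z = Δ (1 ⊗ m(z))` where `m` is the multiplication `A ⊗ A → A`. -/
theorem diag_mul (z : A.tensor A) : P.diag b * z = P.diag b * ot 1 (A.m z) := by
  have : LinearMap.mul ℚ (A.tensor A) (P.diag b) =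
      LinearMap.mul ℚ (A.tensor A) (P.diag b) ∘ₗ otₗ A A 1 ∘ₗ A.m.toLinearMap := by
    refine ot_lin_ext fun i j x hx y hy => ?_
    simp only [LinearMap.comp_apply, LinearMap.mul_apply', AlgHom.toLinearMap_apply, m_ot,
      otₗ_apply]
    have e1 : (ot x y : A.tensor A) = ot x 1 * ot 1 y := by
      rw [ot_mul_ot x A.one_mem A.one_mem y]; simp
    have e2 : (ot 1 (x * y) : A.tensor A) = ot 1 x * ot 1 y := by
      rw [ot_mul_ot 1 hx A.one_mem y]; simp
    rw [e1, e2, ← mul_assoc, P.diag_mul_left b hx, mul_assoc]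
  exact LinearMap.congr_fun this z

end PoincareDuality
section cone
variable (A : CDGA.{u}) (n : ℕ)

/-- The underlying vector space `(A ⊗ A) ⊕ ss^{-n}A` of the mapping cone of
`Δ^! : s^{-n}A → A ⊗ A`; the pair `(z, x)` stands for `z + ss^{-n}x`. -/
abbrev Cone : Type u := A.tensor A × A

/-- The degree `k` part of `ss^{-n}A`, where `ss^{-n}x` has degree `|x| + n - 1`. -/
noncomputable def shiftGr (k : ℕ) : Submodule ℚ A :=
  if n - 1 ≤ k then A.gr (k - (n - 1)) else ⊥

/-- The degree `k` part of the mapping cone. -/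
noncomputable def coneGr (k : ℕ) : Submodule ℚ A.Cone := ((A.tensor A).gr k).prod (A.shiftGr n k)

/-- The subspace of elements of degree at least `2n - 1` of the mapping cone. -/
noncomputable def coneTop : Submodule ℚ A.Cone := ⨆ k, ⨆ (_ : 2 * n - 1 ≤ k), A.coneGr n k

/-- The quotient of the mapping cone by its elements of degree at least `2n - 1`. -/
abbrev ConeQuot : Type u := A.Cone ⧸ A.coneTop n

variable {A n}

theorem mem_shiftGr {k : ℕ} {x : A} :
    x ∈ A.shiftGr n k ↔ x = 0 ∨ ∃ i, i + (n - 1) = k ∧ x ∈ A.gr i := by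
  unfold shiftGr
  split_ifs with h
  · constructor
    · intro hx
      exact Or.inr ⟨k - (n - 1), by omega, hx⟩
    · rintro (rfl | ⟨i, rfl, hx⟩)
      · exact zero_mem _
      · rwa [Nat.add_sub_cancel]
  · constructor
    · intro hx
      exact Or.inl (by simpa using hx)
    · rintro (rfl | ⟨i, rfl, hx⟩)
      · exact zero_mem _
      · omega

theorem shift_mem {i k : ℕ} {x : A} (hx : x ∈ A.gr i) (h : i + (n - 1) = k) :
    x ∈ A.shiftGr n k := mem_shiftGr.2 (Or.inr ⟨i, h, hx⟩)

theorem mem_coneGr {k : ℕ} {e : A.Cone} :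
    e ∈ A.coneGr n k ↔ e.1 ∈ (A.tensor A).gr k ∧ e.2 ∈ A.shiftGr n k := Submodule.mem_prod

theorem coneGr_le_top {k : ℕ} (h : 2 * n - 1 ≤ k) : A.coneGr n k ≤ A.coneTop n :=
  le_iSup₂_of_le k h le_rfl

theorem iSup_coneGr : ⨆ k, A.coneGr n k = ⊤ := by
  rw [eq_top_iff]
  rintro ⟨z, x⟩ -
  have h1 : LinearMap.inl ℚ (A.tensor A) A z ∈ ⨆ k, A.coneGr n k := by
    have : (⨆ k, (A.tensor A).gr k) ≤
        (⨆ k, A.coneGr n k).comap (LinearMap.inl ℚ (A.tensor A) A) := by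
      refine iSup_le fun k w hw => Submodule.mem_iSup_of_mem k ?_
      exact mem_coneGr.2 ⟨hw, zero_mem _⟩
    exact this (by rw [iSup_gr]; trivial)
  have h2 : LinearMap.inr ℚ (A.tensor A) A x ∈ ⨆ k, A.coneGr n k := by
    have : (⨆ k, A.gr k) ≤
        (⨆ k, A.coneGr n k).comap (LinearMap.inr ℚ (A.tensor A) A) := by
      refine iSup_le fun k w hw => Submodule.mem_iSup_of_mem (k + (n - 1)) ?_
      exact mem_coneGr.2 ⟨zero_mem _, shift_mem hw rfl⟩
    exact this (by rw [iSup_gr]; trivial)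
  have := add_mem h1 h2
  simpa using this

/-- Linear maps on the cone that agree on homogeneous elements are equal. -/
theorem cone_lin_ext {M : Type*} [AddCommGroup M] [Module ℚ M] {f g : A.Cone →ₗ[ℚ] M} (n : ℕ)
    (h : ∀ k, ∀ e ∈ A.coneGr n k, f e = g e) : f = g := by
  have : (⨆ k, A.coneGr n k) ≤ LinearMap.eqLocus f g := iSup_le h
  ext1 <;> ext x <;> exact this (by rw [iSup_coneGr]; trivial)

theorem cone_mem_of_hom {S : Submodule ℚ A.Cone} {M : Type*} [AddCommGroup M] [Module ℚ M]
    (f : M →ₗ[ℚ] A.Cone) {G : ℕ → Submodule ℚ M} (hG : ⨆ k, G k = ⊤)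
    (h : ∀ k, ∀ x ∈ G k, f x ∈ S) (x : M) : f x ∈ S := by
  have : (⨆ k, G k) ≤ S.comap f := iSup_le h
  exact this (by rw [hG]; trivial)

variable (A n) in
/-- The projection of the cone onto its part of degree `k`. -/
noncomputable def coneProj (k : ℕ) : A.Cone →ₗ[ℚ] A.Cone :=
  ((A.tensor A).proj k).prodMap (if n - 1 ≤ k then A.proj (k - (n - 1)) else 0)

theorem coneProj_same {k : ℕ} {e : A.Cone} (he : e ∈ A.coneGr n k) : A.coneProj n k e = e := by
  obtain ⟨h1, h2⟩ := mem_coneGr.1 he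
  refine Prod.ext ((A.tensor A).proj_same h1) ?_
  change (if n - 1 ≤ k then A.proj (k - (n - 1)) else 0) e.2 = e.2
  rcases mem_shiftGr.1 h2 with h0 | ⟨i, rfl, hi⟩
  · rw [h0, map_zero]
  · rw [if_pos (by omega), Nat.add_sub_cancel, A.proj_same hi]

theorem coneProj_ne {k j : ℕ} (hj : j ≠ k) {e : A.Cone} (he : e ∈ A.coneGr n j) :
    A.coneProj n k e = 0 := by
  obtain ⟨h1, h2⟩ := mem_coneGr.1 he
  refine Prod.ext ((A.tensor A).proj_ne hj h1) ?_
  change (if n - 1 ≤ k then A.proj (k - (n - 1)) else 0) e.2 = 0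
  rcases mem_shiftGr.1 h2 with h0 | ⟨i, rfl, hi⟩
  · rw [h0, map_zero]
  · split_ifs with h
    · exact A.proj_ne (by omega) hi
    · rfl

theorem coneTop_le_comap_proj (k : ℕ) : A.coneTop n ≤ (A.coneTop n).comap (A.coneProj n k) := by
  refine iSup₂_le fun j hj e he => ?_
  rw [Submodule.mem_comap]
  by_cases h : j = k
  · subst h
    rw [coneProj_same he]
    exact coneGr_le_top hj he
  · rw [coneProj_ne h he]
    exact zero_mem _

variable (A n) in
/-- The grading of the quotient of the cone. -/
noncomputable def coneQuotGr (k : ℕ) : Submodule ℚ (A.ConeQuot n) :=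
  (A.coneGr n k).map (A.coneTop n).mkQ

theorem mk_mem_coneQuotGr {k : ℕ} {e : A.Cone} (he : e ∈ A.coneGr n k) :
    (A.coneTop n).mkQ e ∈ A.coneQuotGr n k := ⟨e, he, rfl⟩

theorem coneQuot_isInternal : DirectSum.IsInternal (A.coneQuotGr n) := by
  refine isInternal_of_proj _
    (fun k => (A.coneTop n).mapQ (A.coneTop n) (A.coneProj n k) (coneTop_le_comap_proj k)) ?_ ?_ ?_
  · rintro k _ ⟨e, he, rfl⟩
    rw [Submodule.mkQ_apply, Submodule.mapQ_apply, coneProj_same he]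
  · rintro k j hj _ ⟨e, he, rfl⟩
    rw [Submodule.mkQ_apply, Submodule.mapQ_apply, coneProj_ne hj he, Submodule.Quotient.mk_zero]
  · simp only [coneQuotGr]
    rw [← Submodule.map_iSup, iSup_coneGr, Submodule.map_top, Submodule.range_mkQ]

/-- `(0, y)` has degree at least `2n - 1` if `y` is a multiple of an element of degree `n`. -/
theorem inr_mem_top {w : A} (hw : w ∈ A.gr n) (x y : A) :
    ((0 : A.tensor A), x * w * y) ∈ A.coneTop n := by
  refine cone_mem_of_hom (LinearMap.inr ℚ (A.tensor A) A ∘ₗ LinearMap.mul ℚ A (x * w))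
    A.iSup_gr (fun j y hy => ?_) y
  refine cone_mem_of_hom (LinearMap.inr ℚ (A.tensor A) A ∘ₗ
    (LinearMap.mul ℚ A).flip y ∘ₗ (LinearMap.mul ℚ A).flip w) A.iSup_gr (fun i x hx => ?_) x
  refine coneGr_le_top (k := i + n + j + (n - 1)) (by omega) (mem_coneGr.2 ⟨zero_mem _, ?_⟩)
  exact shift_mem (A.mul_mem (A.mul_mem hx hw rfl) hy rfl) rfl

end cone

namespace OneConnected
variable {A : CDGA.{u}} (h : A.OneConnected)

theorem tensor_gr_zero (h : A.OneConnected) {z : A.tensor A} (hz : z ∈ (A.tensor A).gr 0) :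
    ∃ c : ℚ, z = algebraMap ℚ (A.tensor A) c := by
  have : (A.tensor A).gr 0 ≤ LinearMap.range (Algebra.linearMap ℚ (A.tensor A)) := by
    refine ot_gr_le fun i j hij a ha b hb => ?_
    obtain ⟨rfl, rfl⟩ : i = 0 ∧ j = 0 := by omega
    obtain ⟨c, rfl⟩ := h.gr_zero a ha
    obtain ⟨c', rfl⟩ := h.gr_zero b hb
    refine ⟨c * c', ?_⟩
    rw [Algebra.linearMap_apply, Algebra.algebraMap_eq_smul_one, Algebra.algebraMap_eq_smul_one,
      Algebra.algebraMap_eq_smul_one, ← otₗ_apply, map_smul, map_smul, LinearMap.smul_apply,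
      smul_smul, otₗ_apply, ot_one, mul_comm]
  obtain ⟨c, hc⟩ := this hz
  exact ⟨c, hc.symm⟩

theorem linearMap_injective (h : A.OneConnected) :
    Function.Injective (Algebra.linearMap ℚ A) := by
  have := h.nontrivial
  exact (algebraMap ℚ A).injective

/-- The augmentation `A → A^0 = ℚ`. -/
noncomputable def aug : A →ₗ[ℚ] ℚ :=
  (LinearEquiv.ofInjective (Algebra.linearMap ℚ A) h.linearMap_injective).symm.toLinearMap ∘ₗ
    LinearMap.codRestrict (LinearMap.range (Algebra.linearMap ℚ A)) (A.proj 0) (fun a => by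
      obtain ⟨c, hc⟩ := h.gr_zero _ (A.proj_mem 0 a)
      exact ⟨c, hc.symm⟩)

theorem algebraMap_aug (a : A) : algebraMap ℚ A (h.aug a) = A.proj 0 a := by
  have := LinearEquiv.apply_symm_apply
    (LinearEquiv.ofInjective (Algebra.linearMap ℚ A) h.linearMap_injective)
    (LinearMap.codRestrict (LinearMap.range (Algebra.linearMap ℚ A)) (A.proj 0) (fun a => by
      obtain ⟨c, hc⟩ := h.gr_zero _ (A.proj_mem 0 a)
      exact ⟨c, hc.symm⟩) a)
  exact congrArg Subtype.val this

theorem aug_algebraMap (c : ℚ) : h.aug (algebraMap ℚ A c) = c := by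
  apply h.linearMap_injective
  rw [Algebra.linearMap_apply, Algebra.linearMap_apply, h.algebraMap_aug, A.proj_same]
  rw [Algebra.algebraMap_eq_smul_one]
  exact Submodule.smul_mem _ _ A.one_mem

theorem aug_one : h.aug 1 = 1 := by
  have := h.aug_algebraMap 1
  rwa [map_one] at this

theorem aug_of_mem {k : ℕ} (hk : k ≠ 0) {a : A} (ha : a ∈ A.gr k) : h.aug a = 0 := by
  apply h.linearMap_injective
  rw [Algebra.linearMap_apply, Algebra.linearMap_apply, h.algebraMap_aug, A.proj_ne hk ha,
    map_zero]

theorem aug_mul (a b : A) : h.aug (a * b) = h.aug a * h.aug b := by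
  have : (LinearMap.mul ℚ A).compr₂ h.aug = (LinearMap.mul ℚ ℚ).compl₁₂ h.aug h.aug := by
    refine A.lin_ext fun i a ha => A.lin_ext fun j b hb => ?_
    simp only [LinearMap.compr₂_apply, LinearMap.compl₁₂_apply, LinearMap.mul_apply']
    by_cases hi : i = 0
    · subst hi
      obtain ⟨c, rfl⟩ := h.gr_zero a ha
      rw [h.aug_algebraMap, ← Algebra.smul_def, map_smul, smul_eq_mul]
    · rw [h.aug_of_mem hi ha, zero_mul]
      exact h.aug_of_mem (k := i + j) (by omega) (A.mul_mem ha hb rfl)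
  exact LinearMap.congr_fun₂ this a b

theorem aug_d (a : A) : h.aug (A.d a) = 0 := by
  have : h.aug ∘ₗ A.d = 0 := by
    refine A.lin_ext fun i a ha => ?_
    exact h.aug_of_mem (Nat.succ_ne_zero i) (A.d_mem ha)
  exact LinearMap.congr_fun this a

end OneConnected

namespace PoincareDuality
variable {A : CDGA.{u}} {n N : ℕ}

theorem three_le (P : A.PoincareDuality n) (h : A.OneConnected) (hn : Odd n) : 3 ≤ n := by
  by_contra hlt
  obtain ⟨k, hk⟩ := hn
  obtain rfl : n = 1 := by omega
  have := h.nontrivial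
  obtain ⟨j, hj, b, hb, hb'⟩ := P.nondeg 0 1 A.one_mem one_ne_zero
  obtain rfl : j = 1 := by omega
  rw [h.gr_one, Submodule.mem_bot] at hb
  exact hb' (by rw [hb, mul_zero, map_zero])

theorem gr_pred (P : A.PoincareDuality n) (h : A.OneConnected) {k : ℕ} (hk : k + 1 = n) {a : A}
    (ha : a ∈ A.gr k) : a = 0 := by
  by_contra hne
  obtain ⟨j, hj, b, hb, hb'⟩ := P.nondeg k a ha hne
  obtain rfl : j = 1 := by omega
  rw [h.gr_one, Submodule.mem_bot] at hb
  exact hb' (by rw [hb, mul_zero, map_zero])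

theorem tensor_gr_pred (P : A.PoincareDuality n) (h : A.OneConnected) {k : ℕ}
    (hk : k + 1 = 2 * n) {z : A.tensor A} (hz : z ∈ (A.tensor A).gr k) : z = 0 := by
  have : (A.tensor A).gr k ≤ ⊥ := by
    refine ot_gr_le fun i j hij a ha b hb => ?_
    rw [Submodule.mem_bot, ← otₗ_apply]
    rcases lt_trichotomy i n with hi | hi | hi
    · by_cases hi' : i + 1 = n
      · rw [P.gr_pred h hi' ha, map_zero, LinearMap.zero_apply]
      · rw [P.gr_eq_zero (by omega) hb, map_zero]
    · rw [P.gr_pred h (by omega) hb, map_zero]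
    · rw [P.gr_eq_zero hi ha, map_zero, LinearMap.zero_apply]
  simpa using this hz

/-- Every element of `(A ⊗ A)^{2n-2}` is a cocycle. -/
theorem d_eq_zero (P : A.PoincareDuality n) (h : A.OneConnected) (hn : Odd n)
    (ξ : (A.tensor A).gr (2 * n - 2)) : (A.tensor A).d ξ = 0 := by
  have := P.three_le h hn
  exact P.tensor_gr_pred h (by omega) ((A.tensor A).d_mem ξ.2)

variable (P : A.PoincareDuality n) (b : A.HomogeneousBasis N)

/-- The map `Δ^! : s^{-n}A → A ⊗ A`, `s^{-n}x ↦ Δ (1 ⊗ x)`. -/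
noncomputable def shriek : A →ₗ[ℚ] A.tensor A :=
  LinearMap.mul ℚ (A.tensor A) (P.diag b) ∘ₗ otₗ A A 1

theorem shriek_apply (x : A) : P.shriek b x = P.diag b * ot 1 x := rfl

/-- The differential `δ (z + ss^{-n}x) = dz + Δ^!(s^{-n}x) - s d(s^{-n}x)` of the mapping cone,
where `-s d(s^{-n}x) = -(-1)^n ss^{-n}dx`. -/
noncomputable def coneD : A.Cone →ₗ[ℚ] A.Cone :=
  ((A.tensor A).d ∘ₗ LinearMap.fst ℚ _ _ + P.shriek b ∘ₗ LinearMap.snd ℚ _ _).prod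
    (-((-1 : ℚ) ^ n • (A.d ∘ₗ LinearMap.snd ℚ _ _)))

theorem coneD_apply (hn : Odd n) (e : A.Cone) :
    P.coneD b e = ((A.tensor A).d e.1 + P.diag b * ot 1 e.2, A.d e.2) := by
  simp [coneD, shriek_apply, hn.neg_one_pow]

theorem shriek_mem {i k : ℕ} (hk : i + n = k) {x : A} (hx : x ∈ A.gr i) :
    P.diag b * ot 1 x ∈ (A.tensor A).gr k :=
  (A.tensor A).mul_mem (P.diag_mem b) (ot_mem A.one_mem hx rfl) (by omega)

theorem coneD_mem (h : A.OneConnected) (hn : Odd n) {k : ℕ} {e : A.Cone}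
    (he : e ∈ A.coneGr n k) : P.coneD b e ∈ A.coneGr n (k + 1) := by
  have := P.three_le h hn
  obtain ⟨h1, h2⟩ := mem_coneGr.1 he
  rw [P.coneD_apply b hn, mem_coneGr]
  rcases mem_shiftGr.1 h2 with h0 | ⟨i, rfl, hi⟩
  · have e0 : P.diag b * ot 1 e.2 = 0 := by
      rw [← P.shriek_apply, h0, map_zero]
    rw [e0, add_zero, h0, map_zero]
    exact ⟨(A.tensor A).d_mem h1, zero_mem _⟩
  · exact ⟨add_mem ((A.tensor A).d_mem h1) (P.shriek_mem b (by omega) hi),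
      shift_mem (A.d_mem hi) (by omega)⟩

theorem coneD_coneD (hn : Odd n) (e : A.Cone) : P.coneD b (P.coneD b e) = 0 := by
  rw [P.coneD_apply b hn, P.coneD_apply b hn]
  have e1 : (A.tensor A).d (P.diag b * ot 1 e.2) = -(P.diag b * ot 1 (A.d e.2)) := by
    rw [(A.tensor A).leibniz (P.diag_mem b), P.d_diag, zero_mul, zero_add, hn.neg_one_pow,
      d_ot A.one_mem, A.d_one, ← otₗ_apply, map_zero, LinearMap.zero_apply, zero_add, pow_zero,
      one_smul, neg_one_smul]
  refine Prod.ext ?_ (A.d_d _)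
  simp only [map_add, (A.tensor A).d_d, e1, zero_add, neg_add_cancel, Prod.fst_zero]

theorem coneTop_le_comap_coneD (h : A.OneConnected) (hn : Odd n) :
    A.coneTop n ≤ (A.coneTop n).comap (P.coneD b) :=
  iSup₂_le fun k hk _ he => coneGr_le_top (by omega) (P.coneD_mem b h hn he)

end PoincareDuality

section cxi
variable {A : CDGA.{u}} {n N : ℕ} (h : A.OneConnected) (ξ : (A.tensor A).gr (2 * n - 2))

/-- The multiplication on the mapping cone: `A ⊗ A` acts on `ss^{-n}A` from both sides, and
`ss^{-n}x · ss^{-n}y` is `ξ` for `x = y = 1` and vanishes for `|x| + |y| > 0`.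
For `n` odd the actions on homogeneous elements are
`(a ⊗ b) · ss^{-n}x = (-1)^(|b||x|) ss^{-n}(axb)` and
`ss^{-n}x · (a ⊗ b) = (-1)^(|a||x|) ss^{-n}(axb)`; see `m_ot_mul` and `mul_m_ot`. -/
noncomputable def coneMul : A.Cone →ₗ[ℚ] A.Cone →ₗ[ℚ] A.Cone :=
  LinearMap.mk₂ ℚ
    (fun e f => (e.1 * f.1 + (h.aug e.2 * h.aug f.2) • (ξ : A.tensor A),
      A.m e.1 * f.2 + e.2 * A.m f.1))
    (by
      intro e e' f
      refine Prod.ext ?_ ?_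
      · simp only [Prod.fst_add, Prod.snd_add, map_add, add_mul, add_smul]; abel
      · simp only [Prod.fst_add, Prod.snd_add, map_add, add_mul]; abel)
    (by
      intro c e f
      refine Prod.ext ?_ ?_
      · simp only [Prod.smul_fst, Prod.smul_snd, map_smul, smul_mul_assoc, smul_add, smul_smul,
          smul_eq_mul, mul_assoc]
      · simp only [Prod.smul_fst, Prod.smul_snd, map_smul, smul_mul_assoc, smul_add])
    (by
      intro e f f'
      refine Prod.ext ?_ ?_
      · simp only [Prod.fst_add, Prod.snd_add, map_add, mul_add, add_smul]; abel
      · simp only [Prod.fst_add, Prod.snd_add, map_add, mul_add]; abel)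
    (by
      intro c e f
      refine Prod.ext ?_ ?_
      · simp only [Prod.smul_fst, Prod.smul_snd, map_smul, mul_smul_comm, smul_add, smul_smul,
          smul_eq_mul]
        rw [mul_left_comm]
      · simp only [Prod.smul_fst, Prod.smul_snd, map_smul, mul_smul_comm, smul_add])

theorem coneMul_apply (e f : A.Cone) : coneMul h ξ e f =
    (e.1 * f.1 + (h.aug e.2 * h.aug f.2) • (ξ : A.tensor A),
      A.m e.1 * f.2 + e.2 * A.m f.1) := rfl

theorem coneMul_mem (hn : 1 ≤ n) {k l : ℕ} {e f : A.Cone} (he : e ∈ A.coneGr n k)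
    (hf : f ∈ A.coneGr n l) : coneMul h ξ e f ∈ A.coneGr n (k + l) := by
  obtain ⟨h1, h2⟩ := mem_coneGr.1 he
  obtain ⟨h3, h4⟩ := mem_coneGr.1 hf
  rw [coneMul_apply, mem_coneGr]
  refine ⟨add_mem ((A.tensor A).mul_mem h1 h3 rfl) ?_, add_mem ?_ ?_⟩
  · rcases mem_shiftGr.1 h2 with h0 | ⟨i, rfl, hi⟩
    · rw [h0, map_zero, zero_mul, zero_smul]; exact zero_mem _
    rcases mem_shiftGr.1 h4 with h0 | ⟨j, rfl, hj⟩
    · rw [h0, map_zero, mul_zero, zero_smul]; exact zero_mem _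
    by_cases hi0 : i = 0
    · by_cases hj0 : j = 0
      · have e0 : i + (n - 1) + (j + (n - 1)) = 2 * n - 2 := by omega
        rw [e0]
        exact Submodule.smul_mem _ _ ξ.2
      · rw [h.aug_of_mem hj0 hj, mul_zero, zero_smul]; exact zero_mem _
    · rw [h.aug_of_mem hi0 hi, zero_mul, zero_smul]; exact zero_mem _
  · rcases mem_shiftGr.1 h4 with h0 | ⟨j, rfl, hj⟩
    · rw [h0, mul_zero]; exact zero_mem _
    · exact shift_mem (A.mul_mem (A.m_mem h1) hj rfl) (by omega)
  · rcases mem_shiftGr.1 h2 with h0 | ⟨i, rfl, hi⟩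
    · rw [h0, zero_mul]; exact zero_mem _
    · exact shift_mem (A.mul_mem hi (A.m_mem h3) rfl) (by omega)

theorem coneMul_top_left (hn : 1 ≤ n) {e : A.Cone} (he : e ∈ A.coneTop n) (f : A.Cone) :
    coneMul h ξ e f ∈ A.coneTop n := by
  refine cone_mem_of_hom (coneMul h ξ e) (iSup_coneGr (n := n)) (fun l f hf => ?_) f
  have : A.coneTop n ≤ (A.coneTop n).comap ((coneMul h ξ).flip f) :=
    iSup₂_le fun k hk e he => by
      rw [Submodule.mem_comap, LinearMap.flip_apply]
      exact coneGr_le_top (k := k + l) (by omega) (coneMul_mem h ξ hn he hf)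
  exact this he

theorem coneMul_top_right (hn : 1 ≤ n) (e : A.Cone) {f : A.Cone} (hf : f ∈ A.coneTop n) :
    coneMul h ξ e f ∈ A.coneTop n := by
  refine cone_mem_of_hom ((coneMul h ξ).flip f) (iSup_coneGr (n := n)) (fun l e he => ?_) e
  have : A.coneTop n ≤ (A.coneTop n).comap (coneMul h ξ e) :=
    iSup₂_le fun k hk f hf => coneGr_le_top (by omega) (coneMul_mem h ξ hn he hf)
  exact this hf

/-- The induced multiplication on the quotient of the cone. -/
noncomputable def coneQuotMul (hn : 1 ≤ n) :
    A.ConeQuot n →ₗ[ℚ] A.ConeQuot n →ₗ[ℚ] A.ConeQuot n :=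
  (A.coneTop n).liftQ
    (((A.coneTop n).liftQ ((coneMul h ξ).compr₂ (A.coneTop n).mkQ).flip (by
      intro f hf
      rw [LinearMap.mem_ker]
      refine LinearMap.ext fun e => ?_
      exact (Submodule.Quotient.mk_eq_zero _).2 (coneMul_top_right h ξ hn e hf))).flip) (by
    intro e he
    rw [LinearMap.mem_ker]
    refine Submodule.linearMap_qext _ (LinearMap.ext fun f => ?_)
    exact (Submodule.Quotient.mk_eq_zero _).2 (coneMul_top_left h ξ hn he f))

theorem coneQuotMul_mk (hn : 1 ≤ n) (e f : A.Cone) :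
    coneQuotMul h ξ hn ((A.coneTop n).mkQ e) ((A.coneTop n).mkQ f) =
      (A.coneTop n).mkQ (coneMul h ξ e f) := rfl

theorem xi_mul_sub (hn : 1 ≤ n) (z : A.tensor A) :
    ((ξ : A.tensor A) * z - h.aug (A.m z) • (ξ : A.tensor A), (0 : A)) ∈ A.coneTop n := by
  refine cone_mem_of_hom (LinearMap.inl ℚ (A.tensor A) A ∘ₗ
    (LinearMap.mul ℚ (A.tensor A) ξ - (h.aug ∘ₗ A.m.toLinearMap).smulRight (ξ : A.tensor A)))
    (A.tensor A).iSup_gr (fun k z hz => ?_) z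
  simp only [LinearMap.comp_apply, LinearMap.sub_apply, LinearMap.mul_apply',
    LinearMap.smulRight_apply, AlgHom.toLinearMap_apply]
  by_cases hk : k = 0
  · subst hk
    obtain ⟨c, rfl⟩ := h.tensor_gr_zero hz
    rw [AlgHom.commutes, h.aug_algebraMap, ← Algebra.commutes, ← Algebra.smul_def, sub_self,
      map_zero]
    exact zero_mem _
  · rw [h.aug_of_mem hk (A.m_mem hz), zero_smul, sub_zero]
    refine coneGr_le_top (k := 2 * n - 2 + k) (by omega) (mem_coneGr.2 ⟨?_, zero_mem _⟩)
    exact (A.tensor A).mul_mem ξ.2 hz rfl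

theorem mul_xi_sub (hn : 1 ≤ n) (z : A.tensor A) :
    (z * (ξ : A.tensor A) - h.aug (A.m z) • (ξ : A.tensor A), (0 : A)) ∈ A.coneTop n := by
  refine cone_mem_of_hom (LinearMap.inl ℚ (A.tensor A) A ∘ₗ
    ((LinearMap.mul ℚ (A.tensor A)).flip ξ -
      (h.aug ∘ₗ A.m.toLinearMap).smulRight (ξ : A.tensor A)))
    (A.tensor A).iSup_gr (fun k z hz => ?_) z
  simp only [LinearMap.comp_apply, LinearMap.sub_apply, LinearMap.mul_apply', LinearMap.flip_apply,
    LinearMap.smulRight_apply, AlgHom.toLinearMap_apply]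
  by_cases hk : k = 0
  · subst hk
    obtain ⟨c, rfl⟩ := h.tensor_gr_zero hz
    rw [AlgHom.commutes, h.aug_algebraMap, ← Algebra.smul_def, sub_self, map_zero]
    exact zero_mem _
  · rw [h.aug_of_mem hk (A.m_mem hz), zero_smul, sub_zero]
    refine coneGr_le_top (k := k + (2 * n - 2)) (by omega) (mem_coneGr.2 ⟨?_, zero_mem _⟩)
    exact (A.tensor A).mul_mem hz ξ.2 rfl

/-- The multiplication of the cone is associative up to elements of degree at least `2n - 1`. -/
theorem coneMul_assoc (P : A.PoincareDuality n) (hn : 3 ≤ n) (e f g : A.Cone) :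
    coneMul h ξ (coneMul h ξ e f) g - coneMul h ξ e (coneMul h ξ f g) ∈ A.coneTop n := by
  have hm : A.m (ξ : A.tensor A) = 0 := P.gr_eq_zero (by omega) (A.m_mem ξ.2)
  have key : coneMul h ξ (coneMul h ξ e f) g - coneMul h ξ e (coneMul h ξ f g) =
      (h.aug e.2 * h.aug f.2) •
        ((ξ : A.tensor A) * g.1 - h.aug (A.m g.1) • (ξ : A.tensor A), (0 : A)) -
      (h.aug f.2 * h.aug g.2) •
        (e.1 * (ξ : A.tensor A) - h.aug (A.m e.1) • (ξ : A.tensor A), (0 : A)) := by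
    refine Prod.ext ?_ ?_
    · simp only [coneMul_apply, Prod.fst_sub, Prod.smul_fst, map_add, h.aug_mul, add_mul, mul_add,
        smul_mul_assoc, mul_smul_comm, smul_sub, smul_smul, mul_assoc, add_smul]
      module
    · simp only [coneMul_apply, Prod.snd_sub, Prod.smul_snd, map_add, map_mul, map_smul, hm,
        smul_zero, add_zero, add_mul, mul_add, mul_assoc, sub_zero]
      abel
  rw [key]
  exact sub_mem (Submodule.smul_mem _ _ (xi_mul_sub h ξ (by omega) g.1))
    (Submodule.smul_mem _ _ (mul_xi_sub h ξ (by omega) e.1))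

/-- The multiplication of the cone is graded commutative. -/
theorem coneMul_comm (hn : Odd n) {p q : ℕ} {e f : A.Cone} (he : e ∈ A.coneGr n p)
    (hf : f ∈ A.coneGr n q) : coneMul h ξ e f = (-1 : ℚ) ^ (p * q) • coneMul h ξ f e := by
  obtain ⟨r, hr⟩ := hn
  have hn1 : n - 1 = 2 * r := by omega
  have hsq : ∀ s : ℕ, ((-1 : ℚ) ^ (2 * s)) = 1 := fun s => by rw [pow_mul]; simp
  obtain ⟨h1, h2⟩ := mem_coneGr.1 he
  obtain ⟨h3, h4⟩ := mem_coneGr.1 hf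
  have s1 : (h.aug e.2 * h.aug f.2) • (ξ : A.tensor A) =
      (-1 : ℚ) ^ (p * q) • (h.aug f.2 * h.aug e.2) • (ξ : A.tensor A) := by
    rw [smul_smul]
    congr 1
    rcases mem_shiftGr.1 h2 with h0 | ⟨i, rfl, hi⟩
    · rw [h0, map_zero]; ring
    by_cases hi0 : i = 0
    · subst hi0
      have : (0 + (n - 1)) * q = 2 * (r * q) := by rw [hn1]; ring
      rw [this, hsq]; ring
    · rw [h.aug_of_mem hi0 hi]; ring
  have s2 : A.m e.1 * f.2 = (-1 : ℚ) ^ (p * q) • (f.2 * A.m e.1) := by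
    rcases mem_shiftGr.1 h4 with h0 | ⟨j, rfl, hj⟩
    · rw [h0, mul_zero, zero_mul, smul_zero]
    · rw [A.graded_comm (A.m_mem h1) hj]
      have : p * (j + (n - 1)) = p * j + 2 * (p * r) := by rw [hn1]; ring
      rw [this, pow_add, hsq, mul_one]
  have s3 : e.2 * A.m f.1 = (-1 : ℚ) ^ (p * q) • (A.m f.1 * e.2) := by
    rcases mem_shiftGr.1 h2 with h0 | ⟨i, rfl, hi⟩
    · rw [h0, mul_zero, zero_mul, smul_zero]
    · rw [A.graded_comm hi (A.m_mem h3)]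
      have : (i + (n - 1)) * q = i * q + 2 * (r * q) := by rw [hn1]; ring
      rw [this, pow_add, hsq, mul_one]
  rw [coneMul_apply, coneMul_apply]
  refine Prod.ext ?_ ?_
  · simp only [Prod.smul_fst, smul_add]
    rw [← s1, ← (A.tensor A).graded_comm h1 h3]
  · simp only [Prod.smul_snd, smul_add]
    rw [s2, s3, add_comm]

/-- The Leibniz rule holds up to elements of degree at least `2n - 1`. -/
theorem coneMul_leibniz (P : A.PoincareDuality n) (b : A.HomogeneousBasis N) (hn : Odd n) {p : ℕ}
    {e : A.Cone} (he : e ∈ A.coneGr n p) (f : A.Cone) :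
    P.coneD b (coneMul h ξ e f) - (coneMul h ξ (P.coneD b e) f +
      (-1 : ℚ) ^ p • coneMul h ξ e (P.coneD b f)) ∈ A.coneTop n := by
  have hn3 := P.three_le h hn
  have hdξ := P.d_eq_zero h hn ξ
  obtain ⟨h1, h2⟩ := mem_coneGr.1 he
  have hmul : ∀ x : A, ∀ z : A.tensor A,
      P.diag b * ot 1 x * z = P.diag b * ot 1 (x * A.m z) := by
    intro x z
    rw [mul_assoc, P.diag_mul, map_mul, m_ot, one_mul]
  have hcomm : P.diag b * ot 1 (A.m e.1 * f.2) =
      (-1 : ℚ) ^ p • (e.1 * (P.diag b * ot 1 f.2)) := by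
    have : (ot 1 (A.m e.1 * f.2) : A.tensor A) = ot 1 (A.m e.1) * ot 1 f.2 := by
      rw [ot_mul_ot 1 (A.m_mem h1) A.one_mem]; simp
    rw [this, ← mul_assoc, ← P.diag_mul, (A.tensor A).graded_comm (P.diag_mem b) h1,
      smul_mul_assoc, mul_assoc]
    congr 1
    rw [pow_mul, hn.neg_one_pow]
  have hd2 : A.d (e.2 * A.m f.1) =
      A.d e.2 * A.m f.1 + (-1 : ℚ) ^ p • (e.2 * A.d (A.m f.1)) := by
    rcases mem_shiftGr.1 h2 with h0 | ⟨i, rfl, hi⟩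
    · rw [h0]; simp
    · rw [A.leibniz hi]
      obtain ⟨r, hr⟩ := hn
      have hn1 : n - 1 = 2 * r := by omega
      rw [pow_add, hn1, pow_mul (-1 : ℚ) 2 r]
      simp
  have key : P.coneD b (coneMul h ξ e f) - (coneMul h ξ (P.coneD b e) f +
      (-1 : ℚ) ^ p • coneMul h ξ e (P.coneD b f)) =
      -((0 : A.tensor A), 1 * A.m (P.diag b) * (e.2 * f.2)) -
        (-1 : ℚ) ^ p • ((0 : A.tensor A), e.2 * A.m (P.diag b) * f.2) := by
    rw [P.coneD_apply b hn, P.coneD_apply b hn, P.coneD_apply b hn]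
    refine Prod.ext ?_ ?_
    · simp only [coneMul_apply, Prod.fst_sub, Prod.fst_add, Prod.smul_fst, Prod.fst_neg,
        map_add, map_smul, hdξ, smul_zero, h.aug_d, zero_mul, mul_zero, zero_smul, add_zero,
        (A.tensor A).leibniz h1, ← otₗ_apply]
      simp only [otₗ_apply, mul_add, add_mul, hmul, hcomm, smul_add]
      abel
    · simp only [coneMul_apply, Prod.snd_sub, Prod.snd_add, Prod.smul_snd, Prod.snd_neg,
        map_add, map_mul, m_d, hd2, A.leibniz (A.m_mem h1), m_ot, one_mul, add_mul, mul_add,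
        smul_add, mul_assoc]
      abel
  rw [key]
  exact sub_mem (neg_mem (inr_mem_top (A.m_mem (P.diag_mem b)) _ _))
    (Submodule.smul_mem _ _ (inr_mem_top (A.m_mem (P.diag_mem b)) _ _))

/-- The ring structure on the quotient of the cone. -/
noncomputable abbrev coneQuotRing (P : A.PoincareDuality n) (hn : 3 ≤ n) : Ring (A.ConeQuot n) :=
  { Submodule.Quotient.addCommGroup (A.coneTop n) with
    mul := fun x y => coneQuotMul h ξ (by omega) x y
    one := (A.coneTop n).mkQ (1, 0)
    left_distrib := fun x y z => map_add (coneQuotMul h ξ (by omega) x) y z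
    right_distrib := fun x y z => LinearMap.map_add₂ (coneQuotMul h ξ (by omega)) x y z
    zero_mul := fun x => LinearMap.map_zero₂ (coneQuotMul h ξ (by omega)) x
    mul_zero := fun x => map_zero (coneQuotMul h ξ (by omega) x)
    mul_assoc := by
      intro x y z
      obtain ⟨e, rfl⟩ := Submodule.mkQ_surjective _ x
      obtain ⟨f, rfl⟩ := Submodule.mkQ_surjective _ y
      obtain ⟨g, rfl⟩ := Submodule.mkQ_surjective _ z
      exact (Submodule.Quotient.eq _).2 (coneMul_assoc h ξ P hn e f g)
    one_mul := by
      intro x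
      obtain ⟨e, rfl⟩ := Submodule.mkQ_surjective _ x
      refine congrArg (A.coneTop n).mkQ (?_ : coneMul h ξ (1, 0) e = e)
      rw [coneMul_apply]
      simp
    mul_one := by
      intro x
      obtain ⟨e, rfl⟩ := Submodule.mkQ_surjective _ x
      refine congrArg (A.coneTop n).mkQ (?_ : coneMul h ξ e (1, 0) = e)
      rw [coneMul_apply]
      simp }

end cxi

section model
variable {A : CDGA.{u}} {n N : ℕ} (h : A.OneConnected)

/-- The CDGA `C(ξ)`: the quotient of the mapping cone of `Δ^!` by its elements of degree at least
`2n - 1`, with the multiplication for which `(ss^{-n}1)^2 = ξ`. -/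
noncomputable def Cxi (P : A.PoincareDuality n) (b : A.HomogeneousBasis N) (hn : Odd n)
    (ξ : (A.tensor A).gr (2 * n - 2)) : CDGA.{u} :=
  letI : Ring (A.ConeQuot n) := coneQuotRing h ξ P (P.three_le h hn)
  letI : Algebra ℚ (A.ConeQuot n) := Algebra.ofModule
    (fun c x y => LinearMap.map_smul₂ (coneQuotMul h ξ _) c x y)
    (fun c x y => map_smul (coneQuotMul h ξ _ x) c y)
  { carrier := A.ConeQuot n
    gr := A.coneQuotGr n
    gradedMonoid :=
      { one_mem := mk_mem_coneQuotGr (mem_coneGr.2 ⟨(A.tensor A).one_mem, zero_mem _⟩)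
        mul_mem := by
          rintro p q _ _ ⟨e, he, rfl⟩ ⟨f, hf, rfl⟩
          have := P.three_le h hn
          exact mk_mem_coneQuotGr (coneMul_mem h ξ (by omega) he hf) }
    isInternal := coneQuot_isInternal
    d := (A.coneTop n).mapQ (A.coneTop n) (P.coneD b) (P.coneTop_le_comap_coneD b h hn)
    d_mem := by
      rintro k _ ⟨e, he, rfl⟩
      exact mk_mem_coneQuotGr (P.coneD_mem b h hn he)
    d_d := by
      intro x
      obtain ⟨e, rfl⟩ := Submodule.mkQ_surjective _ x
      exact congrArg (A.coneTop n).mkQ (P.coneD_coneD b hn e)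
    graded_comm := by
      rintro p q _ _ ⟨e, he, rfl⟩ ⟨f, hf, rfl⟩
      exact congrArg (A.coneTop n).mkQ (coneMul_comm h ξ hn he hf)
    leibniz := by
      rintro p _ ⟨e, he, rfl⟩ y
      obtain ⟨f, rfl⟩ := Submodule.mkQ_surjective _ y
      exact (Submodule.Quotient.eq _).2 (coneMul_leibniz h ξ P b hn he f) }

/-- The canonical morphism `A ⊗ A → C(ξ)`, `z ↦ [(z, 0)]`. -/
noncomputable def toCxi (P : A.PoincareDuality n) (b : A.HomogeneousBasis N) (hn : Odd n)
    (ξ : (A.tensor A).gr (2 * n - 2)) : Hom (A.tensor A) (Cxi h P b hn ξ) where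
  toAlgHom := AlgHom.ofLinearMap
    ((A.coneTop n).mkQ ∘ₗ LinearMap.inl ℚ (A.tensor A) A : A.tensor A →ₗ[ℚ] A.ConeQuot n)
    rfl
    (by
      intro z w
      refine congrArg (A.coneTop n).mkQ
        (?_ : ((z * w, 0) : A.Cone) = coneMul h ξ (z, 0) (w, 0))
      rw [coneMul_apply]
      simp)
  map_mem := fun hz => mk_mem_coneQuotGr (mem_coneGr.2 ⟨hz, zero_mem _⟩)
  map_d := by
    intro z
    refine congrArg (A.coneTop n).mkQ
      (?_ : (((A.tensor A).d z, 0) : A.Cone) = P.coneD b (z, 0))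
    rw [P.coneD_apply b hn, ← otₗ_apply]
    simp

/-- `(ss^{-n}1)^2 = ξ` in `C(ξ)`. -/
theorem Cxi_sq (P : A.PoincareDuality n) (b : A.HomogeneousBasis N) (hn : Odd n)
    (ξ : (A.tensor A).gr (2 * n - 2)) (s : Cxi h P b hn ξ)
    (hs : s = (A.coneTop n).mkQ (0, 1)) : s * s = (toCxi h P b hn ξ).toAlgHom ξ := by
  subst hs
  refine congrArg (A.coneTop n).mkQ (?_ : coneMul h ξ (0, 1) (0, 1) = ((ξ : A.tensor A), 0))
  rw [coneMul_apply]
  simp [h.aug_one]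

/-- The class of `ξ` in `H^{2n-2}(A ⊗ A) / ([Δ])`. -/
noncomputable def xiClass (P : A.PoincareDuality n) (b : A.HomogeneousBasis N) (hn : Odd n)
    (ξ : (A.tensor A).gr (2 * n - 2)) :
    (A.tensor A).HgrMod (2 * n - 2) ((A.tensor A).cls ⟨P.diag b, P.d_diag b⟩) :=
  Submodule.Quotient.mk
    ⟨(A.tensor A).cls ⟨ξ, P.d_eq_zero h hn ξ⟩, (A.tensor A).cls_mem ξ.2⟩

end model
end CDGA

/-! The algebras `C(ξ)` all live on one complex, the truncated mapping cone, and their products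
differ only in the square of the degree `n - 1` generator `σ = ss^{-n}1`. If `ξ` and `ξ'` agree
modulo `[Δ]`, then `ξ - ξ' = zΔ - dy` with `z` a cocycle. Since `dσ = Δ` and `zΔ = ±Δ(1 ⊗ m(z))`,
this difference is a coboundary `dω` in the cone, with `ω` of degree `2n - 3`. In `C(ξ')` the span
`W` of `ω` and `dω` is an ideal for degree reasons: degree 0 consists of scalars, degree 1 is zero,
and everything in degree at least `2n - 1` has been killed. It is also acyclic. The identity of the
complex is therefore multiplicative modulo an acyclic ideal, and the pairs `(x, y)` in `C(ξ) ×
C(ξ')` with `x - y ∈ W` form a CDGA whose two projections are surjective with kernel a copy of `W`.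
This is a span of quasi-isomorphisms under `A ⊗ A` (`spanUnder_of_mul_congr`,
`spanUnder_of_xiClass_eq`).

Weak equivalence asks for a relative Sullivan algebra in the middle. As `A ⊗ A` is 1-connected and
the middle term `E` has `H^0 = ℚ`, the map `A ⊗ A → E` has a relative Sullivan model
(`exists_relativeSullivan`), built by repeatedly adjoining free generators for the relative
cohomology classes of positive degree. Choosing these from a complement of the relative coboundaries
keeps `H^1` injective, so generators of degree 0 are never needed.

Transitivity glues two spans along a common `C(ξ)`. Any quasi-isomorphism to `C(ξ)` under `A ⊗ A` is
onto, because `σ` generates `C(ξ)` over `A ⊗ A` and can be lifted exactly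
(`surjective_of_isQuasiIso`). The fibre product of two surjective quasi-isomorphisms is again a
span, which is then replaced by a Sullivan model. The map `ψ` exists by the first part, and it is
onto because every class of `C(ξ)` is hit by the class of `ξ`. -/

namespace CDGA

/-! ### Homogeneous components and the degree involution. -/

section homogeneous
variable (A : CDGA.{u})

theorem sum_proj (x : A) : ∃ s : Finset ℕ, x = ∑ k ∈ s, A.proj k x := by
  classical
  exact ⟨_, (DirectSum.sum_support_decompose A.gr x).symm⟩

theorem algebraMap_mem (c : ℚ) : algebraMap ℚ A c ∈ A.gr 0 := by
  rw [Algebra.algebraMap_eq_smul_one]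
  exact Submodule.smul_mem _ _ A.one_mem

theorem d_algebraMap (c : ℚ) : A.d (algebraMap ℚ A c) = 0 := by
  rw [Algebra.algebraMap_eq_smul_one, map_smul, A.d_one, smul_zero]

theorem proj_succ_d (k : ℕ) (x : A) : A.proj (k + 1) (A.d x) = A.d (A.proj k x) := by
  have : A.proj (k + 1) ∘ₗ A.d = A.d ∘ₗ A.proj k := by
    refine A.lin_ext fun j a ha => ?_
    simp only [LinearMap.comp_apply]
    by_cases hj : j = k
    · subst hj
      rw [A.proj_same ha, A.proj_same (A.d_mem ha)]
    · rw [A.proj_ne hj ha, A.proj_ne (by omega) (A.d_mem ha), map_zero]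
  exact LinearMap.congr_fun this x

theorem proj_zero_d (x : A) : A.proj 0 (A.d x) = 0 := by
  have : A.proj 0 ∘ₗ A.d = 0 := by
    refine A.lin_ext fun j a ha => ?_
    exact A.proj_ne (Nat.succ_ne_zero j) (A.d_mem ha)
  exact LinearMap.congr_fun this x

theorem d_proj_eq_zero {x : A} (hx : A.d x = 0) (k : ℕ) : A.d (A.proj k x) = 0 := by
  rw [← A.proj_succ_d, hx, map_zero]

/-- A homogeneous coboundary is the coboundary of a homogeneous element. -/
theorem eq_d_proj {k : ℕ} {x y : A} (hx : x ∈ A.gr (k + 1)) (h : x = A.d y) :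
    x = A.d (A.proj k y) := by
  rw [← A.proj_succ_d, ← h, A.proj_same hx]

/-- The grading starts in degree 0 and `d` raises degree, so no coboundary has a component there. -/
theorem eq_zero_of_mem_zero_of_eq_d {x y : A} (hx : x ∈ A.gr 0) (h : x = A.d y) : x = 0 := by
  rw [← A.proj_same hx, h, A.proj_zero_d]

variable {A} {B : CDGA.{u}}

theorem map_proj {f : A →ₗ[ℚ] B} (hf : ∀ k, ∀ a ∈ A.gr k, f a ∈ B.gr k) (k : ℕ) (a : A) :
    f (A.proj k a) = B.proj k (f a) := by
  have : f ∘ₗ A.proj k = B.proj k ∘ₗ f := by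
    refine A.lin_ext fun j a ha => ?_
    simp only [LinearMap.comp_apply]
    by_cases hj : j = k
    · subst hj
      rw [A.proj_same ha, B.proj_same (hf j a ha)]
    · rw [A.proj_ne hj ha, B.proj_ne hj (hf j a ha), map_zero]
  exact LinearMap.congr_fun this a

theorem map_sgn {f : A →ₗ[ℚ] B} (hf : ∀ k, ∀ a ∈ A.gr k, f a ∈ B.gr k) (a : A) :
    f (A.sgn a) = B.sgn (f a) := by
  have : f ∘ₗ A.sgn = B.sgn ∘ₗ f := by
    refine A.lin_ext fun j a ha => ?_
    simp only [LinearMap.comp_apply]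
    rw [A.sgn_of_mem ha, B.sgn_of_mem (hf j a ha), map_smul]
  exact LinearMap.congr_fun this a

theorem sgn_mul (a b : A) : A.sgn (a * b) = A.sgn a * A.sgn b := by
  have : (LinearMap.mul ℚ A).compr₂ A.sgn = (LinearMap.mul ℚ A).compl₁₂ A.sgn A.sgn := by
    refine A.lin_ext fun i a ha => A.lin_ext fun j b hb => ?_
    simp only [LinearMap.compr₂_apply, LinearMap.compl₁₂_apply, LinearMap.mul_apply']
    rw [A.sgn_of_mem ha, A.sgn_of_mem hb, A.sgn_of_mem (A.mul_mem ha hb rfl), smul_mul_smul_comm,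
      pow_add]
  exact LinearMap.congr_fun₂ this a b

theorem sgn_mem {k : ℕ} {a : A} (ha : a ∈ A.gr k) : A.sgn a ∈ A.gr k := by
  rw [A.sgn_of_mem ha]
  exact Submodule.smul_mem _ _ ha

theorem sgn_one : A.sgn 1 = 1 := by
  rw [A.sgn_of_mem A.one_mem, pow_zero, one_smul]

end homogeneous

/-! ### Morphisms and criteria for quasi-isomorphisms. -/

namespace Hom
variable {A B C : CDGA.{u}}

/-- The composite of two morphisms. -/
def comp (g : Hom B C) (f : Hom A B) : Hom A C where
  toAlgHom := g.toAlgHom.comp f.toAlgHom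
  map_mem h := g.map_mem (f.map_mem h)
  map_d a := by simp only [AlgHom.comp_apply, f.map_d, g.map_d]

theorem comp_apply (g : Hom B C) (f : Hom A B) (a : A) :
    (g.comp f).toAlgHom a = g.toAlgHom (f.toAlgHom a) := rfl

theorem apply_proj (f : Hom A B) (k : ℕ) (a : A) :
    f.toAlgHom (A.proj k a) = B.proj k (f.toAlgHom a) :=
  map_proj (f := f.toAlgHom.toLinearMap) (fun _ _ h => f.map_mem h) k a

theorem onH_mk (f : Hom A B) (z : A.cocycles) : f.onH (A.cls z) = B.cls (f.onCocycles z) := rfl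

end Hom

theorem cls_eq_cls_iff {A : CDGA.{u}} {z w : A.cocycles} :
    A.cls z = A.cls w ↔ ∃ y, A.d y = (z : A) - w :=
  Ideal.Quotient.mk_eq_mk_iff_sub_mem z w

theorem cls_eq_zero_iff {A : CDGA.{u}} {z : A.cocycles} :
    A.cls z = 0 ↔ ∃ y, A.d y = (z : A) :=
  Ideal.Quotient.eq_zero_iff_mem

namespace Hom
variable {A B C : CDGA.{u}}

/-- A morphism is a quasi-isomorphism iff it reflects coboundaries and reaches every cocycle up to
a coboundary. -/
theorem isQuasiIso_iff (f : Hom A B) : f.IsQuasiIso ↔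
    (∀ x, A.d x = 0 → ∀ y, f.toAlgHom x = B.d y → ∃ x', x = A.d x') ∧
    (∀ y, B.d y = 0 → ∃ x, A.d x = 0 ∧ ∃ y', y = f.toAlgHom x + B.d y') := by
  refine and_congr ?_ ?_
  · have key : Function.Injective f.onH ↔ ∀ a, f.onH a = 0 → a = 0 :=
      ⟨fun h a ha => h (ha.trans (RingHom.map_zero f.onH).symm), fun h a b hab =>
        sub_eq_zero.1 (h _ ((RingHom.map_sub f.onH a b).trans (sub_eq_zero.2 hab)))⟩
    rw [key]
    constructor
    · intro h x hx y hy
      have := h (A.cls ⟨x, hx⟩) (by rw [f.onH_mk, cls_eq_zero_iff]; exact ⟨y, hy.symm⟩)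
      obtain ⟨x', hx'⟩ := cls_eq_zero_iff.1 this
      exact ⟨x', hx'.symm⟩
    · intro h a ha
      obtain ⟨⟨x, hx⟩, rfl⟩ := Ideal.Quotient.mk_surjective a
      obtain ⟨y, hy⟩ := cls_eq_zero_iff.1 ((f.onH_mk _).symm.trans ha)
      obtain ⟨x', hx'⟩ := h x hx y hy.symm
      exact cls_eq_zero_iff.2 ⟨x', hx'.symm⟩
  · constructor
    · intro h y hy
      obtain ⟨a, ha⟩ := h (B.cls ⟨y, hy⟩)
      obtain ⟨⟨x, hx⟩, rfl⟩ := Ideal.Quotient.mk_surjective a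
      obtain ⟨y', hy'⟩ := cls_eq_cls_iff.1 (ha.symm.trans (f.onH_mk _))
      refine ⟨x, hx, y', ?_⟩
      rw [hy']
      exact (add_sub_cancel _ _).symm
    · intro h a
      obtain ⟨⟨y, hy⟩, rfl⟩ := Ideal.Quotient.mk_surjective a
      obtain ⟨x, hx, y', hy'⟩ := h y hy
      refine ⟨A.cls ⟨x, hx⟩, ?_⟩
      rw [f.onH_mk]
      refine cls_eq_cls_iff.2 ⟨-y', ?_⟩
      change B.d (-y') = f.toAlgHom x - y
      rw [hy', map_neg]
      abel

theorem IsQuasiIso.comp {g : Hom B C} {f : Hom A B} (hg : g.IsQuasiIso) (hf : f.IsQuasiIso) :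
    (g.comp f).IsQuasiIso := by
  rw [isQuasiIso_iff] at *
  constructor
  · intro x hx y hy
    obtain ⟨y', hy'⟩ := hg.1 (f.toAlgHom x) (by rw [← f.map_d, hx, map_zero]) y hy
    exact hf.1 x hx y' hy'
  · intro y hy
    obtain ⟨x, hx, y', rfl⟩ := hg.2 y hy
    obtain ⟨w, hw, x', rfl⟩ := hf.2 x hx
    refine ⟨w, hw, g.toAlgHom x' + y', ?_⟩
    rw [comp_apply, map_add, map_add, g.map_d, add_assoc]

/-- It suffices to check homogeneous elements. -/
theorem isQuasiIso_of_homogeneous (f : Hom A B)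
    (h1 : ∀ k, ∀ x ∈ A.gr k, A.d x = 0 → ∀ y, f.toAlgHom x = B.d y → ∃ x', x = A.d x')
    (h2 : ∀ k, ∀ y ∈ B.gr k, B.d y = 0 → ∃ x, A.d x = 0 ∧ ∃ y', y = f.toAlgHom x + B.d y') :
    f.IsQuasiIso := by
  rw [isQuasiIso_iff]
  constructor
  · intro x hx y hy
    -- Each component is handled on its own. Degree 0 is separate: the coboundary `B.d y` has no
    -- component there, so `f` kills that part of `x`.
    have key : ∀ k, ∃ x', A.proj k x = A.d x' := by
      intro k
      have e : f.toAlgHom (A.proj k x) = B.proj k (B.d y) := by rw [f.apply_proj, hy]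
      cases k with
      | zero =>
        rw [B.proj_zero_d] at e
        exact h1 0 _ (A.proj_mem 0 x) (A.d_proj_eq_zero hx 0) 0 (by rw [e, map_zero])
      | succ k =>
        rw [B.proj_succ_d] at e
        exact h1 _ _ (A.proj_mem _ x) (A.d_proj_eq_zero hx _) _ e
    choose g hg using key
    obtain ⟨s, hs⟩ := A.sum_proj x
    refine ⟨∑ k ∈ s, g k, ?_⟩
    rw [map_sum]
    exact hs.trans (Finset.sum_congr rfl fun k _ => hg k)
  · intro y hy
    have key : ∀ k, ∃ x, A.d x = 0 ∧ ∃ y', B.proj k y = f.toAlgHom x + B.d y' := fun k =>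
      h2 k _ (B.proj_mem k y) (B.d_proj_eq_zero hy k)
    choose g hg g' hg' using key
    obtain ⟨s, hs⟩ := B.sum_proj y
    refine ⟨∑ k ∈ s, g k, ?_, ∑ k ∈ s, g' k, ?_⟩
    · rw [map_sum]
      exact Finset.sum_eq_zero fun k _ => hg k
    · rw [map_sum, map_sum, ← Finset.sum_add_distrib]
      exact hs.trans (Finset.sum_congr rfl fun k _ => hg' k)

/-- A surjective morphism with acyclic kernel is a quasi-isomorphism. -/
theorem isQuasiIso_of_surjective (f : Hom A B) (hs : Function.Surjective f.toAlgHom)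
    (hk : ∀ x, f.toAlgHom x = 0 → A.d x = 0 → ∃ x', f.toAlgHom x' = 0 ∧ x = A.d x') :
    f.IsQuasiIso := by
  rw [isQuasiIso_iff]
  constructor
  · intro x hx y hy
    obtain ⟨w, rfl⟩ := hs y
    -- Lifting the primitive `y` to `w` moves the problem into the kernel.
    obtain ⟨x', -, hx'⟩ := hk (x - A.d w) (by rw [map_sub, hy, f.map_d, sub_self])
      (by rw [map_sub, hx, A.d_d, sub_zero])
    exact ⟨x' + w, by rw [map_add, ← hx']; abel⟩
  · intro y hy
    obtain ⟨w, rfl⟩ := hs y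
    obtain ⟨x', hx', hd⟩ := hk (A.d w) (by rw [f.map_d, hy]) (A.d_d w)
    exact ⟨w - x', by rw [map_sub, ← hd, sub_self], 0, by rw [map_sub, hx']; simp⟩

/-- The kernel of a surjective quasi-isomorphism is acyclic. -/
theorem IsQuasiIso.acyclic_ker {f : Hom A B} (hf : f.IsQuasiIso)
    (hs : Function.Surjective f.toAlgHom) {x : A} (h0 : f.toAlgHom x = 0) (hx : A.d x = 0) :
    ∃ x', f.toAlgHom x' = 0 ∧ x = A.d x' := by
  rw [isQuasiIso_iff] at hf
  obtain ⟨x', rfl⟩ := hf.1 x hx 0 (by rw [h0, map_zero])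
  obtain ⟨w, hw, y', hy'⟩ := hf.2 (f.toAlgHom x') (by rw [← f.map_d, h0])
  obtain ⟨v, rfl⟩ := hs y'
  -- The primitive `x'` need not lie in the kernel, but its image is a cocycle, hence the image of a
  -- cocycle `w` plus that of some `A.d v`. Subtracting both leaves the differential unchanged.
  refine ⟨x' - w - A.d v, ?_, ?_⟩
  · rw [map_sub, map_sub, f.map_d, hy']
    abel
  · rw [map_sub, map_sub, A.d_d, hw, sub_zero, sub_zero]

end Hom

/-! ### Cohomological connectedness. -/

/-- `H^0(A) = ℚ`. -/
structure CohConnected (A : CDGA.{u}) : Prop where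
  nontrivial : Nontrivial A
  scalar : ∀ x ∈ A.gr 0, A.d x = 0 → ∃ c : ℚ, x = algebraMap ℚ A c

/-- There are no nonzero coboundaries in degree 0, so two degree 0 cocycles with the same cohomology
class are equal. -/
theorem CohConnected.of_isQuasiIso {A B : CDGA.{u}} {f : Hom A B} (hf : f.IsQuasiIso)
    (hB : B.CohConnected) : A.CohConnected where
  nontrivial := by
    have := hB.nontrivial
    exact f.toAlgHom.toRingHom.domain_nontrivial
  scalar := by
    intro x hx hd
    obtain ⟨c, hc⟩ := hB.scalar _ (f.map_mem hx) (by rw [← f.map_d, hd, map_zero])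
    obtain ⟨x', hx'⟩ := (f.isQuasiIso_iff.1 hf).1 (x - algebraMap ℚ A c)
      (by rw [map_sub, hd, A.d_algebraMap, sub_zero]) 0
      (by rw [map_sub, hc, AlgHom.commutes, sub_self, map_zero])
    exact ⟨c, sub_eq_zero.1
      (A.eq_zero_of_mem_zero_of_eq_d (sub_mem hx (A.algebraMap_mem c)) hx')⟩

/-! ### Differential graded subalgebras of a product. -/

section subProd
variable {A B : CDGA.{u}} (S : Subalgebra ℚ (A × B))
  (hd : ∀ x ∈ S, (A.d x.1, B.d x.2) ∈ S)
  (hp : ∀ k, ∀ x ∈ S, (A.proj k x.1, B.proj k x.2) ∈ S)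

/-- A subalgebra of the product of two CDGAs which is graded and closed under the differential. -/
noncomputable def subProd : CDGA.{u} where
  carrier := S
  gr k := ((A.gr k).prod (B.gr k)).comap S.val.toLinearMap
  gradedMonoid :=
    { one_mem := ⟨A.one_mem, B.one_mem⟩
      mul_mem := fun _ _ _ _ hx hy => ⟨A.mul_mem hx.1 hy.1 rfl, B.mul_mem hx.2 hy.2 rfl⟩ }
  isInternal := by
    refine isInternal_of_proj _ (fun k => LinearMap.restrict (p := S.toSubmodule)
      (q := S.toSubmodule) ((A.proj k).prodMap (B.proj k)) (hp k)) ?_ ?_ ?_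
    · intro k x hx
      exact Subtype.ext (Prod.ext (A.proj_same hx.1) (B.proj_same hx.2))
    · intro k j hj x hx
      exact Subtype.ext (Prod.ext (A.proj_ne hj hx.1) (B.proj_ne hj hx.2))
    · rw [eq_top_iff]
      rintro ⟨x, hx⟩ -
      obtain ⟨s, hs⟩ := A.sum_proj x.1
      obtain ⟨t, ht⟩ := B.sum_proj x.2
      -- The two coordinates may have different supports, so the sum runs over their union, where
      -- the extra components vanish.
      have key : (⟨x, hx⟩ : S) = ∑ k ∈ s ∪ t, ⟨(A.proj k x.1, B.proj k x.2), hp k x hx⟩ := by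
        refine Subtype.ext ?_
        rw [AddSubmonoidClass.coe_finsetSum]
        refine Prod.ext ?_ ?_
        · rw [Prod.fst_sum]
          refine hs.trans (Finset.sum_subset Finset.subset_union_left fun k _ hk => ?_)
          rw [hs, map_sum]
          exact Finset.sum_eq_zero fun j hj =>
            A.proj_ne (by rintro rfl; exact hk hj) (A.proj_mem j _)
        · rw [Prod.snd_sum]
          refine ht.trans (Finset.sum_subset Finset.subset_union_right fun k _ hk => ?_)
          rw [ht, map_sum]
          exact Finset.sum_eq_zero fun j hj =>
            B.proj_ne (by rintro rfl; exact hk hj) (B.proj_mem j _)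
      rw [key]
      exact Submodule.sum_mem _ fun k _ =>
        Submodule.mem_iSup_of_mem k ⟨A.proj_mem k _, B.proj_mem k _⟩
  d := LinearMap.restrict (p := S.toSubmodule) (q := S.toSubmodule) (A.d.prodMap B.d) hd
  d_mem h := ⟨A.d_mem h.1, B.d_mem h.2⟩
  d_d x := Subtype.ext (Prod.ext (A.d_d _) (B.d_d _))
  graded_comm ha hb := Subtype.ext (Prod.ext (A.graded_comm ha.1 hb.1) (B.graded_comm ha.2 hb.2))
  leibniz ha b := Subtype.ext (Prod.ext (A.leibniz ha.1 _) (B.leibniz ha.2 _))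

/-- The first projection. -/
noncomputable def subProdFst : Hom (subProd S hd hp) A where
  toAlgHom := (AlgHom.fst ℚ A B).comp S.val
  map_mem h := h.1
  map_d _ := rfl

/-- The second projection. -/
noncomputable def subProdSnd : Hom (subProd S hd hp) B where
  toAlgHom := (AlgHom.snd ℚ A B).comp S.val
  map_mem h := h.2
  map_d _ := rfl

/-- The morphism into a subalgebra of a product with given components. -/
noncomputable def subProdLift {R : CDGA.{u}} (f : Hom R A) (g : Hom R B)
    (h : ∀ r, (f.toAlgHom r, g.toAlgHom r) ∈ S) : Hom R (subProd S hd hp) where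
  toAlgHom := (f.toAlgHom.prod g.toAlgHom).codRestrict S h
  map_mem hr := ⟨f.map_mem hr, g.map_mem hr⟩
  map_d r := Subtype.ext (Prod.ext (f.map_d r) (g.map_d r))

end subProd

/-! ### Spans of quasi-isomorphisms. -/

/-- `f` and `g` are joined by a span of quasi-isomorphisms under `R`. -/
def SpanUnder {R P Q : CDGA.{u}} (f : Hom R P) (g : Hom R Q) : Prop :=
  ∃ (E : CDGA.{u}) (i : Hom R E) (α : Hom E P) (β : Hom E Q), α.IsQuasiIso ∧ β.IsQuasiIso ∧
    (∀ r, α.toAlgHom (i.toAlgHom r) = f.toAlgHom r) ∧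
    (∀ r, β.toAlgHom (i.toAlgHom r) = g.toAlgHom r)

/-- The fibre product of two surjective quasi-isomorphisms is a span of quasi-isomorphisms. -/
theorem spanUnder_of_surjective {R P P' Q : CDGA.{u}} {f : Hom R P} {f' : Hom R P'}
    {p : Hom P Q} {p' : Hom P' Q} (hp : p.IsQuasiIso) (hp' : p'.IsQuasiIso)
    (hs : Function.Surjective p.toAlgHom) (hs' : Function.Surjective p'.toAlgHom)
    (hc : ∀ r, p.toAlgHom (f.toAlgHom r) = p'.toAlgHom (f'.toAlgHom r)) : SpanUnder f f' := by
  let S : Subalgebra ℚ (P × P') := AlgHom.equalizer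
    (p.toAlgHom.comp (AlgHom.fst ℚ P P')) (p'.toAlgHom.comp (AlgHom.snd ℚ P P'))
  have hS : ∀ x : P × P', x ∈ S ↔ p.toAlgHom x.1 = p'.toAlgHom x.2 := fun x => Iff.rfl
  have hd : ∀ x ∈ S, (P.d x.1, P'.d x.2) ∈ S := by
    intro x hx
    rw [hS] at *
    rw [p.map_d, p'.map_d, hx]
  have hpr : ∀ k, ∀ x ∈ S, (P.proj k x.1, P'.proj k x.2) ∈ S := by
    intro k x hx
    rw [hS] at *
    rw [p.apply_proj, p'.apply_proj, hx]
  refine ⟨subProd S hd hpr, subProdLift S hd hpr f f' hc, subProdFst S hd hpr,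
    subProdSnd S hd hpr, ?_, ?_, fun _ => rfl, fun _ => rfl⟩
  -- The first projection is onto because `p'` is. Its kernel is a copy of `ker p'`, which is
  -- acyclic. The second projection is symmetric.
  · refine Hom.isQuasiIso_of_surjective _ ?_ ?_
    · intro x
      obtain ⟨y, hy⟩ := hs' (p.toAlgHom x)
      exact ⟨⟨(x, y), hy.symm⟩, rfl⟩
    · rintro ⟨⟨x, y⟩, hxy⟩ h0 h1
      obtain rfl : x = 0 := h0
      have hy : p'.toAlgHom y = 0 := by
        have := (hS _).1 hxy
        rw [← this, map_zero]
      obtain ⟨y', hy', rfl⟩ := hp'.acyclic_ker hs' hy (congrArg (fun z => z.1.2) h1)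
      exact ⟨⟨(0, y'), by rw [hS, hy', map_zero]⟩, rfl,
        Subtype.ext (Prod.ext (map_zero P.d).symm rfl)⟩
  · refine Hom.isQuasiIso_of_surjective _ ?_ ?_
    · intro y
      obtain ⟨x, hx⟩ := hs (p'.toAlgHom y)
      exact ⟨⟨(x, y), hx⟩, rfl⟩
    · rintro ⟨⟨x, y⟩, hxy⟩ h0 h1
      obtain rfl : y = 0 := h0
      have hx : p.toAlgHom x = 0 := by
        have := (hS _).1 hxy
        rw [this, map_zero]
      obtain ⟨x', hx', rfl⟩ := hp.acyclic_ker hs hx (congrArg (fun z => z.1.1) h1)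
      exact ⟨⟨(x', 0), by rw [hS, hx', map_zero]⟩, rfl,
        Subtype.ext (Prod.ext rfl (map_zero P'.d).symm)⟩

/-- Two CDGAs with the same underlying complex, whose multiplications agree up to an acyclic
differential ideal, are joined by a span of quasi-isomorphisms. -/
theorem spanUnder_of_mul_congr {R P Q : CDGA.{u}} {f : Hom R P} {g : Hom R Q} (θ : P ≃ₗ[ℚ] Q)
    (hθ : ∀ k, ∀ a ∈ P.gr k, θ a ∈ Q.gr k) (hθd : ∀ a, θ (P.d a) = Q.d (θ a)) (hθ1 : θ 1 = 1)
    (W : Submodule ℚ Q) (hWl : ∀ a, ∀ w ∈ W, a * w ∈ W) (hWr : ∀ a, ∀ w ∈ W, w * a ∈ W)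
    (hWp : ∀ k, ∀ w ∈ W, Q.proj k w ∈ W) (hWd : ∀ w ∈ W, Q.d w ∈ W)
    (hWa : ∀ w ∈ W, Q.d w = 0 → ∃ v ∈ W, w = Q.d v)
    (hm : ∀ a b, θ (a * b) - θ a * θ b ∈ W) (hfg : ∀ r, θ (f.toAlgHom r) = g.toAlgHom r) :
    SpanUnder f g := by
  -- The graph of `θ` is not a subalgebra, but its thickening by the ideal `W` is, since `W`
  -- contains the failure of `θ` to be multiplicative. Through `θ`, both projections have kernel
  -- `W`.
  let S : Subalgebra ℚ (P × Q) :=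
    { carrier := {x | θ x.1 - x.2 ∈ W}
      mul_mem' := by
        intro x y hx hy
        have e : θ (x.1 * y.1) - x.2 * y.2 = (θ (x.1 * y.1) - θ x.1 * θ y.1) +
            ((θ x.1 - x.2) * θ y.1 + x.2 * (θ y.1 - y.2)) := by
          rw [sub_mul, mul_sub]; abel
        change θ (x.1 * y.1) - x.2 * y.2 ∈ W
        rw [e]
        exact add_mem (hm _ _) (add_mem (hWr _ _ hx) (hWl _ _ hy))
      add_mem' := by
        intro x y hx hy
        have e : θ (x.1 + y.1) - (x.2 + y.2) = (θ x.1 - x.2) + (θ y.1 - y.2) := by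
          rw [map_add]; abel
        change θ (x.1 + y.1) - (x.2 + y.2) ∈ W
        rw [e]
        exact add_mem hx hy
      algebraMap_mem' := by
        intro c
        change θ (algebraMap ℚ P c) - algebraMap ℚ Q c ∈ W
        rw [Algebra.algebraMap_eq_smul_one, Algebra.algebraMap_eq_smul_one, map_smul, hθ1,
          sub_self]
        exact zero_mem _ }
  have hS : ∀ x : P × Q, x ∈ S ↔ θ x.1 - x.2 ∈ W := fun x => Iff.rfl
  have hd : ∀ x ∈ S, (P.d x.1, Q.d x.2) ∈ S := by
    intro x hx
    rw [hS] at *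
    rw [hθd, ← map_sub]
    exact hWd _ hx
  have hp : ∀ k, ∀ x ∈ S, (P.proj k x.1, Q.proj k x.2) ∈ S := by
    intro k x hx
    rw [hS] at *
    have := map_proj (f := θ.toLinearMap) hθ k x.1
    simp only [LinearEquiv.coe_coe] at this
    rw [this, ← map_sub]
    exact hWp k _ hx
  refine ⟨subProd S hd hp, subProdLift S hd hp f g fun r => ?_, subProdFst S hd hp,
    subProdSnd S hd hp, ?_, ?_, fun _ => rfl, fun _ => rfl⟩
  · rw [hS, hfg, sub_self]
    exact zero_mem _
  · refine Hom.isQuasiIso_of_surjective _ ?_ ?_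
    · intro x
      exact ⟨⟨(x, θ x), by rw [hS, sub_self]; exact zero_mem _⟩, rfl⟩
    · rintro ⟨⟨x, y⟩, hxy⟩ h0 h1
      obtain rfl : x = 0 := h0
      rw [hS, map_zero, zero_sub, neg_mem_iff] at hxy
      obtain ⟨v, hv, rfl⟩ := hWa y hxy (congrArg (fun z => z.1.2) h1)
      exact ⟨⟨(0, v), by rwa [hS, map_zero, zero_sub, neg_mem_iff]⟩, rfl,
        Subtype.ext (Prod.ext (map_zero P.d).symm rfl)⟩
  · refine Hom.isQuasiIso_of_surjective _ ?_ ?_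
    · intro y
      exact ⟨⟨(θ.symm y, y), by
        rw [hS, LinearEquiv.apply_symm_apply, sub_self]; exact zero_mem _⟩, rfl⟩
    · rintro ⟨⟨x, y⟩, hxy⟩ h0 h1
      obtain rfl : y = 0 := h0
      rw [hS, sub_zero] at hxy
      have h1' : P.d x = 0 := congrArg (fun z => z.1.1) h1
      obtain ⟨v, hv, e⟩ := hWa (θ x) hxy (by rw [← hθd, h1', map_zero])
      have ex : x = P.d (θ.symm v) := by
        apply θ.injective
        rw [hθd, LinearEquiv.apply_symm_apply, e]
      refine ⟨⟨(θ.symm v, 0), by rwa [hS, LinearEquiv.apply_symm_apply, sub_zero]⟩, rfl,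
        Subtype.ext (Prod.ext ex (map_zero Q.d).symm)⟩

/-! ### The free graded commutative algebra and its grading. -/

namespace FreeCGA

theorem neg_one_pow_mul_self (m : ℕ) : ((-1 : ℚ) ^ m) * (-1) ^ m = 1 := by
  rw [← mul_pow]; simp

section degree
variable {V : ℕ → Type u}

/-- The degree of a product of generators. -/
def deg (l : List (Σ p, V p)) : ℕ := (l.map Sigma.fst).sum

theorem deg_cons (g : Σ p, V p) (l : List (Σ p, V p)) : deg (g :: l) = g.1 + deg l :=
  List.sum_cons

theorem deg_append (l l' : List (Σ p, V p)) : deg (l ++ l') = deg l + deg l' := by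
  simp [deg]

end degree

variable {V : ℕ → Type u} [∀ p, AddCommGroup (V p)] [∀ p, Module ℚ (V p)]

variable (V) in
/-- The inclusion of the generators of degree `p`. -/
noncomputable def ι (p : ℕ) : V p →ₗ[ℚ] FreeCGA V :=
  (RingQuot.mkAlgHom ℚ (FreeRel V)).toLinearMap ∘ₗ TensorAlgebra.ι ℚ ∘ₗ DirectSum.lof ℚ ℕ V p

theorem ι_mul_ι {p q : ℕ} (v : V p) (w : V q) :
    ι V p v * ι V q w = (-1 : ℚ) ^ (p * q) • (ι V q w * ι V p v) := by
  have := RingQuot.mkAlgHom_rel ℚ (FreeRel.swap (V := V) p q v w)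
  rw [map_mul, map_smul, map_mul] at this
  exact this

/-- The universal property of the free graded commutative algebra. -/
noncomputable def lift {B : Type*} [Ring B] [Algebra ℚ B] (φ : ∀ p, V p →ₗ[ℚ] B)
    (h : ∀ p q, ∀ v : V p, ∀ w : V q, φ p v * φ q w = (-1 : ℚ) ^ (p * q) • (φ q w * φ p v)) :
    FreeCGA V →ₐ[ℚ] B :=
  RingQuot.liftAlgHom ℚ ⟨TensorAlgebra.lift ℚ (DirectSum.toModule ℚ ℕ B φ), by
    rintro _ _ ⟨p, q, v, w⟩
    simp only [map_mul, map_smul, TensorAlgebra.lift_ι_apply, DirectSum.toModule_lof]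
    exact h p q v w⟩

theorem lift_ι {B : Type*} [Ring B] [Algebra ℚ B] (φ : ∀ p, V p →ₗ[ℚ] B)
    (h : ∀ p q, ∀ v : V p, ∀ w : V q, φ p v * φ q w = (-1 : ℚ) ^ (p * q) • (φ q w * φ p v))
    {p : ℕ} (v : V p) : lift φ h (ι V p v) = φ p v := by
  refine (RingQuot.liftAlgHom_mkAlgHom_apply _ _ _ _).trans ?_
  rw [LinearMap.comp_apply, TensorAlgebra.lift_ι_apply, DirectSum.toModule_lof]

theorem algHom_ext {B : Type*} [Ring B] [Algebra ℚ B] {f g : FreeCGA V →ₐ[ℚ] B}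
    (h : ∀ p, ∀ v : V p, f (ι V p v) = g (ι V p v)) : f = g := by
  refine RingQuot.ringQuot_ext' ℚ _ _ (TensorAlgebra.hom_ext (DirectSum.linearMap_ext ℚ ?_))
  intro p
  ext v
  exact h p v

/-- The universal property gives a map from the free algebra to `S` which, followed by the inclusion
of `S`, is the identity. -/
theorem eq_top_of_ι_mem (S : Subalgebra ℚ (FreeCGA V)) (hS : ∀ p, ∀ v : V p, ι V p v ∈ S) :
    S = ⊤ := by
  have key : S.val.comp (lift (V := V) (B := S)
      (fun p => (ι V p).codRestrict S.toSubmodule (hS p))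
      (fun p q v w => Subtype.ext (ι_mul_ι v w))) = AlgHom.id ℚ _ := by
    refine algHom_ext fun p v => ?_
    rw [AlgHom.comp_apply, lift_ι]
    rfl
  rw [eq_top_iff]
  rintro x -
  have := congrArg (fun f => f x) key
  simp only [AlgHom.comp_apply, AlgHom.id_apply] at this
  rw [← this]
  exact Subtype.property _

/-- The product of a list of generators. -/
noncomputable def mono (l : List (Σ p, V p)) : FreeCGA V := (l.map fun g => ι V g.1 g.2).prod

theorem mono_nil : mono ([] : List (Σ p, V p)) = 1 := rfl

theorem mono_cons (g : Σ p, V p) (l : List (Σ p, V p)) :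
    mono (g :: l) = ι V g.1 g.2 * mono l := List.prod_cons

theorem mono_append (l l' : List (Σ p, V p)) : mono (l ++ l') = mono l * mono l' := by
  simp [mono]

theorem ι_mul_mono {p : ℕ} (v : V p) (l : List (Σ p, V p)) :
    ι V p v * mono l = (-1 : ℚ) ^ (p * deg l) • (mono l * ι V p v) := by
  induction l with
  | nil => simp [mono_nil, deg]
  | cons g l ih =>
    rw [mono_cons, deg_cons, ← mul_assoc, ι_mul_ι, smul_mul_assoc, mul_assoc, ih, mul_smul_comm,
      smul_smul, mul_add, pow_add, mul_assoc]

theorem mono_mul_mono (l l' : List (Σ p, V p)) :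
    mono l * mono l' = (-1 : ℚ) ^ (deg l * deg l') • (mono l' * mono l) := by
  induction l with
  | nil => simp [mono_nil, deg]
  | cons g l ih =>
    rw [mono_cons, deg_cons, mul_assoc, ih, mul_smul_comm, ← mul_assoc, ι_mul_mono,
      smul_mul_assoc, smul_smul, add_mul, pow_add, mul_assoc, mul_comm ((-1 : ℚ) ^ _)]

variable (V) in
/-- The degree `k` part: the span of the products of generators of total degree `k`. -/
noncomputable def gr (k : ℕ) : Submodule ℚ (FreeCGA V) :=
  Submodule.span ℚ {x | ∃ l : List (Σ p, V p), deg l = k ∧ x = mono l}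

theorem mono_mem (l : List (Σ p, V p)) : mono l ∈ gr V (deg l) :=
  Submodule.subset_span ⟨l, rfl, rfl⟩

theorem ι_mem {p : ℕ} (v : V p) : ι V p v ∈ gr V p := by
  have := mono_mem [(⟨p, v⟩ : Σ p, V p)]
  simpa [mono, deg] using this

instance gradedMonoid : SetLike.GradedMonoid (gr V) where
  one_mem := mono_mem []
  mul_mem := by
    intro k l x y hx hy
    have h1 : ∀ m : List (Σ p, V p), deg m = k →
        gr V l ≤ (gr V (k + l)).comap (LinearMap.mul ℚ (FreeCGA V) (mono m)) := by
      intro m hm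
      refine Submodule.span_le.2 ?_
      rintro _ ⟨m', hm', rfl⟩
      change mono m * mono m' ∈ gr V (k + l)
      rw [← mono_append, ← hm, ← hm', ← deg_append]
      exact mono_mem _
    have h2 : gr V k ≤ (gr V (k + l)).comap ((LinearMap.mul ℚ (FreeCGA V)).flip y) := by
      refine Submodule.span_le.2 ?_
      rintro _ ⟨m, hm, rfl⟩
      exact h1 m hm hy
    exact h2 hx

variable (V) in
/-- The algebra morphism multiplying the degree `k` part by `X ^ k`. -/
noncomputable def polyHom : FreeCGA V →ₐ[ℚ] Polynomial (FreeCGA V) :=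
  lift (B := Polynomial (FreeCGA V))
    (fun p => (Polynomial.monomial (R := FreeCGA V) p).restrictScalars ℚ ∘ₗ ι V p) (by
    intro p q v w
    simp only [LinearMap.comp_apply, LinearMap.restrictScalars_apply]
    rw [Polynomial.monomial_mul_monomial, Polynomial.monomial_mul_monomial, ι_mul_ι,
      Polynomial.smul_monomial, add_comm])

theorem polyHom_mono (l : List (Σ p, V p)) :
    polyHom V (mono l) = Polynomial.monomial (deg l) (mono l) := by
  induction l with
  | nil => simp [mono_nil, deg]
  | cons g l ih =>
    rw [mono_cons, deg_cons, map_mul, ih, polyHom, lift_ι, LinearMap.comp_apply,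
      LinearMap.restrictScalars_apply, Polynomial.monomial_mul_monomial]

theorem iSup_gr_eq_top : ⨆ k, gr V k = ⊤ := by
  let S : Subalgebra ℚ (FreeCGA V) := (⨆ k, gr V k).toSubalgebra
    (Submodule.mem_iSup_of_mem 0 (mono_mem [])) (by
      intro x y hx hy
      have h1 : ∀ k, ∀ x ∈ gr V k,
          ⨆ k, gr V k ≤ (⨆ k, gr V k).comap (LinearMap.mul ℚ (FreeCGA V) x) :=
        fun k x hx => iSup_le fun l y hy =>
          Submodule.mem_iSup_of_mem (k + l) (SetLike.mul_mem_graded hx hy)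
      have h2 : ⨆ k, gr V k ≤ (⨆ k, gr V k).comap ((LinearMap.mul ℚ (FreeCGA V)).flip y) :=
        iSup_le fun k x hx => h1 k x hx hy
      exact h2 hx)
  have hS : S = ⊤ := eq_top_of_ι_mem S fun p v => Submodule.mem_iSup_of_mem p (ι_mem v)
  rw [eq_top_iff]
  rintro x -
  have hx : x ∈ (⊤ : Subalgebra ℚ (FreeCGA V)) := trivial
  rw [← hS] at hx
  exact hx

/-- The variable `X` is central, so `polyHom` records degrees as exponents, and extracting the
coefficient of `X ^ k` gives the separating projections. No basis of monomials is needed. -/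
theorem isInternal_gr : DirectSum.IsInternal (gr V) := by
  have key : ∀ k, ∀ x ∈ gr V k, polyHom V x = Polynomial.monomial k x := by
    intro k x hx
    have : gr V k ≤ LinearMap.eqLocus (polyHom V).toLinearMap
        ((Polynomial.monomial k).restrictScalars ℚ) := by
      refine Submodule.span_le.2 ?_
      rintro _ ⟨l, rfl, rfl⟩
      exact polyHom_mono l
    exact this hx
  refine isInternal_of_proj _
    (fun k => (Polynomial.lcoeff (FreeCGA V) k).restrictScalars ℚ ∘ₗ (polyHom V).toLinearMap)
    ?_ ?_ iSup_gr_eq_top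
  · intro k x hx
    simp [key k x hx]
  · intro k j hj x hx
    simp [key j x hx, Polynomial.coeff_monomial, hj]

theorem mul_comm_of_mem {p q : ℕ} {x y : FreeCGA V} (hx : x ∈ gr V p) (hy : y ∈ gr V q) :
    x * y = (-1 : ℚ) ^ (p * q) • (y * x) := by
  have h1 : ∀ m : List (Σ p, V p), deg m = p →
      gr V q ≤ LinearMap.eqLocus (LinearMap.mul ℚ (FreeCGA V) (mono m))
        ((-1 : ℚ) ^ (p * q) • (LinearMap.mul ℚ (FreeCGA V)).flip (mono m)) := by
    rintro m rfl
    refine Submodule.span_le.2 ?_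
    rintro _ ⟨m', rfl, rfl⟩
    exact mono_mul_mono m m'
  have h2 : gr V p ≤ LinearMap.eqLocus ((LinearMap.mul ℚ (FreeCGA V)).flip y)
      ((-1 : ℚ) ^ (p * q) • LinearMap.mul ℚ (FreeCGA V) y) := by
    refine Submodule.span_le.2 ?_
    rintro _ ⟨m, hm, rfl⟩
    exact h1 m hm hy
  exact h2 hx

/-- Any monomial of degree 0 other than the empty one contains a generator of degree 0, hence is
zero. -/
theorem gr_zero_le [Subsingleton (V 0)] {x : FreeCGA V} (hx : x ∈ gr V 0) :
    ∃ c : ℚ, x = algebraMap ℚ _ c := by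
  have : gr V 0 ≤ LinearMap.range (Algebra.linearMap ℚ (FreeCGA V)) := by
    refine Submodule.span_le.2 ?_
    rintro _ ⟨l, hl, rfl⟩
    rcases l with _ | ⟨⟨p, v⟩, l⟩
    · exact ⟨1, map_one (algebraMap ℚ (FreeCGA V))⟩
    · rw [deg_cons] at hl
      obtain rfl : p = 0 := by simp only at hl; omega
      rw [mono_cons, Subsingleton.elim v 0, map_zero, zero_mul]
      exact zero_mem _
  obtain ⟨c, hc⟩ := this hx
  exact ⟨c, hc.symm⟩

theorem gr_one_le [Subsingleton (V 0)] {x : FreeCGA V} (hx : x ∈ gr V 1) :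
    ∃ v : V 1, x = ι V 1 v := by
  have : gr V 1 ≤ LinearMap.range (ι V 1) := by
    refine Submodule.span_le.2 ?_
    rintro _ ⟨l, hl, rfl⟩
    rcases l with _ | ⟨⟨p, v⟩, l⟩
    · simp [deg] at hl
    · rw [deg_cons] at hl
      simp only at hl
      rw [mono_cons]
      rcases Nat.eq_zero_or_pos p with rfl | hp
      · rw [Subsingleton.elim v 0, map_zero, zero_mul]
        exact zero_mem _
      · obtain rfl : p = 1 := by omega
        obtain ⟨c, hc⟩ := gr_zero_le (x := mono l) (by
          have := mono_mem l
          rwa [show deg l = 0 by omega] at this)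
        refine ⟨c • v, ?_⟩
        rw [hc, map_smul, ← Algebra.commutes, ← Algebra.smul_def]
  obtain ⟨c, hc⟩ := this hx
  exact ⟨c, hc.symm⟩

/-- The generators are detected in the square-zero extension of `ℚ` by their direct sum, where all
products of two of them vanish and the commutation relations hold trivially. -/
theorem ι_injective (p : ℕ) : Function.Injective (ι V p) := by
  -- The algebra structure on the square-zero extension needs a right action as well; it is taken
  -- equal to the left one.
  let _ : Module ℚᵐᵒᵖ (⨁ p, V p) := Module.compHom _ ((RingHom.id ℚ).fromOpposite mul_comm)
  have : IsCentralScalar ℚ (⨁ p, V p) := ⟨fun r m => rfl⟩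
  let f : FreeCGA V →ₐ[ℚ] TrivSqZeroExt ℚ (⨁ p, V p) :=
    lift (fun p => TrivSqZeroExt.inrHom ℚ (⨁ p, V p) ∘ₗ DirectSum.lof ℚ ℕ V p) (by
      intro p q v w
      simp)
  intro v w hvw
  have h := congrArg f hvw
  simp only [f, lift_ι, LinearMap.comp_apply, TrivSqZeroExt.inrHom_apply] at h
  exact DirectSum.of_injective p (TrivSqZeroExt.inr_injective h)

/-- Isomorphic spaces of generators give isomorphic free algebras. -/
noncomputable def congr {W : ℕ → Type u} [∀ p, AddCommGroup (W p)] [∀ p, Module ℚ (W p)]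
    (e : ∀ p, V p ≃ₗ[ℚ] W p) : FreeCGA V ≃ₐ[ℚ] FreeCGA W :=
  AlgEquiv.ofAlgHom
    (lift (fun p => ι W p ∘ₗ (e p).toLinearMap) (fun _ _ _ _ => ι_mul_ι _ _))
    (lift (fun p => ι V p ∘ₗ (e p).symm.toLinearMap) (fun _ _ _ _ => ι_mul_ι _ _))
    (algHom_ext fun p v => by
      simp only [AlgHom.comp_apply, lift_ι, LinearMap.comp_apply, LinearEquiv.coe_coe,
        LinearEquiv.apply_symm_apply, AlgHom.id_apply])
    (algHom_ext fun p v => by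
      simp only [AlgHom.comp_apply, lift_ι, LinearMap.comp_apply, LinearEquiv.coe_coe,
        LinearEquiv.symm_apply_apply, AlgHom.id_apply])

theorem congr_ι {W : ℕ → Type u} [∀ p, AddCommGroup (W p)] [∀ p, Module ℚ (W p)]
    (e : ∀ p, V p ≃ₗ[ℚ] W p) {p : ℕ} (v : V p) : congr e (ι V p v) = ι W p (e p v) :=
  lift_ι _ _ v

end FreeCGA

theorem freeLift_ι {M : CDGA.{u}} (V : ℕ → Submodule ℚ M) (hV : ∀ p, V p ≤ M.gr p) {p : ℕ}
    (v : V p) : freeLift V hV (FreeCGA.ι (fun p => V p) p v) = v := by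
  refine (RingQuot.liftAlgHom_mkAlgHom_apply _ _ _ _).trans ?_
  rw [LinearMap.comp_apply, TensorAlgebra.lift_ι_apply, DirectSum.toModule_lof]
  rfl

/-! ### The free algebra as a CDGA. -/

/-- The free graded commutative algebra `ΛV`, with zero differential. -/
noncomputable def free (V : ℕ → Type u) [∀ p, AddCommGroup (V p)] [∀ p, Module ℚ (V p)] :
    CDGA.{u} where
  carrier := FreeCGA V
  gr := FreeCGA.gr V
  isInternal := FreeCGA.isInternal_gr
  d := 0
  d_mem _ := zero_mem _
  d_d _ := rfl
  graded_comm := FreeCGA.mul_comm_of_mem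
  leibniz _ _ := by simp

section free
variable {V : ℕ → Type u} [∀ p, AddCommGroup (V p)] [∀ p, Module ℚ (V p)]

variable (V) in
/-- The inclusion of the generators of degree `p` in the CDGA `ΛV`. -/
noncomputable def gen (p : ℕ) : V p →ₗ[ℚ] free V := FreeCGA.ι V p

theorem gen_mem {p : ℕ} (v : V p) : gen V p v ∈ (free V).gr p := FreeCGA.ι_mem v

theorem gen_injective (p : ℕ) : Function.Injective (gen V p) := FreeCGA.ι_injective p

theorem free_eq_top (S : Subalgebra ℚ (free V)) (hS : ∀ p, ∀ v : V p, gen V p v ∈ S) : S = ⊤ :=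
  FreeCGA.eq_top_of_ι_mem S hS

/-- Algebra morphisms out of `ΛV`. -/
noncomputable def freeAlgHom {B : Type*} [Ring B] [Algebra ℚ B] (φ : ∀ p, V p →ₗ[ℚ] B)
    (h : ∀ p q, ∀ v : V p, ∀ w : V q, φ p v * φ q w = (-1 : ℚ) ^ (p * q) • (φ q w * φ p v)) :
    free V →ₐ[ℚ] B := FreeCGA.lift φ h

theorem freeAlgHom_gen {B : Type*} [Ring B] [Algebra ℚ B] (φ : ∀ p, V p →ₗ[ℚ] B)
    (h : ∀ p q, ∀ v : V p, ∀ w : V q, φ p v * φ q w = (-1 : ℚ) ^ (p * q) • (φ q w * φ p v))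
    {p : ℕ} (v : V p) : freeAlgHom φ h (gen V p v) = φ p v := FreeCGA.lift_ι φ h v

theorem free_gr_induction {C : ℕ → free V → Prop} (one : C 0 1)
    (mul : ∀ p k, ∀ v : V p, ∀ w ∈ (free V).gr k, C k w → C (p + k) (gen V p v * w)) (zero : ∀ k, C k 0)
    (add : ∀ k x y, C k x → C k y → C k (x + y)) (smul : ∀ k (c : ℚ) x, C k x → C k (c • x))
    {k : ℕ} {w : free V} (hw : w ∈ (free V).gr k) : C k w := by
  refine Submodule.span_induction (p := fun x _ => C k x) ?_ (zero k)
    (fun x y _ _ => add k x y) (fun c x _ => smul k c x) hw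
  rintro _ ⟨l, rfl, rfl⟩
  clear hw
  induction l with
  | nil => exact one
  | cons g l ih =>
    rw [FreeCGA.mono_cons, FreeCGA.deg_cons]
    exact mul _ _ _ _ (FreeCGA.mono_mem l) ih

end free

/-! ### Upper triangular matrices, used to encode derivations as algebra morphisms. -/

section triangular
variable {B : Type*} [Ring B]

/-- An upper triangular matrix. -/
def tri (a b c : B) : Matrix (Fin 2) (Fin 2) B := !![a, b; 0, c]

theorem tri_mul (a b c a' b' c' : B) :
    tri a b c * tri a' b' c' = tri (a * a') (a * b' + b * c') (c * c') := by
  simp [tri]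

theorem tri_one : tri (1 : B) 0 1 = 1 := Matrix.one_fin_two.symm

theorem tri_zero : tri (0 : B) 0 0 = 0 := (Matrix.eta_fin_two 0).symm

variable [Algebra ℚ B]

theorem tri_smul (r : ℚ) (a b c : B) : r • tri a b c = tri (r • a) (r • b) (r • c) := by
  simp [tri]

/-- The linear map to upper triangular matrices with given entries. -/
def triₗ {M : Type*} [AddCommGroup M] [Module ℚ M] (f g h : M →ₗ[ℚ] B) :
    M →ₗ[ℚ] Matrix (Fin 2) (Fin 2) B where
  toFun x := tri (f x) (g x) (h x)
  map_add' x y := by simp [tri]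
  map_smul' r x := by simp [tri]

theorem triₗ_apply {M : Type*} [AddCommGroup M] [Module ℚ M] (f g h : M →ₗ[ℚ] B) (x : M) :
    triₗ f g h x = tri (f x) (g x) (h x) := rfl

end triangular

/-! ### The algebra `R ⊗ ΛV` and its universal property. -/

section tensorFree
variable (R : CDGA.{u}) (V : ℕ → Type u) [∀ p, AddCommGroup (V p)] [∀ p, Module ℚ (V p)]

/-- The graded algebra `R ⊗ ΛV`, with the differential of `R` extended by zero on `V`. -/
noncomputable abbrev tensorFree : CDGA.{u} := R.tensor (free V)

/-- The inclusion `R → R ⊗ ΛV`. -/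
noncomputable def inBase : R →ₐ[ℚ] tensorFree R V :=
  GradedTensorProduct.includeLeft R.gr (free V).gr

/-- The inclusion `ΛV → R ⊗ ΛV`. -/
noncomputable def inFree : free V →ₐ[ℚ] tensorFree R V :=
  GradedTensorProduct.includeRight R.gr (free V).gr

/-- The inclusion `V → R ⊗ ΛV`. -/
noncomputable def inGen (p : ℕ) : V p →ₗ[ℚ] tensorFree R V :=
  (inFree R V).toLinearMap ∘ₗ gen V p

variable {R V}

theorem inBase_apply (r : R) : inBase R V r = ot r (1 : free V) := rfl

theorem inFree_apply (w : free V) : inFree R V w = ot (1 : R) w := rfl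

theorem inBase_mul_inFree (r : R) (w : free V) :
    inBase R V r * inFree R V w = ot r w := by
  rw [inBase_apply, inFree_apply, ot_mul_ot r (free V).one_mem R.one_mem]
  simp

theorem inBase_mem {k : ℕ} {r : R} (hr : r ∈ R.gr k) : inBase R V r ∈ (tensorFree R V).gr k :=
  ot_mem hr (free V).one_mem rfl

theorem inFree_mem {k : ℕ} {w : free V} (hw : w ∈ (free V).gr k) :
    inFree R V w ∈ (tensorFree R V).gr k :=
  ot_mem (B := free V) R.one_mem hw (zero_add k)

theorem inGen_mem {p : ℕ} (v : V p) : inGen R V p v ∈ (tensorFree R V).gr p :=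
  inFree_mem (gen_mem v)

theorem tensorFree_lin_ext {M : Type*} [AddCommGroup M] [Module ℚ M]
    {f g : tensorFree R V →ₗ[ℚ] M}
    (h : ∀ i j, ∀ r ∈ R.gr i, ∀ w ∈ (free V).gr j,
      f (inBase R V r * inFree R V w) = g (inBase R V r * inFree R V w)) : f = g :=
  ot_lin_ext fun i j r hr w hw => by
    have := h i j r hr w hw
    rwa [inBase_mul_inFree] at this

theorem tensorFree_eq_top (S : Subalgebra ℚ (tensorFree R V)) (hR : ∀ r, inBase R V r ∈ S)
    (hV : ∀ p, ∀ v : V p, inGen R V p v ∈ S) : S = ⊤ := by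
  have hF : ∀ w, inFree R V w ∈ S := by
    intro w
    have : w ∈ S.comap (inFree R V) := by
      rw [free_eq_top (S.comap (inFree R V)) hV]
      trivial
    exact this
  have key : S.toSubmodule.mkQ = 0 := by
    refine tensorFree_lin_ext fun i j r _ w _ => ?_
    simp only [LinearMap.zero_apply, Submodule.mkQ_apply, Submodule.Quotient.mk_eq_zero]
    exact S.mul_mem (hR r) (hF w)
  rw [eq_top_iff]
  rintro x -
  exact (Submodule.Quotient.mk_eq_zero S.toSubmodule).1 (LinearMap.congr_fun key x)

theorem tensorFree_algHom_ext {C : Type*} [Ring C] [Algebra ℚ C]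
    {f g : tensorFree R V →ₐ[ℚ] C} (hR : ∀ r, f (inBase R V r) = g (inBase R V r))
    (hV : ∀ p, ∀ v : V p, f (inGen R V p v) = g (inGen R V p v)) : f = g := by
  have := tensorFree_eq_top (AlgHom.equalizer f g) hR hV
  ext x
  have hx : x ∈ (⊤ : Subalgebra ℚ (tensorFree R V)) := trivial
  rw [← this] at hx
  exact hx

/-- Algebra morphisms out of `R ⊗ ΛV`. -/
noncomputable def tensorFreeLift {C : Type*} [Ring C] [Algebra ℚ C] (f : R →ₐ[ℚ] C)
    (g : free V →ₐ[ℚ] C)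
    (h : ∀ p q, ∀ r ∈ R.gr p, ∀ w ∈ (free V).gr q,
      f r * g w = (-1 : ℚ) ^ (p * q) • (g w * f r)) : tensorFree R V →ₐ[ℚ] C :=
  GradedTensorProduct.lift R.gr (free V).gr f g (by
    intro i j a b
    have := h i j a a.2 b b.2
    rw [mul_comm i j] at this
    refine this.trans ?_
    rcases Nat.even_or_odd (j * i) with h | h
    · rw [h.neg_one_pow]
      erw [h.neg_one_pow]
      simp
    · rw [h.neg_one_pow]
      erw [h.neg_one_pow]
      simp)

theorem tensorFreeLift_apply {C : Type*} [Ring C] [Algebra ℚ C] (f : R →ₐ[ℚ] C)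
    (g : free V →ₐ[ℚ] C)
    (h : ∀ p q, ∀ r ∈ R.gr p, ∀ w ∈ (free V).gr q,
      f r * g w = (-1 : ℚ) ^ (p * q) • (g w * f r)) (r : R) (w : free V) :
    tensorFreeLift f g h (inBase R V r * inFree R V w) = f r * g w := by
  rw [inBase_mul_inFree]
  rfl

theorem tensorFreeLift_inBase {C : Type*} [Ring C] [Algebra ℚ C] (f : R →ₐ[ℚ] C)
    (g : free V →ₐ[ℚ] C)
    (h : ∀ p q, ∀ r ∈ R.gr p, ∀ w ∈ (free V).gr q,
      f r * g w = (-1 : ℚ) ^ (p * q) • (g w * f r)) (r : R) :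
    tensorFreeLift f g h (inBase R V r) = f r := by
  have := tensorFreeLift_apply f g h r 1
  rwa [map_one, map_one, mul_one, mul_one] at this

theorem tensorFreeLift_inFree {C : Type*} [Ring C] [Algebra ℚ C] (f : R →ₐ[ℚ] C)
    (g : free V →ₐ[ℚ] C)
    (h : ∀ p q, ∀ r ∈ R.gr p, ∀ w ∈ (free V).gr q,
      f r * g w = (-1 : ℚ) ^ (p * q) • (g w * f r)) (w : free V) :
    tensorFreeLift f g h (inFree R V w) = g w := by
  have := tensorFreeLift_apply f g h 1 w
  rwa [map_one, map_one, one_mul, one_mul] at this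

section cdgaTarget
variable {E : CDGA.{u}} (f : R →ₐ[ℚ] E) (hf : ∀ k, ∀ r ∈ R.gr k, f r ∈ E.gr k)
  (φ : ∀ p, V p →ₗ[ℚ] E) (hφ : ∀ p, ∀ v : V p, φ p v ∈ E.gr p)

/-- The algebra morphism `ΛV → E` with given values on generators. -/
noncomputable def genLift : free V →ₐ[ℚ] E :=
  freeAlgHom φ fun p q v w => E.graded_comm (hφ p v) (hφ q w)

theorem genLift_mem {k : ℕ} {w : free V} (hw : w ∈ (free V).gr k) :
    genLift φ hφ w ∈ E.gr k := by
  refine free_gr_induction (C := fun k w => genLift φ hφ w ∈ E.gr k) ?_ ?_ ?_ ?_ ?_ hw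
  · rw [map_one]
    exact E.one_mem
  · intro p k v w _ ih
    rw [map_mul]
    refine E.mul_mem ?_ ih rfl
    rw [genLift, freeAlgHom_gen]
    exact hφ p v
  · intro k
    rw [map_zero]
    exact zero_mem _
  · intro k x y hx hy
    rw [map_add]
    exact add_mem hx hy
  · intro k c x hx
    rw [map_smul]
    exact Submodule.smul_mem _ _ hx

/-- The algebra morphism `R ⊗ ΛV → E` with given values on `R` and on generators. -/
noncomputable def extLift : tensorFree R V →ₐ[ℚ] E :=
  tensorFreeLift f (genLift φ hφ) fun p _ r hr _ hw =>
    E.graded_comm (hf p r hr) (genLift_mem φ hφ hw)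

theorem extLift_inBase (r : R) : extLift f hf φ hφ (inBase R V r) = f r :=
  tensorFreeLift_inBase _ _ _ r

theorem extLift_inGen {p : ℕ} (v : V p) : extLift f hf φ hφ (inGen R V p v) = φ p v :=
  (tensorFreeLift_inFree _ _ _ _).trans (freeAlgHom_gen _ _ v)

theorem extLift_mem {k : ℕ} {x : tensorFree R V} (hx : x ∈ (tensorFree R V).gr k) :
    extLift f hf φ hφ x ∈ E.gr k := by
  have : (tensorFree R V).gr k ≤ (E.gr k).comap (extLift f hf φ hφ).toLinearMap := by
    refine ot_gr_le fun i j hij r hr w hw => ?_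
    change extLift f hf φ hφ (ot r w) ∈ E.gr k
    rw [← inBase_mul_inFree (V := V)]
    refine Eq.mpr (congrArg (· ∈ E.gr k) (tensorFreeLift_apply _ _ _ r w)) ?_
    exact E.mul_mem (hf i r hr) (genLift_mem φ hφ hw) hij
  exact this hx

end cdgaTarget

/-! ### Derivations of `R ⊗ ΛV` with prescribed values on generators. -/

section derivation
variable (τ : ∀ p, V p →ₗ[ℚ] tensorFree R V)
  (hτ : ∀ p, ∀ v : V p, τ p v ∈ (tensorFree R V).gr (p + 1))

/-- The algebra morphism encoding the derivation on `R`. -/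
noncomputable def derBase : R →ₐ[ℚ] Matrix (Fin 2) (Fin 2) (tensorFree R V) :=
  AlgHom.ofLinearMap
    (triₗ ((inBase R V).toLinearMap ∘ₗ R.sgn) ((inBase R V).toLinearMap ∘ₗ R.d)
      (inBase R V).toLinearMap)
    (by simp [triₗ_apply, R.sgn_one, R.d_one, tri_one])
    (by
      intro a b
      simp only [triₗ_apply, LinearMap.comp_apply, AlgHom.toLinearMap_apply, tri_mul, sgn_mul,
        map_mul, R.leibniz_sgn, map_add]
      rw [add_comm])

theorem derBase_apply (r : R) : derBase (V := V) r =
    tri (inBase R V (R.sgn r)) (inBase R V (R.d r)) (inBase R V r) := rfl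

-- The off-diagonal entries are `(-1)^p v τ(w) + τ(v) w` and its counterpart with `v`, `w`
-- exchanged. Because `τ` raises degree by one, the extra signs `(-1)^p` and `(-1)^q` are exactly
-- those needed for graded commutation, so the free algebra maps to matrices.
include hτ in
theorem derGen_comm (p q : ℕ) (v : V p) (w : V q) :
    triₗ ((-1 : ℚ) ^ p • inGen R V p) (τ p) (inGen R V p) v *
      triₗ ((-1 : ℚ) ^ q • inGen R V q) (τ q) (inGen R V q) w =
    (-1 : ℚ) ^ (p * q) • (triₗ ((-1 : ℚ) ^ q • inGen R V q) (τ q) (inGen R V q) w *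
      triₗ ((-1 : ℚ) ^ p • inGen R V p) (τ p) (inGen R V p) v) := by
  have h1 := FreeCGA.neg_one_pow_mul_self
  have e0 := (tensorFree R V).graded_comm (inGen_mem v) (inGen_mem w)
  simp only [triₗ_apply, tri_mul, tri_smul, LinearMap.smul_apply]
  congr 1
  · rw [smul_mul_smul_comm, smul_mul_smul_comm, e0, smul_smul, smul_smul]
    congr 1
    ring
  · rw [smul_mul_assoc, smul_mul_assoc, (tensorFree R V).graded_comm (inGen_mem v) (hτ q w),
      (tensorFree R V).graded_comm (hτ p v) (inGen_mem w), smul_add, smul_smul, smul_smul,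
      add_comm]
    congr 2
    · rw [add_mul, one_mul, pow_add]
    · rw [mul_add, mul_one, pow_add]
      linear_combination ((-1 : ℚ) ^ (p * q)) * h1 p

/-- The algebra morphism encoding the derivation on `ΛV`. -/
noncomputable def derFree : free V →ₐ[ℚ] Matrix (Fin 2) (Fin 2) (tensorFree R V) :=
  freeAlgHom
    (fun p => triₗ ((-1 : ℚ) ^ p • inGen R V p) (τ p) (inGen R V p))
    (derGen_comm τ hτ)

theorem derFree_gen {p : ℕ} (v : V p) : derFree τ hτ (gen V p v) =
    tri ((-1 : ℚ) ^ p • inGen R V p v) (τ p v) (inGen R V p v) :=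
  freeAlgHom_gen _ _ v

/-- The degree of the off-diagonal entry fixes the sign with which it commutes past `R`; this is
what allows the morphisms on `R` and on `ΛV` to be combined. -/
theorem derFree_mem {k : ℕ} {w : free V} (hw : w ∈ (free V).gr k) :
    ∃ t ∈ (tensorFree R V).gr (k + 1), derFree τ hτ w =
      tri ((-1 : ℚ) ^ k • inFree R V w) t (inFree R V w) := by
  refine free_gr_induction (C := fun k w => ∃ t ∈ (tensorFree R V).gr (k + 1),
    derFree τ hτ w = tri ((-1 : ℚ) ^ k • inFree R V w) t (inFree R V w)) ?_ ?_ ?_ ?_ ?_ hw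
  · refine ⟨0, zero_mem _, ?_⟩
    rw [map_one, map_one, pow_zero, one_smul, tri_one]
  · rintro p k v w hw ⟨t, ht, e⟩
    refine ⟨((-1 : ℚ) ^ p • inGen R V p v) * t + τ p v * inFree R V w, add_mem ?_ ?_, ?_⟩
    · exact (tensorFree R V).mul_mem (Submodule.smul_mem _ _ (inGen_mem v)) ht (by omega)
    · have := inFree_mem (R := R) hw
      exact (tensorFree R V).mul_mem (hτ p v) this (by omega)
    · rw [map_mul, e, derFree_gen, tri_mul, map_mul, smul_mul_smul_comm, pow_add]
      rfl
  · intro k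
    refine ⟨0, zero_mem _, ?_⟩
    rw [map_zero, map_zero, smul_zero, tri_zero]
  · rintro k x y ⟨t, ht, e⟩ ⟨t', ht', e'⟩
    refine ⟨t + t', add_mem ht ht', ?_⟩
    rw [map_add, e, e', map_add]
    simp [tri]
  · rintro k c x ⟨t, ht, e⟩
    refine ⟨c • t, Submodule.smul_mem _ _ ht, ?_⟩
    rw [map_smul, e, map_smul, tri_smul, smul_comm]

/-- The algebra morphism `x ↦ [[(-1)^|x| x, Dx], [0, x]]` encoding the derivation `D`. -/
noncomputable def derHom : tensorFree R V →ₐ[ℚ] Matrix (Fin 2) (Fin 2) (tensorFree R V) :=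
  tensorFreeLift derBase (derFree τ hτ) (by
    intro p q r hr w hw
    obtain ⟨t, ht, e⟩ := derFree_mem τ hτ hw
    have h1 := FreeCGA.neg_one_pow_mul_self
    rw [e, derBase_apply, R.sgn_of_mem hr, map_smul, tri_mul, tri_mul, tri_smul]
    congr 1
    · rw [smul_mul_smul_comm, smul_mul_smul_comm,
        (tensorFree R V).graded_comm (inBase_mem hr) (inFree_mem hw), smul_smul, smul_smul]
      congr 1
      ring
    · rw [smul_mul_assoc, smul_mul_assoc, (tensorFree R V).graded_comm (inBase_mem hr) ht,
        (tensorFree R V).graded_comm (inBase_mem (R.d_mem hr)) (inFree_mem hw), smul_add,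
        smul_smul, smul_smul, add_comm]
      congr 2
      · rw [add_mul, one_mul, pow_add]
      · rw [mul_add, mul_one, pow_add]
        linear_combination ((-1 : ℚ) ^ (p * q)) * h1 p
    · exact (tensorFree R V).graded_comm (inBase_mem hr) (inFree_mem hw))

/-- The derivation of `R ⊗ ΛV` which extends the differential of `R` and has the given values on
generators. -/
noncomputable def der : tensorFree R V →ₗ[ℚ] tensorFree R V :=
  Matrix.entryLinearMap ℚ (tensorFree R V) (0 : Fin 2) (1 : Fin 2) ∘ₗ (derHom τ hτ).toLinearMap

/-- Once all entries are known, multiplicativity of `derHom` becomes the Leibniz rule for its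
off-diagonal entry. -/
theorem derHom_apply (x : tensorFree R V) :
    derHom τ hτ x = tri ((tensorFree R V).sgn x) (der τ hτ x) x := by
  have : (derHom τ hτ).toLinearMap = triₗ (tensorFree R V).sgn (der τ hτ) LinearMap.id := by
    refine tensorFree_lin_ext fun i j r hr w hw => ?_
    obtain ⟨t, ht, e⟩ := derFree_mem τ hτ hw
    have e1 : derHom τ hτ (inBase R V r * inFree R V w) =
        tri ((-1 : ℚ) ^ (i + j) • (inBase R V r * inFree R V w))
          (inBase R V (R.sgn r) * t + inBase R V (R.d r) * inFree R V w)
          (inBase R V r * inFree R V w) := by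
      rw [derHom, tensorFreeLift_apply, e, derBase_apply, tri_mul, R.sgn_of_mem hr, map_smul,
        smul_mul_smul_comm, pow_add]
    have e2 : der τ hτ (inBase R V r * inFree R V w) =
        inBase R V (R.sgn r) * t + inBase R V (R.d r) * inFree R V w := by
      change derHom τ hτ (inBase R V r * inFree R V w) 0 1 = _
      rw [e1]
      rfl
    rw [triₗ_apply, e2, (tensorFree R V).sgn_of_mem
      ((tensorFree R V).mul_mem (inBase_mem hr) (inFree_mem hw) rfl)]
    exact e1
  exact LinearMap.congr_fun this x

theorem der_mul (x y : tensorFree R V) :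
    der τ hτ (x * y) = der τ hτ x * y + (tensorFree R V).sgn x * der τ hτ y := by
  have h := map_mul (derHom τ hτ) x y
  rw [derHom_apply, derHom_apply, derHom_apply, tri_mul] at h
  have := congrFun (congrFun h 0) 1
  rw [add_comm]
  exact this

theorem der_inBase (r : R) : der τ hτ (inBase R V r) = inBase R V (R.d r) := by
  have h : derHom τ hτ (inBase R V r) = derBase r := tensorFreeLift_inBase _ _ _ r
  exact congrFun (congrFun h 0) 1

theorem der_inGen {p : ℕ} (v : V p) : der τ hτ (inGen R V p v) = τ p v := by
  have h : derHom τ hτ (inGen R V p v) = derFree τ hτ (gen V p v) :=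
    tensorFreeLift_inFree _ _ _ _
  rw [derFree_gen] at h
  exact congrFun (congrFun h 0) 1

theorem der_mem {k : ℕ} {x : tensorFree R V} (hx : x ∈ (tensorFree R V).gr k) :
    der τ hτ x ∈ (tensorFree R V).gr (k + 1) := by
  have : (tensorFree R V).gr k ≤ ((tensorFree R V).gr (k + 1)).comap (der τ hτ) := by
    refine ot_gr_le fun i j hij r hr w hw => ?_
    change der τ hτ (ot r w) ∈ (tensorFree R V).gr (k + 1)
    rw [← inBase_mul_inFree (V := V), der_mul, der_inBase]
    obtain ⟨t, ht, e⟩ := derFree_mem τ hτ hw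
    have e1 : der τ hτ (inFree R V w) = t := by
      have h : derHom τ hτ (inFree R V w) = derFree τ hτ w := tensorFreeLift_inFree _ _ _ _
      rw [e] at h
      exact congrFun (congrFun h 0) 1
    rw [e1]
    exact add_mem ((tensorFree R V).mul_mem (inBase_mem (R.d_mem hr)) (inFree_mem hw) (by omega))
      ((tensorFree R V).mul_mem (sgn_mem (inBase_mem hr)) ht (by omega))
  exact this hx

theorem der_sgn (x : tensorFree R V) :
    der τ hτ ((tensorFree R V).sgn x) = -(tensorFree R V).sgn (der τ hτ x) := by
  have : der τ hτ ∘ₗ (tensorFree R V).sgn = -((tensorFree R V).sgn ∘ₗ der τ hτ) := by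
    refine (tensorFree R V).lin_ext fun k a ha => ?_
    simp [(tensorFree R V).sgn_of_mem ha, (tensorFree R V).sgn_of_mem (der_mem τ hτ ha), pow_succ]
  exact LinearMap.congr_fun this x

/-- A morphism that commutes with the differentials on `R` and on generators commutes with the
differentials. -/
theorem map_der {E : CDGA.{u}} (L : tensorFree R V →ₐ[ℚ] E)
    (hL : ∀ k, ∀ x ∈ (tensorFree R V).gr k, L x ∈ E.gr k) (D : E →ₗ[ℚ] E)
    (hD : ∀ x y, D (x * y) = D x * y + E.sgn x * D y)
    (hR : ∀ r, L (inBase R V (R.d r)) = D (L (inBase R V r)))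
    (hV : ∀ p, ∀ v : V p, L (τ p v) = D (L (inGen R V p v))) (x : tensorFree R V) :
    L (der τ hτ x) = D (L x) := by
  have hs : ∀ x, L ((tensorFree R V).sgn x) = E.sgn (L x) :=
    map_sgn (f := L.toLinearMap) hL
  have hbase : ∀ r, L (der τ hτ (inBase R V r)) = D (L (inBase R V r)) := fun r => by
    rw [der_inBase, hR]
  let S : Subalgebra ℚ (tensorFree R V) :=
    { carrier := {x | L (der τ hτ x) = D (L x)}
      mul_mem' := by
        intro x y hx hy
        change L (der τ hτ (x * y)) = D (L (x * y))
        rw [der_mul, map_add, map_mul, map_mul, map_mul, hD, hs]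
        exact congrArg₂ _ (congrArg (· * _) hx) (congrArg (_ * ·) hy)
      add_mem' := by
        intro x y hx hy
        change L (der τ hτ (x + y)) = D (L (x + y))
        rw [map_add, map_add, map_add, map_add]
        exact congrArg₂ _ hx hy
      algebraMap_mem' := by
        intro c
        have := hbase (algebraMap ℚ R c)
        rwa [AlgHom.commutes] at this }
  have : x ∈ S := by
    rw [tensorFree_eq_top S hbase fun p v => ?_]
    · trivial
    · change L (der τ hτ (inGen R V p v)) = D (L (inGen R V p v))
      rw [der_inGen, hV]
  exact this

/-- The cross terms of `D²(xy)` cancel because `D` anticommutes with the degree involution. Elements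
killed by `D²` thus form a subalgebra, and only generators need checking. -/
theorem der_der (hD : ∀ p, ∀ v : V p, der τ hτ (τ p v) = 0) (x : tensorFree R V) :
    der τ hτ (der τ hτ x) = 0 := by
  have hbase : ∀ r, der τ hτ (der τ hτ (inBase R V r)) = 0 := fun r => by
    rw [der_inBase, der_inBase, R.d_d, map_zero]
  let S : Subalgebra ℚ (tensorFree R V) :=
    { carrier := {x | der τ hτ (der τ hτ x) = 0}
      mul_mem' := by
        intro x y hx hy
        change der τ hτ (der τ hτ (x * y)) = 0
        rw [der_mul, map_add, der_mul, der_mul, der_sgn, sgn_sgn,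
          show der τ hτ (der τ hτ x) = 0 from hx, show der τ hτ (der τ hτ y) = 0 from hy]
        simp
      add_mem' := by
        intro x y hx hy
        change der τ hτ (der τ hτ (x + y)) = 0
        rw [map_add, map_add, show der τ hτ (der τ hτ x) = 0 from hx,
          show der τ hτ (der τ hτ y) = 0 from hy, add_zero]
      algebraMap_mem' := by
        intro c
        have := hbase (algebraMap ℚ R c)
        rwa [AlgHom.commutes] at this }
  have : x ∈ S := by
    rw [tensorFree_eq_top S hbase fun p v => ?_]
    · trivial
    · change der τ hτ (der τ hτ (inGen R V p v)) = 0
      rw [der_inGen, hD]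
  exact this

variable (hD : ∀ p, ∀ v : V p, der τ hτ (τ p v) = 0)

/-- The CDGA `(R ⊗ ΛV, D)`, where `D` extends the differential of `R` and is given by `τ` on
generators. -/
noncomputable def semifree : CDGA.{u} where
  carrier := tensorFree R V
  gr := (tensorFree R V).gr
  isInternal := (tensorFree R V).isInternal
  d := der τ hτ
  d_mem := der_mem τ hτ
  d_d := der_der τ hτ hD
  graded_comm := (tensorFree R V).graded_comm
  leibniz ha b := by
    rw [der_mul, (tensorFree R V).sgn_of_mem ha, smul_mul_assoc]

/-- The inclusion `R → (R ⊗ ΛV, D)`. -/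
noncomputable def semifreeIncl : Hom R (semifree τ hτ hD) where
  toAlgHom := inBase R V
  map_mem := inBase_mem
  map_d r := (der_inBase τ hτ r).symm

/-- Morphisms out of `(R ⊗ ΛV, D)`. -/
noncomputable def semifreeLift {E : CDGA.{u}} (f : Hom R E) (φ : ∀ p, V p →ₗ[ℚ] E)
    (hφ : ∀ p, ∀ v : V p, φ p v ∈ E.gr p)
    (h : ∀ p, ∀ v : V p,
      extLift f.toAlgHom (fun _ _ => f.map_mem) φ hφ (τ p v) = E.d (φ p v)) :
    Hom (semifree τ hτ hD) E where
  toAlgHom := extLift f.toAlgHom (fun _ _ => f.map_mem) φ hφ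
  map_mem := extLift_mem _ _ _ _
  map_d := map_der τ hτ _ (fun _ _ => extLift_mem _ _ _ _) E.d E.leibniz_sgn
    (fun r => by rw [extLift_inBase, extLift_inBase, f.map_d])
    (fun p v => by rw [h, extLift_inGen])

theorem semifreeLift_inBase {E : CDGA.{u}} (f : Hom R E) (φ : ∀ p, V p →ₗ[ℚ] E)
    (hφ : ∀ p, ∀ v : V p, φ p v ∈ E.gr p)
    (h : ∀ p, ∀ v : V p,
      extLift f.toAlgHom (fun _ _ => f.map_mem) φ hφ (τ p v) = E.d (φ p v)) (r : R) :
    (semifreeLift τ hτ hD f φ hφ h).toAlgHom (inBase R V r) = f.toAlgHom r :=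
  extLift_inBase f.toAlgHom (fun _ _ => f.map_mem) φ hφ r

theorem semifreeLift_inGen {E : CDGA.{u}} (f : Hom R E) (φ : ∀ p, V p →ₗ[ℚ] E)
    (hφ : ∀ p, ∀ v : V p, φ p v ∈ E.gr p)
    (h : ∀ p, ∀ v : V p,
      extLift f.toAlgHom (fun _ _ => f.map_mem) φ hφ (τ p v) = E.d (φ p v)) {p : ℕ} (v : V p) :
    (semifreeLift τ hτ hD f φ hφ h).toAlgHom (inGen R V p v) = φ p v :=
  extLift_inGen f.toAlgHom (fun _ _ => f.map_mem) φ hφ v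

end derivation

end tensorFree

/-! ### Injectivity of the inclusions into `R ⊗ ΛV`, and its degrees 0 and 1. -/

section injectivity
variable {R : CDGA.{u}} {V : ℕ → Type u} [∀ p, AddCommGroup (V p)] [∀ p, Module ℚ (V p)]

/-- Sending all generators to zero gives a retraction. -/
theorem inBase_injective : Function.Injective (inBase R V) := by
  let r := extLift (V := V) (AlgHom.id ℚ R) (fun _ _ h => h) (fun _ => (0 : V _ →ₗ[ℚ] R))
    (fun _ _ => zero_mem _)
  exact Function.LeftInverse.injective (g := r) fun x => extLift_inBase _ _ _ _ x

theorem inFree_injective [Nontrivial R] : Function.Injective (inFree R V) :=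
  Algebra.TensorProduct.includeRight_injective (R := ℚ) (A := R) (B := free V)
    (algebraMap ℚ R).injective

theorem inGen_injective [Nontrivial R] (p : ℕ) : Function.Injective (inGen R V p) :=
  inFree_injective.comp (gen_injective p)

theorem tensorFree_gr_zero [Subsingleton (V 0)]
    (hR : ∀ x ∈ R.gr 0, ∃ c : ℚ, x = algebraMap ℚ R c) :
    ∀ x ∈ (tensorFree R V).gr 0, ∃ c : ℚ, x = algebraMap ℚ (tensorFree R V) c := by
  intro x hx
  have : (tensorFree R V).gr 0 ≤ LinearMap.range (Algebra.linearMap ℚ (tensorFree R V)) := by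
    refine ot_gr_le fun i j hij a ha w hw => ?_
    obtain ⟨rfl, rfl⟩ : i = 0 ∧ j = 0 := by omega
    obtain ⟨c, rfl⟩ := hR a ha
    obtain ⟨c', hc'⟩ : ∃ c : ℚ, w = algebraMap ℚ (free V) c := FreeCGA.gr_zero_le hw
    refine ⟨c * c', ?_⟩
    rw [hc', ← inBase_mul_inFree, AlgHom.commutes, AlgHom.commutes, ← map_mul]
    rfl
  obtain ⟨c, hc⟩ := this hx
  exact ⟨c, hc.symm⟩

theorem tensorFree_gr_one [Subsingleton (V 0)]
    (hR : ∀ x ∈ R.gr 0, ∃ c : ℚ, x = algebraMap ℚ R c) :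
    ∀ x ∈ (tensorFree R V).gr 1, ∃ a ∈ R.gr 1, ∃ v : V 1,
      x = inBase R V a + inGen R V 1 v := by
  intro x hx
  have : (tensorFree R V).gr 1 ≤
      (R.gr 1).map (inBase R V).toLinearMap ⊔ LinearMap.range (inGen R V 1) := by
    refine ot_gr_le fun i j hij a ha w hw => ?_
    rw [← inBase_mul_inFree]
    rcases Nat.eq_zero_or_pos i with rfl | hi
    · obtain rfl : j = 1 := by omega
      obtain ⟨c, rfl⟩ := hR a ha
      obtain ⟨v, hv⟩ : ∃ v : V 1, w = gen V 1 v := FreeCGA.gr_one_le hw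
      refine Submodule.mem_sup_right ⟨c • v, ?_⟩
      rw [hv, AlgHom.commutes, ← Algebra.smul_def, map_smul]
      rfl
    · obtain ⟨rfl, rfl⟩ : i = 1 ∧ j = 0 := by omega
      obtain ⟨c, hc⟩ : ∃ c : ℚ, w = algebraMap ℚ (free V) c := FreeCGA.gr_zero_le hw
      refine Submodule.mem_sup_left ⟨c • a, Submodule.smul_mem _ _ ha, ?_⟩
      rw [hc, AlgHom.commutes, ← Algebra.commutes, ← Algebra.smul_def]
      exact map_smul (inBase R V) c a
  obtain ⟨y, ⟨a, ha, rfl⟩, z, ⟨v, rfl⟩, h⟩ := Submodule.mem_sup.1 (this hx)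
  exact ⟨a, ha, v, h.symm⟩

end injectivity

/-! ### One stage of the relative Sullivan construction. -/

/-- A stage of the construction of a relative Sullivan model of `f : R → E`: a factorisation of
`f` through a connected CDGA `M` such that `H^1(M) → H^1(E)` is injective. -/
structure Stage {R E : CDGA.{u}} (f : Hom R E) where
  M : CDGA.{u}
  i : Hom R M
  φ : Hom M E
  comm : ∀ r, φ.toAlgHom (i.toAlgHom r) = f.toAlgHom r
  zero : ∀ x ∈ M.gr 0, ∃ c : ℚ, x = algebraMap ℚ M c
  one : ∀ x ∈ M.gr 1, M.d x = 0 → ∀ e, φ.toAlgHom x = E.d e → x = 0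

namespace Stage
variable {R E : CDGA.{u}} {f : Hom R E} (s : Stage f)

/-- The relative cocycles of degree `p`: pairs `(z, e)` with `dz = 0` and `φ z = de`. -/
noncomputable def cocyc (p : ℕ) : Submodule ℚ (s.M × E) :=
  (s.M.gr (p + 1)).prod (E.gr p) ⊓ LinearMap.ker (s.M.d ∘ₗ LinearMap.fst ℚ s.M E) ⊓
    LinearMap.ker (s.φ.toAlgHom.toLinearMap ∘ₗ LinearMap.fst ℚ s.M E -
      E.d ∘ₗ LinearMap.snd ℚ s.M E)

theorem mem_cocyc {p : ℕ} {z : s.M × E} : z ∈ s.cocyc p ↔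
    (z.1 ∈ s.M.gr (p + 1) ∧ z.2 ∈ E.gr p) ∧ s.M.d z.1 = 0 ∧ s.φ.toAlgHom z.1 = E.d z.2 := by
  simp only [cocyc, Submodule.mem_inf, Submodule.mem_prod, LinearMap.mem_ker,
    LinearMap.comp_apply, LinearMap.sub_apply, LinearMap.fst_apply, LinearMap.snd_apply,
    AlgHom.toLinearMap_apply, sub_eq_zero, and_assoc]

/-- The relative coboundaries `(dx, φ x + de)` of degree `p`. -/
noncomputable def cobound (p : ℕ) : Submodule ℚ (s.M × E) :=
  ((s.M.gr p).prod ((E.gr p).comap E.d)).map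
    ((s.M.d ∘ₗ LinearMap.fst ℚ s.M E).prod
      (s.φ.toAlgHom.toLinearMap ∘ₗ LinearMap.fst ℚ s.M E + E.d ∘ₗ LinearMap.snd ℚ s.M E))

/-- The degree condition is put on `E.d e` and not on `e`, which avoids speaking of degree `p - 1`
when `p = 0`. -/
theorem mem_cobound {p : ℕ} {z : s.M × E} : z ∈ s.cobound p ↔
    ∃ x ∈ s.M.gr p, ∃ e, E.d e ∈ E.gr p ∧ z = (s.M.d x, s.φ.toAlgHom x + E.d e) := by
  constructor
  · rintro ⟨⟨x, e⟩, ⟨hx, he⟩, rfl⟩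
    exact ⟨x, hx, e, he, rfl⟩
  · rintro ⟨x, hx, e, he, rfl⟩
    exact ⟨(x, e), ⟨hx, he⟩, rfl⟩

theorem cobound_le (p : ℕ) : s.cobound p ≤ s.cocyc p := by
  intro z hz
  obtain ⟨x, hx, e, he, rfl⟩ := s.mem_cobound.1 hz
  rw [mem_cocyc]
  refine ⟨⟨s.M.d_mem hx, add_mem (s.φ.map_mem hx) he⟩, s.M.d_d x, ?_⟩
  rw [map_add, E.d_d, add_zero, s.φ.map_d]

/-- A complement of the relative coboundaries in the relative cocycles, in positive degrees. -/
noncomputable def W : ℕ → Submodule ℚ (s.M × E)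
  | 0 => ⊥
  | p + 1 => s.cocyc (p + 1) ⊓ (Submodule.exists_isCompl (s.cobound (p + 1))).choose

theorem mem_cocyc_of_mem_W {p : ℕ} {z : s.M × E} (hz : z ∈ s.W p) : z ∈ s.cocyc p := by
  cases p with
  | zero =>
    rw [(Submodule.mem_bot ℚ).1 hz]
    exact zero_mem _
  | succ p => exact hz.1

/-- The spanning half of the choice of complement: every relative class of positive degree is
represented by a new generator. This makes the limit a quasi-isomorphism. -/
theorem exists_W {p : ℕ} {z : s.M × E} (hz : z ∈ s.cocyc (p + 1)) :
    ∃ w ∈ s.W (p + 1), ∃ x ∈ s.M.gr (p + 1), ∃ e,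
      z.1 = w.1 + s.M.d x ∧ z.2 = w.2 + (s.φ.toAlgHom x + E.d e) := by
  have hc := (Submodule.exists_isCompl (s.cobound (p + 1))).choose_spec
  obtain ⟨b, hb, c, hcc, h⟩ := Submodule.mem_sup.1 (hc.sup_eq_top ▸ Submodule.mem_top (x := z))
  obtain ⟨x, hx, e, he, rfl⟩ := s.mem_cobound.1 hb
  have e1 : c = z - (s.M.d x, s.φ.toAlgHom x + E.d e) := by rw [← h]; abel
  refine ⟨c, ⟨?_, hcc⟩, x, hx, e, ?_, ?_⟩
  · change c ∈ s.cocyc (p + 1)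
    rw [e1]
    exact sub_mem hz (s.cobound_le _ hb)
  · rw [e1, Prod.fst_sub, sub_add_cancel]
  · rw [e1, Prod.snd_sub, sub_add_cancel]

/-- The independence half of the choice of complement. It ensures that new generators create no new
kernel in degree 1. -/
theorem W_eq_zero {p : ℕ} {w : s.M × E} (hw : w ∈ s.W p) {x : s.M} (hx : x ∈ s.M.gr p) {e : E}
    (h1 : w.1 = s.M.d x) (h2 : w.2 = s.φ.toAlgHom x + E.d e) : w = 0 := by
  cases p with
  | zero => exact (Submodule.mem_bot ℚ).1 hw
  | succ p =>
    have hc := (Submodule.exists_isCompl (s.cobound (p + 1))).choose_spec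
    refine (Submodule.disjoint_def.1 hc.disjoint) w (s.mem_cobound.2 ⟨x, hx, e, ?_, ?_⟩) hw.2
    · have h3 := (s.mem_cocyc.1 hw.1).1.2
      rw [h2] at h3
      have := sub_mem h3 (s.φ.map_mem hx)
      rwa [add_sub_cancel_left] at this
    · exact Prod.ext h1 h2

instance : Subsingleton (s.W 0) := by
  change Subsingleton (⊥ : Submodule ℚ (s.M × E))
  infer_instance

/-- The differential on the new generators. -/
noncomputable def τ (p : ℕ) : s.W p →ₗ[ℚ] tensorFree s.M (fun p => s.W p) :=
  (inBase s.M (fun p => s.W p)).toLinearMap ∘ₗ LinearMap.fst ℚ s.M E ∘ₗ (s.W p).subtype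

theorem τ_apply {p : ℕ} (w : s.W p) : s.τ p w = inBase s.M (fun p => s.W p) w.1.1 := rfl

theorem τ_mem (p : ℕ) (w : s.W p) :
    s.τ p w ∈ (tensorFree s.M (fun p => s.W p)).gr (p + 1) :=
  inBase_mem (s.mem_cocyc.1 (s.mem_cocyc_of_mem_W w.2)).1.1

theorem der_τ (p : ℕ) (w : s.W p) : der s.τ s.τ_mem (s.τ p w) = 0 := by
  rw [τ_apply, der_inBase, (s.mem_cocyc.1 (s.mem_cocyc_of_mem_W w.2)).2.1, map_zero]

/-- The value of the next morphism to `E` on the new generators. -/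
noncomputable def val (p : ℕ) : s.W p →ₗ[ℚ] E := LinearMap.snd ℚ s.M E ∘ₗ (s.W p).subtype

theorem val_mem (p : ℕ) (w : s.W p) : s.val p w ∈ E.gr p :=
  (s.mem_cocyc.1 (s.mem_cocyc_of_mem_W w.2)).1.2

theorem φ_eq_d_val (p : ℕ) (w : s.W p) : s.φ.toAlgHom w.1.1 = E.d (s.val p w) :=
  (s.mem_cocyc.1 (s.mem_cocyc_of_mem_W w.2)).2.2

/-- The morphism to `E` of the next stage. -/
noncomputable def nextHom : Hom (semifree s.τ s.τ_mem s.der_τ) E :=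
  semifreeLift s.τ s.τ_mem s.der_τ s.φ s.val s.val_mem fun p w => by
    rw [τ_apply, extLift_inBase, φ_eq_d_val]

theorem nextHom_inBase (x : s.M) :
    s.nextHom.toAlgHom (inBase s.M (fun p => s.W p) x) = s.φ.toAlgHom x :=
  semifreeLift_inBase _ _ _ _ _ _ _ x

theorem nextHom_inGen {p : ℕ} (w : s.W p) :
    s.nextHom.toAlgHom (inGen s.M (fun p => s.W p) p w) = s.val p w := by
  rw [nextHom]
  exact semifreeLift_inGen s.τ s.τ_mem s.der_τ s.φ s.val s.val_mem _ w

/-- The next stage, obtained by adding a generator for each relative cohomology class. -/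
noncomputable def next : Stage f where
  M := semifree s.τ s.τ_mem s.der_τ
  i := (semifreeIncl s.τ s.τ_mem s.der_τ).comp s.i
  φ := s.nextHom
  comm r := (s.nextHom_inBase _).trans (s.comm r)
  zero := tensorFree_gr_zero s.zero
  -- A degree 1 element is `a + w` with `w` a new generator. If it is a cocycle with exact image,
  -- the pair `w` is the relative coboundary of `-a` and `e`, so `w = 0` by the choice of
  -- complement, and then `a = 0` by the previous stage.
  one := by
    intro x hx hd e he
    obtain ⟨a, ha, w, rfl⟩ := tensorFree_gr_one s.zero x hx
    have hd' : inBase s.M (fun p => s.W p) (s.M.d a) +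
        inBase s.M (fun p => s.W p) w.1.1 = 0 := by
      have h : der s.τ s.τ_mem (inBase s.M (fun p => s.W p) a +
        inGen s.M (fun p => s.W p) 1 w) = 0 := hd
      rwa [map_add, der_inBase, der_inGen, τ_apply] at h
    rw [← map_add] at hd'
    have h1 := inBase_injective (hd'.trans (map_zero (inBase s.M (fun p => s.W p))).symm)
    have h2 : s.φ.toAlgHom a + w.1.2 = E.d e := by
      rw [← he, ← nextHom_inBase]
      refine Eq.trans ?_ (map_add s.nextHom.toAlgHom _ _).symm
      rw [nextHom_inGen]
      rfl
    have hw : w.1 = 0 := by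
      refine s.W_eq_zero w.2 (neg_mem ha) (e := e) ?_ ?_
      · rw [map_neg]
        exact eq_neg_of_add_eq_zero_right h1
      · rw [map_neg, ← h2]
        abel
    have hw' : w = 0 := Subtype.ext hw
    have ha0 : a = 0 := by
      refine s.one a ha ?_ e ?_
      · rwa [hw, Prod.fst_zero, add_zero] at h1
      · rwa [hw, Prod.snd_zero, add_zero] at h2
    rw [hw', ha0, map_zero, map_zero, add_zero]
    rfl

/-! ### The tower of stages. -/

/-- The `k`-th stage of the construction starting with `s`. -/
noncomputable def iter : ℕ → Stage f
  | 0 => s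
  | k + 1 => (iter k).next

/-- The inclusion of a stage in the next one. -/
noncomputable def stepIncl (k : ℕ) : (s.iter k).M →ₐ[ℚ] (s.iter (k + 1)).M :=
  inBase (s.iter k).M fun p => (s.iter k).W p

/-- The inclusion of the new generators in the next stage. -/
noncomputable def stepGen (k p : ℕ) : (s.iter k).W p →ₗ[ℚ] (s.iter (k + 1)).M :=
  inGen (s.iter k).M (fun p => (s.iter k).W p) p

theorem stepIncl_mem (k : ℕ) {j : ℕ} {x : (s.iter k).M} (hx : x ∈ (s.iter k).M.gr j) :
    s.stepIncl k x ∈ (s.iter (k + 1)).M.gr j := inBase_mem hx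

theorem stepGen_mem (k : ℕ) {p : ℕ} (w : (s.iter k).W p) :
    s.stepGen k p w ∈ (s.iter (k + 1)).M.gr p :=
  inGen_mem (R := (s.iter k).M) (V := fun p => (s.iter k).W p) w

theorem step_algHom_ext {k : ℕ} {C : Type*} [Ring C] [Algebra ℚ C]
    {g g' : (s.iter (k + 1)).M →ₐ[ℚ] C} (h : ∀ x, g (s.stepIncl k x) = g' (s.stepIncl k x))
    (h' : ∀ p, ∀ w : (s.iter k).W p, g (s.stepGen k p w) = g' (s.stepGen k p w)) : g = g' :=
  tensorFree_algHom_ext (R := (s.iter k).M) (V := fun p => (s.iter k).W p) h h'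

theorem step_eq_top {k : ℕ} (S : Subalgebra ℚ (s.iter (k + 1)).M)
    (h : ∀ x, s.stepIncl k x ∈ S) (h' : ∀ p, ∀ w : (s.iter k).W p, s.stepGen k p w ∈ S) :
    S = ⊤ :=
  tensorFree_eq_top (R := (s.iter k).M) (V := fun p => (s.iter k).W p) S h h'

theorem step_map_d {k : ℕ} {B : CDGA.{u}} (L : (s.iter (k + 1)).M →ₐ[ℚ] B)
    (hL : ∀ j, ∀ x ∈ (s.iter (k + 1)).M.gr j, L x ∈ B.gr j) (D : B →ₗ[ℚ] B)
    (hD : ∀ x y, D (x * y) = D x * y + B.sgn x * D y)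
    (h : ∀ x, L (s.stepIncl k ((s.iter k).M.d x)) = D (L (s.stepIncl k x)))
    (h' : ∀ p, ∀ w : (s.iter k).W p, L (s.stepIncl k w.1.1) = D (L (s.stepGen k p w)))
    (x : (s.iter (k + 1)).M) : L ((s.iter (k + 1)).M.d x) = D (L x) :=
  map_der (s.iter k).τ (s.iter k).τ_mem L hL D hD h h' x

theorem φ_stepIncl (k : ℕ) (x : (s.iter k).M) :
    (s.iter (k + 1)).φ.toAlgHom (s.stepIncl k x) = (s.iter k).φ.toAlgHom x :=
  (s.iter k).nextHom_inBase x

theorem φ_stepGen (k p : ℕ) (w : (s.iter k).W p) :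
    (s.iter (k + 1)).φ.toAlgHom (s.stepGen k p w) = (s.iter k).val p w :=
  (s.iter k).nextHom_inGen w

section stepLift
variable {k : ℕ} {B : CDGA.{u}} (g : (s.iter k).M →ₐ[ℚ] B)
  (hg : ∀ j, ∀ x ∈ (s.iter k).M.gr j, g x ∈ B.gr j) (ψ : ∀ p, (s.iter k).W p →ₗ[ℚ] B)
  (hψ : ∀ p, ∀ w : (s.iter k).W p, ψ p w ∈ B.gr p)

/-- Algebra morphisms out of the next stage. -/
noncomputable def stepLift : (s.iter (k + 1)).M →ₐ[ℚ] B := extLift g hg ψ hψ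

theorem stepLift_stepIncl (x : (s.iter k).M) :
    s.stepLift g hg ψ hψ (s.stepIncl k x) = g x := extLift_inBase g hg ψ hψ x

theorem stepLift_stepGen {p : ℕ} (w : (s.iter k).W p) :
    s.stepLift g hg ψ hψ (s.stepGen k p w) = ψ p w := extLift_inGen g hg ψ hψ w

theorem stepLift_mem (j : ℕ) (x : (s.iter (k + 1)).M) (hx : x ∈ (s.iter (k + 1)).M.gr j) :
    s.stepLift g hg ψ hψ x ∈ B.gr j := extLift_mem g hg ψ hψ hx

end stepLift

/-! ### The limit, built directly on the sum of all generators rather than as a colimit. -/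

/-- All generators of degree `p` added in the construction. -/
abbrev Gen (p : ℕ) : Type u := ⨁ k, (s.iter k).W p

theorem gen_induction {p : ℕ} {C : s.Gen p → Prop} (zero : C 0)
    (lof : ∀ k, ∀ w : (s.iter k).W p, C (DirectSum.lof ℚ ℕ (fun k => (s.iter k).W p) k w))
    (add : ∀ v w, C v → C w → C (v + w)) (v : s.Gen p) : C v :=
  DirectSum.induction_on v zero lof add

instance : Subsingleton (s.Gen 0) := by
  refine ⟨fun v w => ?_⟩
  refine DFinsupp.ext fun k => ?_
  exact Subsingleton.elim (α := (s.iter k).W 0) _ _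

/-- The algebra underlying the limit of the construction. -/
noncomputable abbrev limAlg : CDGA.{u} := tensorFree s.M s.Gen

/-- The inclusion of the generators added at stage `k`. -/
noncomputable def inLim (k p : ℕ) : (s.iter k).W p →ₗ[ℚ] s.limAlg :=
  inGen s.M s.Gen p ∘ₗ DirectSum.lof ℚ ℕ (fun k => (s.iter k).W p) k

theorem inLim_mem (k p : ℕ) (w : (s.iter k).W p) : s.inLim k p w ∈ s.limAlg.gr p := inGen_mem _

/-- The map from the `k`-th stage to the limit. -/
noncomputable def toLim : ∀ k : ℕ, {g : (s.iter k).M →ₐ[ℚ] s.limAlg //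
    ∀ j, ∀ x ∈ (s.iter k).M.gr j, g x ∈ s.limAlg.gr j}
  | 0 => ⟨inBase s.M s.Gen, fun _ _ => inBase_mem⟩
  | k + 1 => ⟨s.stepLift (toLim k).1 (toLim k).2 (s.inLim k) (s.inLim_mem k),
      s.stepLift_mem _ _ _ _⟩

theorem toLim_stepIncl (k : ℕ) (x : (s.iter k).M) :
    (s.toLim (k + 1)).1 (s.stepIncl k x) = (s.toLim k).1 x :=
  s.stepLift_stepIncl (s.toLim k).1 (s.toLim k).2 (s.inLim k) (s.inLim_mem k) x

theorem toLim_stepGen (k : ℕ) {p : ℕ} (w : (s.iter k).W p) :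
    (s.toLim (k + 1)).1 (s.stepGen k p w) = s.inLim k p w :=
  s.stepLift_stepGen (s.toLim k).1 (s.toLim k).2 (s.inLim k) (s.inLim_mem k) w

/-- The differential of the limit on generators. -/
noncomputable def limτ (p : ℕ) : s.Gen p →ₗ[ℚ] s.limAlg :=
  DirectSum.toModule ℚ ℕ s.limAlg fun k =>
    (s.toLim k).1.toLinearMap ∘ₗ LinearMap.fst ℚ _ E ∘ₗ ((s.iter k).W p).subtype

theorem limτ_lof (k p : ℕ) (w : (s.iter k).W p) :
    s.limτ p (DirectSum.lof ℚ ℕ (fun k => (s.iter k).W p) k w) = (s.toLim k).1 w.1.1 := by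
  rw [limτ, DirectSum.toModule_lof]
  rfl

theorem limτ_mem (p : ℕ) (v : s.Gen p) : s.limτ p v ∈ s.limAlg.gr (p + 1) := by
  refine s.gen_induction (C := fun v => s.limτ p v ∈ s.limAlg.gr (p + 1)) ?_ ?_ ?_ v
  · rw [map_zero]
    exact zero_mem _
  · intro k w
    rw [limτ_lof]
    exact (s.toLim k).2 _ _ ((s.iter k).mem_cocyc.1 ((s.iter k).mem_cocyc_of_mem_W w.2)).1.1
  · intro v w hv hw
    rw [map_add]
    exact add_mem hv hw

theorem der_inLim (k p : ℕ) (w : (s.iter k).W p) :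
    der s.limτ s.limτ_mem (s.inLim k p w) = (s.toLim k).1 w.1.1 := by
  rw [inLim, LinearMap.comp_apply, der_inGen, limτ_lof]

theorem der_toLim (k : ℕ) (x : (s.iter k).M) :
    (s.toLim k).1 ((s.iter k).M.d x) = der s.limτ s.limτ_mem ((s.toLim k).1 x) := by
  induction k with
  | zero => exact (der_inBase _ _ _).symm
  | succ k ih =>
    -- The differential used on the target is the derivation given by `limτ`, not the one that
    -- `limAlg` carries as a tensor product.
    refine s.step_map_d (B := s.limAlg) (s.toLim (k + 1)).1 (s.toLim (k + 1)).2
      (der s.limτ s.limτ_mem) (der_mul _ _) ?_ ?_ x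
    · intro r
      rw [toLim_stepIncl, toLim_stepIncl, ih]
    · intro p w
      rw [toLim_stepGen, der_inLim, toLim_stepIncl]

theorem der_limτ (p : ℕ) (v : s.Gen p) : der s.limτ s.limτ_mem (s.limτ p v) = 0 := by
  refine s.gen_induction (C := fun v => der s.limτ s.limτ_mem (s.limτ p v) = 0) ?_ ?_ ?_ v
  · rw [map_zero, map_zero]
  · intro k w
    rw [limτ_lof, ← der_toLim,
      ((s.iter k).mem_cocyc.1 ((s.iter k).mem_cocyc_of_mem_W w.2)).2.1, map_zero]
  · intro v w hv hw
    rw [map_add, map_add, hv, hw, add_zero]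

/-- The limit of the construction. -/
noncomputable def lim : CDGA.{u} := semifree s.limτ s.limτ_mem s.der_limτ

/-- The morphism from the limit to `E` on generators. -/
noncomputable def limVal (p : ℕ) : s.Gen p →ₗ[ℚ] E :=
  DirectSum.toModule ℚ ℕ E fun k => (s.iter k).val p

theorem limVal_lof (k p : ℕ) (w : (s.iter k).W p) :
    s.limVal p (DirectSum.lof ℚ ℕ (fun k => (s.iter k).W p) k w) = (s.iter k).val p w := by
  rw [limVal, DirectSum.toModule_lof]

theorem limVal_mem (p : ℕ) (v : s.Gen p) : s.limVal p v ∈ E.gr p := by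
  refine s.gen_induction (C := fun v => s.limVal p v ∈ E.gr p) ?_ ?_ ?_ v
  · rw [map_zero]
    exact zero_mem _
  · intro k w
    rw [limVal_lof]
    exact (s.iter k).val_mem p w
  · intro v w hv hw
    rw [map_add]
    exact add_mem hv hw

/-- The algebra morphism from the limit to `E`. -/
noncomputable def limAlgHom : s.limAlg →ₐ[ℚ] E :=
  extLift s.φ.toAlgHom (fun _ _ => s.φ.map_mem) s.limVal s.limVal_mem

theorem limAlgHom_inLim (k p : ℕ) (w : (s.iter k).W p) :
    s.limAlgHom (s.inLim k p w) = (s.iter k).val p w := by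
  rw [limAlgHom, inLim, LinearMap.comp_apply, extLift_inGen, limVal_lof]

theorem limAlgHom_toLim (k : ℕ) (x : (s.iter k).M) :
    s.limAlgHom ((s.toLim k).1 x) = (s.iter k).φ.toAlgHom x := by
  induction k with
  | zero => exact extLift_inBase _ _ _ _ _
  | succ k ih =>
    have : s.limAlgHom.comp (s.toLim (k + 1)).1 = (s.iter (k + 1)).φ.toAlgHom := by
      refine s.step_algHom_ext ?_ ?_
      · intro r
        rw [AlgHom.comp_apply, toLim_stepIncl, ih, φ_stepIncl]
      · intro p w
        rw [AlgHom.comp_apply, toLim_stepGen, limAlgHom_inLim, φ_stepGen]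
    exact congrArg (fun g => g x) this

/-- The morphism from the limit to `E`. -/
noncomputable def limHom : Hom s.lim E :=
  semifreeLift s.limτ s.limτ_mem s.der_limτ s.φ s.limVal s.limVal_mem (by
    intro p v
    refine s.gen_induction (C := fun v => s.limAlgHom (s.limτ p v) = E.d (s.limVal p v))
      ?_ ?_ ?_ v
    · simp only [map_zero]
    · intro k w
      rw [limτ_lof, limVal_lof, limAlgHom_toLim, φ_eq_d_val]
    · intro v w hv hw
      rw [map_add, map_add, map_add, map_add, hv, hw])

theorem limHom_toLim (k : ℕ) (x : (s.iter k).M) :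
    s.limHom.toAlgHom ((s.toLim k).1 x) = (s.iter k).φ.toAlgHom x := s.limAlgHom_toLim k x

theorem limHom_inLim (k p : ℕ) (w : (s.iter k).W p) :
    s.limHom.toAlgHom (s.inLim k p w) = (s.iter k).val p w := s.limAlgHom_inLim k p w

/-! ### Retractions of the limit onto the stages. -/

section retraction

/-- The map from the generators added at stage `j` to stage `k`: the inclusion for `j < k`, and
zero otherwise. -/
noncomputable def retrGen (j p : ℕ) : ∀ k : ℕ, (s.iter j).W p →ₗ[ℚ] (s.iter k).M
  | 0 => 0
  | k + 1 =>
    if h : j = k then h ▸ s.stepGen j p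
    else (s.stepIncl k).toLinearMap ∘ₗ retrGen j p k

theorem retrGen_self (k p : ℕ) (w : (s.iter k).W p) :
    s.retrGen k p (k + 1) w = s.stepGen k p w := by
  rw [retrGen, dif_pos rfl]

theorem retrGen_ne {j k : ℕ} (h : j ≠ k) (p : ℕ) (w : (s.iter j).W p) :
    s.retrGen j p (k + 1) w = s.stepIncl k (s.retrGen j p k w) := by
  rw [retrGen, dif_neg h]
  rfl

theorem retrGen_mem (j p k : ℕ) (w : (s.iter j).W p) :
    s.retrGen j p k w ∈ (s.iter k).M.gr p := by
  induction k with
  | zero => exact zero_mem _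
  | succ k ih =>
    by_cases h : j = k
    · subst h
      rw [retrGen_self]
      exact s.stepGen_mem j w
    · rw [retrGen_ne s h]
      exact s.stepIncl_mem k ih

/-- The inclusion of the initial stage. -/
noncomputable def baseIncl : ∀ k : ℕ, {g : s.M →ₐ[ℚ] (s.iter k).M //
    ∀ j, ∀ x ∈ s.M.gr j, g x ∈ (s.iter k).M.gr j}
  | 0 => ⟨AlgHom.id ℚ s.M, fun _ _ h => h⟩
  | k + 1 => ⟨(s.stepIncl k).comp (baseIncl k).1,
      fun j x hx => s.stepIncl_mem k ((baseIncl k).2 j x hx)⟩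

/-- The map from the limit to the generators of stage `k` which vanishes on later generators. -/
noncomputable def limRetrGen (k p : ℕ) : s.Gen p →ₗ[ℚ] (s.iter k).M :=
  DirectSum.toModule ℚ ℕ (s.iter k).M fun j => s.retrGen j p k

theorem limRetrGen_lof (k j p : ℕ) (w : (s.iter j).W p) :
    s.limRetrGen k p (DirectSum.lof ℚ ℕ (fun k => (s.iter k).W p) j w) = s.retrGen j p k w := by
  rw [limRetrGen, DirectSum.toModule_lof]

theorem limRetrGen_mem (k p : ℕ) (v : s.Gen p) : s.limRetrGen k p v ∈ (s.iter k).M.gr p := by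
  refine s.gen_induction (C := fun v => s.limRetrGen k p v ∈ (s.iter k).M.gr p) ?_ ?_ ?_ v
  · rw [map_zero]
    exact zero_mem _
  · intro j w
    rw [limRetrGen_lof]
    exact s.retrGen_mem j p k w
  · intro v w hv hw
    rw [map_add]
    exact add_mem hv hw

/-- The retraction from the limit to stage `k`. -/
noncomputable def retr (k : ℕ) : s.limAlg →ₐ[ℚ] (s.iter k).M :=
  extLift (s.baseIncl k).1 (s.baseIncl k).2 (s.limRetrGen k) (s.limRetrGen_mem k)

theorem retr_inLim (k j p : ℕ) (w : (s.iter j).W p) :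
    s.retr k (s.inLim j p w) = s.retrGen j p k w := by
  rw [retr, inLim, LinearMap.comp_apply, extLift_inGen, limRetrGen_lof]

theorem retr_inBase (k : ℕ) (x : s.M) :
    s.retr k (inBase s.M s.Gen x) = (s.baseIncl k).1 x := extLift_inBase _ _ _ _ x

/-- The image of stage `m` involves only generators added before stage `m ≤ k`. The two retractions
differ only on the generators added at stage `k`. -/
theorem retr_succ_toLim {k m : ℕ} (h : m ≤ k) (x : (s.iter m).M) :
    s.retr (k + 1) ((s.toLim m).1 x) = s.stepIncl k (s.retr k ((s.toLim m).1 x)) := by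
  induction m with
  | zero =>
    exact (s.retr_inBase (k + 1) x).trans (congrArg (s.stepIncl k) (s.retr_inBase k x)).symm
  | succ m ih =>
    have : (s.retr (k + 1)).comp (s.toLim (m + 1)).1 =
        ((s.stepIncl k).comp (s.retr k)).comp (s.toLim (m + 1)).1 := by
      refine s.step_algHom_ext ?_ ?_
      · intro y
        simp only [AlgHom.comp_apply]
        rw [toLim_stepIncl, ih (by omega)]
      · intro p w
        simp only [AlgHom.comp_apply]
        rw [toLim_stepGen, retr_inLim, retr_inLim, retrGen_ne s (by omega)]
    exact congrArg (fun g => g x) this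

theorem retr_toLim (k : ℕ) (x : (s.iter k).M) : s.retr k ((s.toLim k).1 x) = x := by
  induction k with
  | zero => exact s.retr_inBase 0 x
  | succ k ih =>
    have : (s.retr (k + 1)).comp (s.toLim (k + 1)).1 = AlgHom.id ℚ _ := by
      refine s.step_algHom_ext ?_ ?_
      · intro y
        rw [AlgHom.comp_apply, toLim_stepIncl, retr_succ_toLim s le_rfl, ih, AlgHom.id_apply]
      · intro p w
        rw [AlgHom.comp_apply, toLim_stepGen, retr_inLim, retrGen_self, AlgHom.id_apply]
    exact congrArg (fun g => g x) this

/-- This brings the cocycle condition in the limit back to a stage. -/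
theorem toLim_injective (k : ℕ) : Function.Injective (s.toLim k).1 :=
  Function.LeftInverse.injective (s.retr_toLim k)

end retraction

/-! ### The limit as the union of its stages, and its cohomology. -/

theorem range_toLim_mono {k l : ℕ} (h : k ≤ l) :
    (s.toLim k).1.range ≤ (s.toLim l).1.range := by
  induction l, h using Nat.le_induction with
  | base => exact le_rfl
  | succ l _ ih =>
    refine ih.trans ?_
    rintro _ ⟨x, rfl⟩
    exact ⟨s.stepIncl l x, s.toLim_stepIncl l x⟩

theorem inLim_mem_range (k p : ℕ) (w : (s.iter k).W p) :
    s.inLim k p w ∈ (s.toLim (k + 1)).1.range := ⟨_, s.toLim_stepGen k w⟩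

/-- Every element of the limit comes from some stage. -/
theorem exists_toLim (x : s.limAlg) : ∃ k, x ∈ (s.toLim k).1.range := by
  let S : Subalgebra ℚ s.limAlg :=
    { carrier := {x | ∃ k, x ∈ (s.toLim k).1.range}
      mul_mem' := by
        rintro x y ⟨k, hx⟩ ⟨l, hy⟩
        exact ⟨max k l, Subalgebra.mul_mem _ (s.range_toLim_mono (le_max_left k l) hx)
          (s.range_toLim_mono (le_max_right k l) hy)⟩
      add_mem' := by
        rintro x y ⟨k, hx⟩ ⟨l, hy⟩
        exact ⟨max k l, Subalgebra.add_mem _ (s.range_toLim_mono (le_max_left k l) hx)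
          (s.range_toLim_mono (le_max_right k l) hy)⟩
      algebraMap_mem' := fun c => ⟨0, Subalgebra.algebraMap_mem _ c⟩ }
  have hS : S = ⊤ := by
    refine tensorFree_eq_top S (fun r => ⟨0, r, rfl⟩) fun p v => ?_
    refine s.gen_induction (C := fun v => inGen s.M s.Gen p v ∈ S) ?_ ?_ ?_ v
    · rw [map_zero]
      exact zero_mem S
    · intro k w
      exact ⟨k + 1, s.inLim_mem_range k p w⟩
    · intro v w hv hw
      rw [map_add]
      exact add_mem hv hw
  have hx : x ∈ (⊤ : Subalgebra ℚ s.limAlg) := trivial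
  rw [← hS] at hx
  exact hx

theorem exists_toLim_of_mem {j : ℕ} {x : s.limAlg} (hx : x ∈ s.limAlg.gr j) :
    ∃ k, ∃ y ∈ (s.iter k).M.gr j, (s.toLim k).1 y = x := by
  obtain ⟨k, y, rfl⟩ := s.exists_toLim x
  refine ⟨k, (s.iter k).M.proj j y, CDGA.proj_mem _ _ _, ?_⟩
  have := map_proj (f := (s.toLim k).1.toLinearMap) (s.toLim k).2 j y
  refine this.trans ?_
  exact s.limAlg.proj_same hx

theorem lim_d_inLim (k p : ℕ) (w : (s.iter k).W p) :
    s.lim.d (s.inLim k p w) = (s.toLim k).1 w.1.1 := s.der_inLim k p w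

theorem lim_d_toLim (k : ℕ) (x : (s.iter k).M) :
    s.lim.d ((s.toLim k).1 x) = (s.toLim k).1 ((s.iter k).M.d x) := (s.der_toLim k x).symm

theorem lim_gr_zero (x : s.lim) (hx : x ∈ s.lim.gr 0) : ∃ c : ℚ, x = algebraMap ℚ s.lim c :=
  tensorFree_gr_zero (V := s.Gen) s.zero x hx

/-- The limit is a model of `E`. -/
theorem limHom_isQuasiIso (hE : E.CohConnected) : s.limHom.IsQuasiIso := by
  refine Hom.isQuasiIso_of_homogeneous _ ?_ ?_
  · intro j x hx hd e he
    rcases j with _ | p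
    · obtain ⟨c, rfl⟩ := s.lim_gr_zero x hx
      rw [AlgHom.commutes] at he
      have h0 := E.eq_zero_of_mem_zero_of_eq_d (E.algebraMap_mem c) he
      have := hE.nontrivial
      have hc : c = 0 := (algebraMap ℚ E).injective (h0.trans (map_zero _).symm)
      exact ⟨0, by rw [hc, map_zero, map_zero]⟩
    · obtain ⟨k, y, hy, rfl⟩ := s.exists_toLim_of_mem hx
      have hdy : (s.iter k).M.d y = 0 := by
        apply s.toLim_injective k
        rw [← lim_d_toLim, map_zero]
        exact hd
      have he' : (s.iter k).φ.toAlgHom y = E.d e := (s.limHom_toLim k y).symm.trans he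
      -- In degree 1 a bounding generator would have degree 0, so the injectivity on `H^1` built
      -- into each stage is used instead.
      rcases p with _ | p
      · refine ⟨0, ?_⟩
        rw [(s.iter k).one y hy hdy e he', map_zero, map_zero]
        rfl
      -- A cocycle `y` of stage `k` with image `d e` forms a relative cocycle `(y, e)`. The
      -- generator representing it bounds `y` at stage `k + 1`, up to a coboundary already present.
      · have he2 := E.eq_d_proj ((s.iter k).φ.map_mem hy) he'
        have hz : (y, E.proj (p + 1) e) ∈ (s.iter k).cocyc (p + 1) :=
          (s.iter k).mem_cocyc.2 ⟨⟨hy, E.proj_mem _ _⟩, hdy, he2⟩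
        obtain ⟨w, hw, x, -, e', h1, -⟩ := (s.iter k).exists_W hz
        refine ⟨s.inLim k (p + 1) ⟨w, hw⟩ + (s.toLim k).1 x, ?_⟩
        have h1' : y = w.1 + (s.iter k).M.d x := h1
        refine Eq.trans ?_ (map_add s.lim.d _ _).symm
        rw [lim_d_inLim, lim_d_toLim, h1', map_add]
        rfl
  · intro j y hy hd
    rcases j with _ | p
    · obtain ⟨c, rfl⟩ := hE.scalar y hy hd
      exact ⟨algebraMap ℚ s.lim c, s.lim.d_algebraMap c, 0, by rw [AlgHom.commutes]; simp⟩
    -- For surjectivity one step suffices: a cocycle `y` of `E` is the relative cocycle `(0, y)`,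
    -- and the generator representing it, corrected by `x`, is a cocycle over `y`.
    · have hz : ((0 : (s.iter 0).M), y) ∈ (s.iter 0).cocyc (p + 1) :=
        (s.iter 0).mem_cocyc.2 ⟨⟨zero_mem _, hy⟩, map_zero _, by rw [map_zero]; exact hd.symm⟩
      obtain ⟨w, hw, x, -, e, h1, h2⟩ := (s.iter 0).exists_W hz
      have h1' : 0 = w.1 + (s.iter 0).M.d x := h1
      have h2' : y = w.2 + ((s.iter 0).φ.toAlgHom x + E.d e) := h2
      refine ⟨s.inLim 0 (p + 1) ⟨w, hw⟩ + (s.toLim 0).1 x, ?_, e, ?_⟩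
      · refine Eq.trans (map_add s.lim.d _ _) ?_
        rw [lim_d_inLim, lim_d_toLim]
        refine Eq.trans (map_add (s.toLim 0).1 _ _).symm ?_
        rw [← h1', map_zero]
        rfl
      · have : s.limHom.toAlgHom (s.inLim 0 (p + 1) ⟨w, hw⟩ + (s.toLim 0).1 x) =
            w.2 + (s.iter 0).φ.toAlgHom x := by
          refine Eq.trans (map_add s.limHom.toAlgHom _ _) ?_
          rw [limHom_inLim, limHom_toLim]
          rfl
        rw [this, h2', add_assoc]

end Stage

/-! ### Freeness of `(R ⊗ ΛV, D)` over `R`. -/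

section mulFree
variable {R : CDGA.{u}} {V : ℕ → Type u} [∀ p, AddCommGroup (V p)] [∀ p, Module ℚ (V p)]
  (τ : ∀ p, V p →ₗ[ℚ] tensorFree R V)
  (hτ : ∀ p, ∀ v : V p, τ p v ∈ (tensorFree R V).gr (p + 1))
  (hD : ∀ p, ∀ v : V p, der τ hτ (τ p v) = 0)

/-- The space of generators of degree `p` inside `(R ⊗ ΛV, D)`. -/
noncomputable def genSub (p : ℕ) : Submodule ℚ (semifree τ hτ hD) :=
  LinearMap.range (inGen R V p)

theorem genSub_le (p : ℕ) : genSub τ hτ hD p ≤ (semifree τ hτ hD).gr p := by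
  rintro _ ⟨v, rfl⟩
  exact inGen_mem v

theorem genSub_zero [Subsingleton (V 0)] : genSub τ hτ hD 0 = ⊥ := by
  rw [eq_bot_iff]
  rintro _ ⟨v, rfl⟩
  rw [Subsingleton.elim v 0]
  exact (Submodule.mem_bot ℚ).2 (map_zero (inGen R V 0))

/-- Since the generators inject, `V` may be replaced by its image. The multiplication map then
becomes the identification of the plain tensor product with the graded one. -/
theorem semifree_mulFree_bijective [Nontrivial R] : Function.Bijective
    ((semifreeIncl τ hτ hD).mulFree (genSub τ hτ hD) (genSub_le τ hτ hD)) := by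
  let e : ∀ p, V p ≃ₗ[ℚ] genSub τ hτ hD p := fun p =>
    LinearEquiv.ofInjective (inGen R V p) (inGen_injective p)
  let ε : FreeCGA V ≃ₐ[ℚ] FreeCGA (fun p => genSub τ hτ hD p) := FreeCGA.congr e
  have h1 : (freeLift (genSub τ hτ hD) (genSub_le τ hτ hD)).comp ε.toAlgHom = inFree R V := by
    refine FreeCGA.algHom_ext fun p v => ?_
    have : ε (FreeCGA.ι V p v) = FreeCGA.ι (fun p => genSub τ hτ hD p) p (e p v) :=
      FreeCGA.congr_ι e v
    refine (congrArg (freeLift (genSub τ hτ hD) (genSub_le τ hτ hD)) this).trans ?_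
    rw [freeLift_ι]
    rfl
  let L : R ⊗[ℚ] FreeCGA (fun p => genSub τ hτ hD p) ≃ₗ[ℚ] R ⊗[ℚ] FreeCGA V :=
    TensorProduct.congr (LinearEquiv.refl ℚ R) ε.symm.toLinearEquiv
  let L' : R ⊗[ℚ] FreeCGA V ≃ₗ[ℚ] semifree τ hτ hD :=
    GradedTensorProduct.of ℚ R.gr (free V).gr
  have h2 : (semifreeIncl τ hτ hD).mulFree (genSub τ hτ hD) (genSub_le τ hτ hD) =
      (L.trans L').toLinearMap := by
    refine TensorProduct.ext' fun r w => ?_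
    obtain ⟨w, rfl⟩ := ε.surjective w
    have e1 : freeLift (genSub τ hτ hD) (genSub_le τ hτ hD) (ε w) = inFree R V w :=
      congrArg (fun g => g w) h1
    have e2 : (L.trans L').toLinearMap (r ⊗ₜ ε w) = L' (r ⊗ₜ w) := by
      change L' (r ⊗ₜ ε.symm (ε w)) = L' (r ⊗ₜ w)
      rw [AlgEquiv.symm_apply_apply]
    rw [e2]
    refine Eq.trans ?_ (inBase_mul_inFree (R := R) (V := V) r w)
    exact congrArg (fun y => inBase R V r * y) e1
  rw [h2]
  exact (L.trans L').bijective

end mulFree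

/-! ### The filtration of the generators and the Sullivan condition. -/

namespace Stage
variable {R E : CDGA.{u}} {f : Hom R E} (s : Stage f)

/-- The inclusion of the base in the limit. -/
noncomputable def limIncl : Hom s.M s.lim := semifreeIncl s.limτ s.limτ_mem s.der_limτ

/-- The generators of degree `p` added before stage `k`. -/
noncomputable def limFil (k p : ℕ) : Submodule ℚ s.lim :=
  ⨆ j, ⨆ (_ : j < k), LinearMap.range (s.inLim j p)

theorem limFil_mono {k l : ℕ} (h : k ≤ l) (p : ℕ) : s.limFil k p ≤ s.limFil l p :=
  iSup₂_le fun j hj => le_iSup₂_of_le j (hj.trans_le h) le_rfl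

theorem iSup_limFil (p : ℕ) :
    ⨆ k, s.limFil (k + 1) p = genSub s.limτ s.limτ_mem s.der_limτ p := by
  refine le_antisymm (iSup_le fun k => iSup₂_le fun j _ => ?_) ?_
  · rintro _ ⟨w, rfl⟩
    exact ⟨_, rfl⟩
  · rintro _ ⟨v, rfl⟩
    let g : s.Gen p →ₗ[ℚ] s.lim := inGen s.M s.Gen p
    change g v ∈ ⨆ k, s.limFil (k + 1) p
    refine s.gen_induction (C := fun v => g v ∈ ⨆ k, s.limFil (k + 1) p) ?_ ?_ ?_ v
    · rw [map_zero]
      exact Submodule.zero_mem _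
    · intro k w
      refine Submodule.mem_iSup_of_mem k ?_
      have : LinearMap.range (s.inLim k p) ≤ s.limFil (k + 1) p :=
        le_iSup₂_of_le k (Nat.lt_succ_self k) le_rfl
      exact this ⟨w, rfl⟩
    · intro v w hv hw
      rw [map_add]
      exact Submodule.add_mem _ hv hw

/-- By induction, each stage is generated by the preceding one and by the generators just adjoined.
-/
theorem toLim_mem_adjoin (k : ℕ) (x : (s.iter k).M) : (s.toLim k).1 x ∈
    s.limIncl.toAlgHom.range ⊔ Algebra.adjoin ℚ (⋃ q, (s.limFil k q : Set s.lim)) := by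
  induction k with
  | zero =>
    have : s.limIncl.toAlgHom x ∈ s.limIncl.toAlgHom.range := ⟨x, rfl⟩
    exact (le_sup_left (α := Subalgebra ℚ s.lim)) this
  | succ k ih =>
    let S : Subalgebra ℚ s.lim := s.limIncl.toAlgHom.range ⊔
      Algebra.adjoin ℚ (⋃ q, (s.limFil (k + 1) q : Set s.lim))
    have hle : s.limIncl.toAlgHom.range ⊔
        Algebra.adjoin ℚ (⋃ q, (s.limFil k q : Set s.lim)) ≤ S :=
      sup_le_sup le_rfl (Algebra.adjoin_mono (Set.iUnion_mono fun q =>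
        s.limFil_mono (Nat.le_succ k) q))
    let g : (s.iter (k + 1)).M →ₐ[ℚ] s.lim := (s.toLim (k + 1)).1
    have hS : S.comap g = ⊤ := by
      refine s.step_eq_top _ (fun y => ?_) fun p w => ?_
      · have e : g (s.stepIncl k y) = (s.toLim k).1 y := s.toLim_stepIncl k y
        change g (s.stepIncl k y) ∈ S
        rw [e]
        exact hle (ih y)
      · have e : g (s.stepGen k p w) = s.inLim k p w := s.toLim_stepGen k w
        change g (s.stepGen k p w) ∈ S
        rw [e]
        refine (le_sup_right (α := Subalgebra ℚ s.lim)) (Algebra.subset_adjoin ?_)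
        refine Set.mem_iUnion.2 ⟨p, ?_⟩
        have : LinearMap.range (s.inLim k p) ≤ s.limFil (k + 1) p :=
          le_iSup₂_of_le k (Nat.lt_succ_self k) le_rfl
        exact this ⟨w, rfl⟩
    have hx : x ∈ S.comap g := by
      rw [hS]
      trivial
    exact hx

/-- The differential of a generator added at stage `j` lies in stage `j`, which involves only
generators added earlier. -/
theorem d_mem_adjoin (k p : ℕ) (v : s.lim) (hv : v ∈ s.limFil (k + 1) p) : s.lim.d v ∈
    s.limIncl.toAlgHom.range ⊔ Algebra.adjoin ℚ (⋃ q, (s.limFil k q : Set s.lim)) := by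
  let S : Subalgebra ℚ s.lim := s.limIncl.toAlgHom.range ⊔
    Algebra.adjoin ℚ (⋃ q, (s.limFil k q : Set s.lim))
  have : s.limFil (k + 1) p ≤ S.toSubmodule.comap s.lim.d := by
    refine iSup₂_le fun j hj => ?_
    rintro _ ⟨w, rfl⟩
    change s.lim.d (s.inLim j p w) ∈ S
    rw [lim_d_inLim]
    have hle : s.limIncl.toAlgHom.range ⊔
        Algebra.adjoin ℚ (⋃ q, (s.limFil j q : Set s.lim)) ≤ S :=
      sup_le_sup le_rfl (Algebra.adjoin_mono (Set.iUnion_mono fun q =>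
        s.limFil_mono (by omega) q))
    exact hle (s.toLim_mem_adjoin j _)
  exact this hv

/-- The limit is a relative Sullivan algebra. -/
theorem limIncl_isRelativeSullivan [Nontrivial s.M] : s.limIncl.IsRelativeSullivan := by
  -- The filtration is shifted by one: `limFil 0` is zero, so the first step is `limFil 1`, the
  -- generators adjoined to the base itself.
  refine ⟨⟨inferInstance, fun x hx _ => s.zero x hx⟩, genSub s.limτ s.limτ_mem s.der_limτ,
    genSub_le _ _ _, ?_, semifree_mulFree_bijective _ _ _, fun k p => s.limFil (k + 1) p,
    fun k p => s.limFil_mono (Nat.le_succ _) p, s.iSup_limFil, ?_,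
    fun k p v hv => s.d_mem_adjoin (k + 1) p v hv⟩
  · exact genSub_zero _ _ _
  · intro p v hv
    have h := s.d_mem_adjoin 0 p v hv
    have e : Algebra.adjoin ℚ (⋃ q, (s.limFil 0 q : Set s.lim)) = ⊥ := by
      rw [eq_bot_iff, Algebra.adjoin_le_iff]
      refine Set.iUnion_subset fun q x hx => ?_
      have h0 : s.limFil 0 q = ⊥ := by simp [limFil]
      have hx' : x ∈ s.limFil 0 q := hx
      rw [h0] at hx'
      rw [(Submodule.mem_bot ℚ).1 hx']
      exact Subalgebra.zero_mem _
    rwa [e, sup_bot_eq] at h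

end Stage

/-! ### Existence of relative Sullivan models. -/

/-- The identity morphism. -/
def Hom.id (R : CDGA.{u}) : Hom R R where
  toAlgHom := AlgHom.id ℚ R
  map_mem h := h
  map_d _ := rfl

/-- The initial stage. -/
def Stage.init {R E : CDGA.{u}} (f : Hom R E)
    (h0 : ∀ x ∈ R.gr 0, ∃ c : ℚ, x = algebraMap ℚ R c) (h1 : R.gr 1 = ⊥) : Stage f where
  M := R
  i := Hom.id R
  φ := f
  comm _ := rfl
  zero := h0
  one x hx _ _ _ := by
    rw [h1] at hx
    exact (Submodule.mem_bot ℚ).1 hx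

/-- Every morphism from a 1-connected CDGA to a cohomologically connected one has a relative
Sullivan model. -/
theorem exists_relativeSullivan {R E : CDGA.{u}} (f : Hom R E) (hR : R.OneConnected)
    (hE : E.CohConnected) : ∃ (M : CDGA.{u}) (i : Hom R M) (α : Hom M E),
      i.IsRelativeSullivan ∧ α.IsQuasiIso ∧ ∀ r, α.toAlgHom (i.toAlgHom r) = f.toAlgHom r := by
  let s := Stage.init f hR.gr_zero hR.gr_one
  have : Nontrivial s.M := hR.nontrivial
  exact ⟨s.lim, s.limIncl, s.limHom, s.limIncl_isRelativeSullivan, s.limHom_isQuasiIso hE,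
    fun r => s.limHom_toLim 0 r⟩

/-- The middle term `E` inherits `H^0 = ℚ` from `P`, so `R → E` has a relative Sullivan model;
composing its map to `E` with the two legs gives the required pair of quasi-isomorphisms. -/
theorem SpanUnder.weakEquivUnder {R P Q : CDGA.{u}} {f : Hom R P} {g : Hom R Q}
    (h : SpanUnder f g) (hR : R.OneConnected) (hP : P.CohConnected) : WeakEquivUnder f g := by
  obtain ⟨E, i, α, β, hα, hβ, hf, hg⟩ := h
  obtain ⟨M, j, γ, hj, hγ, hc⟩ := exists_relativeSullivan i hR (.of_isQuasiIso hα hP)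
  refine ⟨M, j, α.comp γ, β.comp γ, hj, hα.comp hγ, hβ.comp hγ, fun r => ?_, fun r => ?_⟩
  · rw [Hom.comp_apply, hc, hf]
  · rw [Hom.comp_apply, hc, hg]

theorem proj_mul_of_mem (A : CDGA.{u}) {k q : ℕ} (a : A) {b : A} (hb : b ∈ A.gr q) :
    A.proj (k + q) (a * b) = A.proj k a * b := by
  have : A.proj (k + q) ∘ₗ (LinearMap.mul ℚ A).flip b =
      (LinearMap.mul ℚ A).flip b ∘ₗ A.proj k := by
    refine A.lin_ext fun j a ha => ?_
    simp only [LinearMap.comp_apply, LinearMap.flip_apply, LinearMap.mul_apply']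
    by_cases hj : j = k
    · subst hj
      rw [A.proj_same ha, A.proj_same (A.mul_mem ha hb rfl)]
    · rw [A.proj_ne hj ha, A.proj_ne (by omega) (A.mul_mem ha hb rfl), zero_mul]
  exact LinearMap.congr_fun this a

theorem OneConnected.tensor {A : CDGA.{u}} (h : A.OneConnected) :
    (A.tensor A).OneConnected where
  nontrivial := by
    refine ⟨⟨0, 1, fun h01 => ?_⟩⟩
    have := congrArg (fun z => h.aug (A.m z)) h01
    simp only [map_zero, map_one, h.aug_one] at this
    exact zero_ne_one this
  gr_zero _ ha := h.tensor_gr_zero ha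
  gr_one := by
    rw [eq_bot_iff]
    refine ot_gr_le fun i j hij a ha b hb => ?_
    rw [Submodule.mem_bot, ← otₗ_apply]
    rcases Nat.eq_zero_or_pos i with rfl | hi
    · obtain rfl : j = 1 := by omega
      rw [h.gr_one, Submodule.mem_bot] at hb
      rw [hb, map_zero]
    · obtain rfl : i = 1 := by omega
      rw [h.gr_one, Submodule.mem_bot] at ha
      rw [ha, map_zero, LinearMap.zero_apply]

/-! ### The CDGAs `C(ξ)` under `A ⊗ A`. -/

section cxi
variable {A : CDGA.{u}} {n N : ℕ} (h : A.OneConnected) (P : A.PoincareDuality n)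
  (b : A.HomogeneousBasis N) (hn : Odd n) (ξ ξ' : (A.tensor A).gr (2 * n - 2))

/-- The class in `C(ξ)` of an element of the mapping cone. -/
noncomputable def cxiMk : A.Cone →ₗ[ℚ] Cxi h P b hn ξ := (A.coneTop n).mkQ

theorem cxiMk_surjective : Function.Surjective (cxiMk h P b hn ξ) :=
  Submodule.mkQ_surjective _

theorem cxiMk_eq_zero {e : A.Cone} (he : e ∈ A.coneTop n) : cxiMk h P b hn ξ e = 0 :=
  (Submodule.Quotient.mk_eq_zero _).2 he

theorem mem_coneTop_of_cxiMk_eq_zero {e : A.Cone} (he : cxiMk h P b hn ξ e = 0) :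
    e ∈ A.coneTop n := (Submodule.Quotient.mk_eq_zero _).1 he

theorem cxiMk_mul (e f : A.Cone) :
    cxiMk h P b hn ξ e * cxiMk h P b hn ξ f = cxiMk h P b hn ξ (coneMul h ξ e f) := rfl

theorem d_cxiMk (e : A.Cone) :
    (Cxi h P b hn ξ).d (cxiMk h P b hn ξ e) = cxiMk h P b hn ξ (P.coneD b e) := rfl

theorem cxiMk_mem {k : ℕ} {e : A.Cone} (he : e ∈ A.coneGr n k) :
    cxiMk h P b hn ξ e ∈ (Cxi h P b hn ξ).gr k := ⟨e, he, rfl⟩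

theorem exists_cxiMk {k : ℕ} {x : Cxi h P b hn ξ} (hx : x ∈ (Cxi h P b hn ξ).gr k) :
    ∃ e ∈ A.coneGr n k, cxiMk h P b hn ξ e = x := hx

theorem toCxi_apply (z : A.tensor A) :
    (toCxi h P b hn ξ).toAlgHom z = cxiMk h P b hn ξ (z, 0) := rfl

theorem cxi_gr_eq_zero {k : ℕ} (hk : 2 * n - 1 ≤ k) {x : Cxi h P b hn ξ}
    (hx : x ∈ (Cxi h P b hn ξ).gr k) : x = 0 := by
  obtain ⟨e, he, rfl⟩ := exists_cxiMk h P b hn ξ hx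
  exact cxiMk_eq_zero h P b hn ξ (coneGr_le_top hk he)

/-- In degrees below `n - 1` the map `A ⊗ A → C(ξ)` is onto. -/
theorem exists_toCxi {k : ℕ} (hk : k < n - 1) {x : Cxi h P b hn ξ}
    (hx : x ∈ (Cxi h P b hn ξ).gr k) :
    ∃ z ∈ (A.tensor A).gr k, (toCxi h P b hn ξ).toAlgHom z = x := by
  obtain ⟨⟨z, y⟩, he, rfl⟩ := exists_cxiMk h P b hn ξ hx
  obtain ⟨hz, hy⟩ := mem_coneGr.1 he
  rcases mem_shiftGr.1 hy with h0 | ⟨i, hi, -⟩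
  · refine ⟨z, hz, ?_⟩
    have h0' : y = 0 := h0
    rw [h0', toCxi_apply]
  · omega

/-- As `n ≥ 3`, degree 0 lies below both the shifted summand and the truncation, so it is `(A ⊗ A)^0
= ℚ`. -/
theorem cxi_cohConnected : (Cxi h P b hn ξ).CohConnected where
  nontrivial := by
    have hn3 := P.three_le h hn
    have := h.tensor.nontrivial
    refine ⟨⟨cxiMk h P b hn ξ (1, 0), 0, fun h0 => ?_⟩⟩
    have h1 : ((1, 0) : A.Cone) ∈ A.coneGr n 0 :=
      mem_coneGr.2 ⟨(A.tensor A).one_mem, zero_mem _⟩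
    have h2 : A.coneTop n ≤ LinearMap.ker (A.coneProj n 0) :=
      iSup₂_le fun j hj e he => coneProj_ne (by omega) he
    have h3 := h2 (mem_coneTop_of_cxiMk_eq_zero h P b hn ξ h0)
    rw [LinearMap.mem_ker, coneProj_same h1] at h3
    exact one_ne_zero (congrArg Prod.fst h3)
  scalar x hx _ := by
    have hn3 := P.three_le h hn
    obtain ⟨z, hz, rfl⟩ := exists_toCxi h P b hn ξ (by omega) hx
    obtain ⟨c, rfl⟩ := h.tensor_gr_zero hz
    exact ⟨c, AlgHom.commutes _ c⟩

/-- The shifted summand starts in degree `n - 1 ≥ 2`, and `A ⊗ A` is 1-connected. -/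
theorem cxi_gr_one {x : Cxi h P b hn ξ} (hx : x ∈ (Cxi h P b hn ξ).gr 1) : x = 0 := by
  have hn3 := P.three_le h hn
  obtain ⟨⟨z, y⟩, he, rfl⟩ := exists_cxiMk h P b hn ξ hx
  obtain ⟨hz, hy⟩ := mem_coneGr.1 he
  rw [h.tensor.gr_one, Submodule.mem_bot] at hz
  rcases mem_shiftGr.1 hy with h0 | ⟨i, hi, -⟩
  · have : (z, y) = (0 : A.Cone) := Prod.ext hz h0
    rw [this, map_zero]
  · omega

/-- `C(ξ)` is generated by `ss^{-n}1` over `A ⊗ A`. -/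
theorem cxiMk_eq (z : A.tensor A) (x : A) : cxiMk h P b hn ξ (z, x) =
    (toCxi h P b hn ξ).toAlgHom z +
      (toCxi h P b hn ξ).toAlgHom (ot 1 x) * cxiMk h P b hn ξ (0, 1) := by
  rw [toCxi_apply, toCxi_apply, cxiMk_mul, ← map_add, coneMul_apply]
  congr 1
  simp [m_ot]

/-- Every quasi-isomorphism to `C(ξ)` under `A ⊗ A` is surjective. -/
theorem surjective_of_isQuasiIso {M : CDGA.{u}} {i : Hom (A.tensor A) M}
    {α : Hom M (Cxi h P b hn ξ)} (hα : α.IsQuasiIso)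
    (hc : ∀ r, α.toAlgHom (i.toAlgHom r) = (toCxi h P b hn ξ).toAlgHom r) :
    Function.Surjective α.toAlgHom := by
  have hn3 := P.three_le h hn
  rw [Hom.isQuasiIso_iff] at hα
  have hd : (Cxi h P b hn ξ).d (cxiMk h P b hn ξ (0, 1)) =
      (toCxi h P b hn ξ).toAlgHom (P.diag b) := by
    rw [d_cxiMk, P.coneD_apply b hn, toCxi_apply, ot_one, mul_one, map_zero, zero_add, A.d_one]
  -- The image of `Δ` is exact in `C(ξ)`, with primitive `ss^{-n}1`, so `Δ` is already exact in `M`.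
  -- Its primitive `v` lifts `ss^{-n}1` up to a cocycle, which is corrected next.
  obtain ⟨v, hv⟩ := hα.1 (i.toAlgHom (P.diag b))
    (by rw [← i.map_d, P.d_diag, map_zero]) _ ((hc _).trans hd.symm)
  obtain ⟨z, -, q, hq⟩ := hα.2 (cxiMk h P b hn ξ (0, 1) - α.toAlgHom v)
    (by rw [map_sub, hd, ← α.map_d, ← hv, hc, sub_self])
  have hs : cxiMk h P b hn ξ (0, 1) ∈ (Cxi h P b hn ξ).gr (n - 2 + 1) :=
    cxiMk_mem h P b hn ξ (mem_coneGr.2 ⟨zero_mem _, shift_mem A.one_mem (by omega)⟩)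
  -- The remaining error is `d q`. Only the component of `q` in degree `n - 2` matters; it lies
  -- below the shifted summand, so it comes from `A ⊗ A` and its differential can be lifted through
  -- `i`.
  obtain ⟨r, -, hr⟩ := exists_toCxi h P b hn ξ (k := n - 2) (by omega)
    ((Cxi h P b hn ξ).proj_mem (n - 2) q)
  have h1 : cxiMk h P b hn ξ (0, 1) =
      α.toAlgHom (M.proj (n - 2 + 1) (v + z) + i.toAlgHom ((A.tensor A).d r)) := by
    rw [map_add, hc, (toCxi h P b hn ξ).map_d, hr, ← proj_succ_d, α.apply_proj, ← map_add,
      map_add α.toAlgHom, add_assoc, ← hq, add_sub_cancel, proj_same _ hs]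
  intro x
  obtain ⟨⟨w, y⟩, rfl⟩ := cxiMk_surjective h P b hn ξ x
  rw [cxiMk_eq, h1, ← hc, ← hc, ← map_mul, ← map_add]
  exact ⟨_, rfl⟩

variable {ξ ξ'} in
/-- If `ξ` and `ξ'` agree modulo `[Δ]`, their difference is a coboundary of the mapping cone. -/
theorem exists_coneD_eq (hξ : xiClass h P b hn ξ = xiClass h P b hn ξ') :
    ∃ w ∈ A.coneGr n (2 * n - 3), P.coneD b w = ((ξ : A.tensor A) - ξ', 0) := by
  have hn3 := P.three_le h hn
  have h1 := (Submodule.Quotient.eq _).1 hξ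
  obtain ⟨a, ha⟩ := Ideal.mem_span_singleton'.1 h1
  obtain ⟨⟨z, hz⟩, rfl⟩ := Ideal.Quotient.mk_surjective a
  obtain ⟨y, hy⟩ := cls_eq_cls_iff.1
    (ha : (A.tensor A).cls (⟨z, hz⟩ * ⟨P.diag b, P.d_diag b⟩) =
      (A.tensor A).cls (⟨ξ, P.d_eq_zero h hn ξ⟩ - ⟨ξ', P.d_eq_zero h hn ξ'⟩))
  have hy' : (A.tensor A).d y = z * P.diag b - ((ξ : A.tensor A) - ξ') := hy
  -- Neither the multiplier `z` nor the primitive `y` is homogeneous a priori. Taking the degree `2n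
  -- - 2` part of the relation keeps only their components in degrees `n - 2` and `2n - 3`.
  have h2 : (ξ : A.tensor A) - ξ' = (A.tensor A).proj (n - 2) z * P.diag b -
      (A.tensor A).d ((A.tensor A).proj (2 * n - 3) y) := by
    rw [← proj_succ_d, hy', ← proj_mul_of_mem _ z (P.diag_mem b), map_sub]
    have e1 : n - 2 + n = 2 * n - 2 := by omega
    have e2 : 2 * n - 3 + 1 = 2 * n - 2 := by omega
    rw [e1, e2, (A.tensor A).proj_same (sub_mem ξ.2 ξ'.2), sub_sub_cancel]
  have hz0 := (A.tensor A).proj_mem (n - 2) z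
  -- Up to sign, `zΔ` is `Δ(1 ⊗ m(z))`, the cone differential's contribution from `ss^{-n} m(z)`;
  -- moreover `d m(z) = m(dz) = 0`.
  rw [(A.tensor A).graded_comm hz0 (P.diag_mem b), P.diag_mul] at h2
  refine ⟨(-(A.tensor A).proj (2 * n - 3) y,
    (-1 : ℚ) ^ ((n - 2) * n) • A.m ((A.tensor A).proj (n - 2) z)), mem_coneGr.2
    ⟨neg_mem ((A.tensor A).proj_mem _ _),
      shift_mem (Submodule.smul_mem _ _ (A.m_mem hz0)) (by omega)⟩, ?_⟩
  rw [P.coneD_apply b hn, h2]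
  refine Prod.ext ?_ ?_
  · simp only [← otₗ_apply, map_smul, map_neg, mul_smul_comm]
    abel
  · simp only [map_smul, ← m_d, (A.tensor A).d_proj_eq_zero hz, map_zero, smul_zero]

/-- Factors of degree 0 are scalars, factors of degree 1 vanish, and a factor of degree at least 2
sends `x` into degree at least `2n - 1`, where `C(ξ)` is zero. Hence elements of degree at least `2n
- 3` span ideals. -/
theorem mul_mem_of_mem_gr {j : ℕ} (hj : 2 * n - 3 ≤ j) {x : Cxi h P b hn ξ}
    (hx : x ∈ (Cxi h P b hn ξ).gr j) {S : Submodule ℚ (Cxi h P b hn ξ)} (hS : x ∈ S)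
    (a : Cxi h P b hn ξ) : a * x ∈ S ∧ x * a ∈ S := by
  have key : ∀ k, ∀ a ∈ (Cxi h P b hn ξ).gr k, a * x ∈ S := by
    intro k a ha
    rcases Nat.lt_or_ge k 2 with hk | hk
    · interval_cases k
      · have hn3 := P.three_le h hn
        obtain ⟨z, hz, rfl⟩ := exists_toCxi h P b hn ξ (by omega) ha
        obtain ⟨c, rfl⟩ := h.tensor_gr_zero hz
        rw [AlgHom.commutes, ← Algebra.smul_def]
        exact Submodule.smul_mem _ _ hS
      · rw [cxi_gr_one h P b hn ξ ha, zero_mul]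
        exact zero_mem _
    · rw [cxi_gr_eq_zero h P b hn ξ (by omega) ((Cxi h P b hn ξ).mul_mem ha hx rfl)]
      exact zero_mem _
  have h1 : (⊤ : Submodule ℚ (Cxi h P b hn ξ)) ≤
      S.comap ((LinearMap.mul ℚ (Cxi h P b hn ξ)).flip x) := by
    rw [← iSup_gr]
    exact iSup_le fun k a ha => key k a ha
  have h2 : (⊤ : Submodule ℚ (Cxi h P b hn ξ)) ≤
      S.comap (LinearMap.mul ℚ (Cxi h P b hn ξ) x) := by
    rw [← iSup_gr]
    refine iSup_le fun k a ha => ?_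
    change x * a ∈ S
    rw [(Cxi h P b hn ξ).graded_comm hx ha]
    exact Submodule.smul_mem _ _ (key k a ha)
  exact ⟨h1 trivial, h2 trivial⟩

-- The two products differ by multiples of `ξ - ξ'`, which is a coboundary `dω` of the common
-- complex. The span of `ω` and `dω` serves as the acyclic ideal.
variable {ξ ξ'} in
theorem spanUnder_of_xiClass_eq (hξ : xiClass h P b hn ξ = xiClass h P b hn ξ') :
    SpanUnder (toCxi h P b hn ξ) (toCxi h P b hn ξ') := by
  obtain ⟨ω, hω, hd, hd0⟩ : ∃ ω ∈ (Cxi h P b hn ξ').gr (2 * n - 3),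
      (Cxi h P b hn ξ').d ω = cxiMk h P b hn ξ' ((ξ : A.tensor A) - ξ', 0) ∧
      ((Cxi h P b hn ξ').d ω = 0 → ω = 0) := by
    -- When the difference vanishes, `ω` is taken to be zero. A nonzero closed `ω` would spoil the
    -- acyclicity of the ideal.
    by_cases h0 : cxiMk h P b hn ξ' ((ξ : A.tensor A) - ξ', 0) = 0
    · exact ⟨0, zero_mem _, by rw [map_zero, h0], fun _ => rfl⟩
    · obtain ⟨w, hw, e⟩ := exists_coneD_eq h P b hn hξ
      refine ⟨cxiMk h P b hn ξ' w, cxiMk_mem h P b hn ξ' hw, by rw [d_cxiMk, e], fun h1 => ?_⟩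
      rw [d_cxiMk, e] at h1
      exact absurd h1 h0
  let C := Cxi h P b hn ξ'
  let W : Submodule ℚ C := Submodule.span ℚ {ω, C.d ω}
  have hωW : ω ∈ W := Submodule.subset_span (by simp)
  have hdW : C.d ω ∈ W := Submodule.subset_span (by simp)
  have hdω : C.d ω ∈ C.gr (2 * n - 3 + 1) := C.d_mem hω
  have hWle : ∀ {S : Submodule ℚ C}, ω ∈ S → C.d ω ∈ S → W ≤ S := by
    intro S h1 h2
    refine Submodule.span_le.2 ?_
    rintro x (rfl | rfl)
    · exact h1
    · exact h2
  -- Grading, differential and unit do not depend on `ξ`, so the identity map serves.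
  let θ : Cxi h P b hn ξ ≃ₗ[ℚ] C := LinearEquiv.refl ℚ (A.ConeQuot n)
  have hθ : ∀ e, θ (cxiMk h P b hn ξ e) = cxiMk h P b hn ξ' e := fun _ => rfl
  refine spanUnder_of_mul_congr θ (fun _ _ ha => ha) (fun _ => rfl) rfl W ?_ ?_ ?_ ?_ ?_ ?_
    (fun _ => rfl)
  · intro a
    exact hWle (S := W.comap (LinearMap.mul ℚ C a))
      (mul_mem_of_mem_gr h P b hn ξ' le_rfl hω hωW a).1
      (mul_mem_of_mem_gr h P b hn ξ' (Nat.le_succ _) hdω hdW a).1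
  · intro a
    exact hWle (S := W.comap ((LinearMap.mul ℚ C).flip a))
      (mul_mem_of_mem_gr h P b hn ξ' le_rfl hω hωW a).2
      (mul_mem_of_mem_gr h P b hn ξ' (Nat.le_succ _) hdω hdW a).2
  · intro k
    have hk : ∀ {j : ℕ} {x : C}, x ∈ C.gr j → x ∈ W → C.proj k x ∈ W := by
      intro j x hx hxW
      by_cases hj : j = k
      · subst hj
        rwa [C.proj_same hx]
      · rw [C.proj_ne hj hx]
        exact zero_mem _
    exact hWle (S := W.comap (C.proj k)) (hk hω hωW) (hk hdω hdW)
  · refine hWle (S := W.comap C.d) hdW ?_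
    rw [Submodule.mem_comap, C.d_d]
    exact zero_mem _
  · intro x hx hx0
    obtain ⟨c, c', rfl⟩ := Submodule.mem_span_pair.1 hx
    rw [map_add, map_smul, map_smul, C.d_d, smul_zero, add_zero] at hx0
    -- A cocycle `c ω + c' dω` has `c dω = 0`. Either `c = 0` and `c' ω` is a primitive, or `dω =
    -- 0`, so `ω = 0` and the element itself is zero.
    rcases smul_eq_zero.1 hx0 with hc | hc
    · exact ⟨c' • ω, Submodule.smul_mem _ _ hωW, by rw [hc, map_smul, zero_smul, zero_add]⟩
    · exact ⟨0, zero_mem _, by rw [hc, hd0 hc, smul_zero, smul_zero, map_zero, add_zero]⟩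
  · intro x y
    obtain ⟨e, rfl⟩ := cxiMk_surjective h P b hn ξ x
    obtain ⟨f, rfl⟩ := cxiMk_surjective h P b hn ξ y
    have e1 : coneMul h ξ e f - coneMul h ξ' e f =
        (h.aug e.2 * h.aug f.2) • ((ξ : A.tensor A) - ξ', (0 : A)) := by
      rw [coneMul_apply, coneMul_apply]
      refine Prod.ext ?_ ?_
      · simp only [Prod.fst_sub, Prod.smul_fst, smul_sub]
        abel
      · simp
    rw [cxiMk_mul, hθ, hθ, hθ, cxiMk_mul, ← map_sub, e1, map_smul, ← hd]
    exact Submodule.smul_mem _ _ hdW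

theorem weakEquivUnder_of_xiClass_eq (hξ : xiClass h P b hn ξ = xiClass h P b hn ξ') :
    WeakEquivUnder (toCxi h P b hn ξ) (toCxi h P b hn ξ') :=
  (spanUnder_of_xiClass_eq h P b hn hξ).weakEquivUnder h.tensor (cxi_cohConnected h P b hn ξ)

/-- Only transitivity needs an argument: the two Sullivan algebras over the middle `C(ξ₂)` are glued
by a fibre product, which is a span because both maps to `C(ξ₂)` are onto. A new Sullivan model is
then taken. -/
theorem weakEquivUnder_equivalence : Equivalence fun ξ ξ' : (A.tensor A).gr (2 * n - 2) =>
    WeakEquivUnder (toCxi h P b hn ξ) (toCxi h P b hn ξ') where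
  refl ξ := weakEquivUnder_of_xiClass_eq h P b hn ξ ξ rfl
  symm := by
    rintro ξ ξ' ⟨M, i, α, β, hi, hα, hβ, hf, hg⟩
    exact ⟨M, i, β, α, hi, hβ, hα, hg, hf⟩
  trans := by
    rintro ξ₁ ξ₂ ξ₃ ⟨M, i, α, β, -, hα, hβ, hf, hg⟩ ⟨M', i', α', β', -, hα', hβ', hf', hg'⟩
    obtain ⟨E, j, γ, γ', hγ, hγ', hj, hj'⟩ := spanUnder_of_surjective hβ hα'
      (surjective_of_isQuasiIso h P b hn ξ₂ hβ hg)
      (surjective_of_isQuasiIso h P b hn ξ₂ hα' hf') fun r => (hg r).trans (hf' r).symm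
    refine SpanUnder.weakEquivUnder ⟨E, j, α.comp γ, β'.comp γ', hα.comp hγ, hβ'.comp hγ',
      fun r => ?_, fun r => ?_⟩ h.tensor (cxi_cohConnected h P b hn ξ₁)
    · rw [Hom.comp_apply, hj, hf]
    · rw [Hom.comp_apply, hj', hg']

/-- Every class in `H^{2n-2}(A ⊗ A) / ([Δ])` is the class of some `ξ`. -/
theorem xiClass_surjective : Function.Surjective (xiClass h P b hn) := by
  intro x
  obtain ⟨⟨_, z, hz, rfl⟩, rfl⟩ := Submodule.Quotient.mk_surjective _ x
  exact ⟨⟨z, hz⟩, rfl⟩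

end cxi

end CDGA

/-! ### The surjection `ψ`. -/

theorem mainTheorem6 {n N : ℕ} (hn : Odd n) (A : CDGA.{u}) (h : A.OneConnected)
    (P : A.PoincareDuality n) (b : A.HomogeneousBasis N) :
    (∀ ξ ξ' : (A.tensor A).gr (2 * n - 2),
      CDGA.xiClass h P b hn ξ = CDGA.xiClass h P b hn ξ' →
        CDGA.WeakEquivUnder (CDGA.toCxi h P b hn ξ) (CDGA.toCxi h P b hn ξ')) ∧
    ∃ hE : Equivalence fun ξ ξ' : (A.tensor A).gr (2 * n - 2) =>
        CDGA.WeakEquivUnder (CDGA.toCxi h P b hn ξ) (CDGA.toCxi h P b hn ξ'),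
      ∃ ψ : (A.tensor A).HgrMod (2 * n - 2) ((A.tensor A).cls ⟨P.diag b, P.d_diag b⟩) →
          Quotient (Setoid.mk _ hE),
        (∀ ξ, ψ (CDGA.xiClass h P b hn ξ) = Quotient.mk (Setoid.mk _ hE) ξ) ∧
        Function.Surjective ψ := by
  have hw := CDGA.weakEquivUnder_of_xiClass_eq h P b hn
  have hE := CDGA.weakEquivUnder_equivalence h P b hn
  have hs := CDGA.xiClass_surjective h P b hn
  -- The map `ψ` is defined by choosing a representative of each class; `hw` shows that its value
  -- does not depend on the choice.
  have hψ : ∀ ξ, Quotient.mk (Setoid.mk _ hE)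
      (Function.surjInv hs (CDGA.xiClass h P b hn ξ)) = Quotient.mk (Setoid.mk _ hE) ξ :=
    fun ξ => Quotient.sound (hw _ _ (Function.surjInv_eq hs _))
  refine ⟨hw, hE, fun x => Quotient.mk _ (Function.surjInv hs x), hψ, fun q => ?_⟩
  obtain ⟨ξ, rfl⟩ := Quotient.exists_rep q
  exact ⟨_, hψ ξ⟩
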